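/- Two players, AND and OR, take part in two simultaneous first-price auctions, one for each of two items. AND has value $1$ if it wins both items and $0$ otherwise; OR has value $v>1/2$ if it wins at least one item and $0$ otherwise. Each player submits a pair of bids in $[0,H]^2$, where $H>1/2$ is the maximum allowed bid; on each item the higher bidder wins and pays its own bid, and utilities are value minus payment. Ties are broken by a fixed, possibly randomized rule: when both bid $b$ on item $i$, AND wins item $i$ with a probability $q_i(b)$ that depends only on the item and on the bid $b$, independently across items. Mixed strategies are Borel probability measures on $[0,H]^2$, which we identify with their cumulative distribution functions, and the players randomize independently. Let $F_{or}^*$ be the strategy in which OR bids $(x,0)$ or $(0,x)$ with probability $1/2$ each, where $x\in[0,1/2]$ has distribution function $x/(1-x)$. Let $F_{and}^*$ be the strategy in which AND bids $(y,y)$, where $y\in[0,1/2]$ has distribution function $(v-1/2)/(v-y)$; thus $F_{and}^*(x,y)=(v-1/2)/(v-\min(x,y))$ for $x,y\in[0,1/2]$. Then, for every such tie-breaking rule, $(F_{and}^*,F_{or}^*)$ is a mixed Nash equilibrium, and a pair of mixed strategies $(F_{and},F_{or})$ is a mixed Nash equilibrium if and only if 1. $F_{or}=F_{or}^*$, and 2.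 $F_{and}$ has the same marginals as $F_{and}^*$, i.e. $F_{and}(x,H)=F_{and}^*(x,H)$ and $F_{and}(H,y)=F_{and}^*(H,y)$ for all $x,y\in[0,H]$, and the same mass at the origin, $F_{and}(0,0)=F_{and}^*(0,0)$. Moreover, for every mixed Nash equilibrium $(F_{and},F_{or})$, the strategy $F_{and}$ is weakly dominated by $F_{and}^*$: against every mixed strategy of OR, AND's expected utility from $F_{and}$ is at most its expected utility from $F_{and}^*$, and if $F_{and}\ne F_{and}^*$ it is strictly smaller against some mixed strategy of OR. Furthermore, the following are the same under $(F_{and},F_{or})$ as under $(F_{and}^*,F_{or}^*)$ with the same tie-breaking rule: the probability of each player winning each bundle of items, the expected payment and the expected utility of each player, the expected revenue and the expected social welfare. -/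

import Mathlib

open MeasureTheory

noncomputable section

namespace AndOr

/-- A pair of bids, one for each of the two items `0` and `1`. -/
abbrev Bid : Type := Fin 2 → ℝ

/-- A (randomized) tie-breaking rule: `andWins i b` is the probability that the `AND` player wins
item `i` when both players bid `b` on it. It depends only on the item and on the bid placed on that
item; ties on different items are broken independently. -/
structure TieRule where
  andWins : Fin 2 → ℝ → ℝ
  measurable : ∀ i, Measurable (andWins i)
  mem_Icc : ∀ i b, andWins i b ∈ Set.Icc (0 : ℝ) 1

/-- Probability that `AND` wins item `i` when `AND` bids `a` and `OR` bids `o` on this item. -/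
def andWinsItem (τ : TieRule) (i : Fin 2) (a o : ℝ) : ℝ :=
  if o < a then 1 else if a = o then τ.andWins i a else 0

/-- Probability that, at the bids `a` of `AND` and `o` of `OR`, the set of items won by `AND` is
exactly `S` (so that `OR` wins exactly `Sᶜ`). -/
def outcomeProb (τ : TieRule) (a o : Bid) (S : Finset (Fin 2)) : ℝ :=
  ∏ i, if i ∈ S then andWinsItem τ i (a i) (o i) else 1 - andWinsItem τ i (a i) (o i)

/-- The valuation of `AND`: value `1` for both items, `0` for any other bundle. -/
def valueAnd (S : Finset (Fin 2)) : ℝ := if S = Finset.univ then 1 else 0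

/-- The valuation of `OR`: value `v` for any nonempty bundle, `0` for the empty one. -/
def valueOr (v : ℝ) (T : Finset (Fin 2)) : ℝ := if T.Nonempty then v else 0

/-- First-price payment of a player who bids `b` and wins the bundle `S`. -/
def pay (b : Bid) (S : Finset (Fin 2)) : ℝ := ∑ i ∈ S, b i

/-- A mixed strategy with maximum allowed bid `H`: a Borel probability law on `[0, H]²`. -/
def IsMixedStrategy (H : ℝ) (F : Measure Bid) : Prop :=
  IsProbabilityMeasure F ∧ ∀ᵐ b ∂F, ∀ i, b i ∈ Set.Icc (0 : ℝ) H

/-- Expectation of a quantity `f a o S` depending on the bids `a` of `AND`, the bids `o` of `OR`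
and the bundle `S` won by `AND`, when the players independently use the mixed strategies `F` and
`G` and ties are broken according to `τ`. -/
def expect (τ : TieRule) (F G : Measure Bid) (f : Bid → Bid → Finset (Fin 2) → ℝ) : ℝ :=
  ∫ p, ∑ S, outcomeProb τ p.1 p.2 S * f p.1 p.2 S ∂(F.prod G)

/-- Probability that `AND` wins exactly the bundle `S`. -/
def bundleProbAnd (τ : TieRule) (F G : Measure Bid) (S : Finset (Fin 2)) : ℝ :=
  expect τ F G fun _ _ S' => if S' = S then 1 else 0

/-- Probability that `OR` wins exactly the bundle `T`. -/
def bundleProbOr (τ : TieRule) (F G : Measure Bid) (T : Finset (Fin 2)) : ℝ :=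
  expect τ F G fun _ _ S' => if S'ᶜ = T then 1 else 0

def paymentAnd (τ : TieRule) (F G : Measure Bid) : ℝ :=
  expect τ F G fun a _ S => pay a S

def paymentOr (τ : TieRule) (F G : Measure Bid) : ℝ :=
  expect τ F G fun _ o S => pay o Sᶜ

def utilityAnd (τ : TieRule) (F G : Measure Bid) : ℝ :=
  expect τ F G fun a _ S => valueAnd S - pay a S

def utilityOr (v : ℝ) (τ : TieRule) (F G : Measure Bid) : ℝ :=
  expect τ F G fun _ o S => valueOr v Sᶜ - pay o Sᶜ

/-- Expected revenue of the auctioneer. -/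
def revenue (τ : TieRule) (F G : Measure Bid) : ℝ :=
  expect τ F G fun a o S => pay a S + pay o Sᶜ

/-- Expected social welfare. -/
def welfare (v : ℝ) (τ : TieRule) (F G : Measure Bid) : ℝ :=
  expect τ F G fun _ _ S => valueAnd S + valueOr v Sᶜ

/-- `(F, G)` is a mixed Nash equilibrium of the game with value `v`, maximum allowed bid `H` and
tie-breaking rule `τ`. -/
def IsNashEquilibrium (v H : ℝ) (τ : TieRule) (F G : Measure Bid) : Prop :=
  IsMixedStrategy H F ∧ IsMixedStrategy H G ∧
  (∀ F', IsMixedStrategy H F' → utilityAnd τ F' G ≤ utilityAnd τ F G) ∧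
  (∀ G', IsMixedStrategy H G' → utilityOr v τ F G' ≤ utilityOr v τ F G)

/-- The strategy `F` of `AND` is weakly dominated by `F'`: against every strategy of `OR`, `F'` is
at least as good as `F`. -/
def WeaklyDominatedAnd (H : ℝ) (τ : TieRule) (F F' : Measure Bid) : Prop :=
  ∀ G', IsMixedStrategy H G' → utilityAnd τ F G' ≤ utilityAnd τ F' G'

/-- The two-dimensional cumulative distribution function of a bid distribution. -/
def jointCDF (F : Measure Bid) (x y : ℝ) : ℝ := F.real {b | b 0 ≤ x ∧ b 1 ≤ y}

/-- The law on `[0, 1/2]` with distribution function `y ↦ (v - 1/2) / (v - y)`: an atom of mass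
`1 - 1/(2v)` at `0`, and density `(v - 1/2) / (v - y)²` on `(0, 1/2]`. -/
def andLaw (v : ℝ) : Measure ℝ :=
  ENNReal.ofReal (1 - 1 / (2 * v)) • Measure.dirac 0 +
    (volume.restrict (Set.Ioc (0 : ℝ) (1 / 2))).withDensity
      fun y => ENNReal.ofReal ((v - 1 / 2) / (v - y) ^ 2)

/-- The law on `[0, 1/2]` with distribution function `x ↦ x / (1 - x)`: it has density
`1 / (1 - x)²` on `(0, 1/2]`. -/
def orLaw : Measure ℝ :=
  (volume.restrict (Set.Ioc (0 : ℝ) (1 / 2))).withDensity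
    fun x => ENNReal.ofReal (1 / (1 - x) ^ 2)

/-- `AND` bids `(y, y)` with `y` drawn from `andLaw v`. -/
def andStar (v : ℝ) : Measure Bid := (andLaw v).map fun y => ![y, y]

/-- `OR` bids `(x, 0)` or `(0, x)`, each with probability `1/2`, with `x` drawn from `orLaw`. -/
def orStar : Measure Bid :=
  (1 / 2 : ENNReal) • orLaw.map (fun x => ![x, 0]) +
    (1 / 2 : ENNReal) • orLaw.map (fun x => ![0, x])

theorem setIntegral_density {c v x : ℝ} (hx : 0 ≤ x) (hxv : x < v) :
    ∫ y in Set.Ioc 0 x, c / (v - y) ^ 2 = c / (v - x) - c / v := by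
  rw [← intervalIntegral.integral_of_le hx]
  have hne : ∀ y ∈ Set.uIcc 0 x, v - y ≠ 0 := by
    intro y hy
    rw [Set.uIcc_of_le hx] at hy
    have := hy.2
    intro h
    linarith
  have h := intervalIntegral.integral_eq_sub_of_hasDerivAt
    (f := fun y => c / (v - y)) (f' := fun y => c / (v - y) ^ 2) (a := 0) (b := x)
    (fun y hy => by
      have h1 : HasDerivAt (fun y => v - y) (-1) y := by
        simpa using (hasDerivAt_id y).const_sub v
      have h2 := (h1.inv (hne y hy)).const_mul c
      have h3 : c * (- -1 / (v - y) ^ 2) = c / (v - y) ^ 2 := by ring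
      rw [h3] at h2
      simpa only [div_eq_mul_inv, Pi.inv_apply] using h2)
    (by
      apply ContinuousOn.intervalIntegrable
      intro y hy
      have := hne y hy
      apply ContinuousAt.continuousWithinAt
      fun_prop (disch := positivity))
  simpa using h

theorem density_Iic {c v x : ℝ} (hc : 0 ≤ c) (hx : 0 ≤ x) (hx2 : x ≤ 1 / 2) (hxv : x < v) :
    (volume.restrict (Set.Ioc (0 : ℝ) (1 / 2))).withDensity
      (fun y => ENNReal.ofReal (c / (v - y) ^ 2)) (Set.Iic x)
      = ENNReal.ofReal (c / (v - x) - c / v) := by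
  rw [withDensity_apply _ measurableSet_Iic, Measure.restrict_restrict measurableSet_Iic]
  have hs : Set.Iic x ∩ Set.Ioc (0 : ℝ) (1 / 2) = Set.Ioc 0 x := by
    ext y
    simp only [Set.mem_inter_iff, Set.mem_Iic, Set.mem_Ioc]
    constructor
    · rintro ⟨h1, h2, _⟩; exact ⟨h2, h1⟩
    · rintro ⟨h1, h2⟩; exact ⟨h2, h1, h2.trans hx2⟩
  rw [hs, ← ofReal_integral_eq_lintegral_ofReal, setIntegral_density hx hxv]
  · have hcont : ContinuousOn (fun y => c / (v - y) ^ 2) (Set.Icc 0 x) := by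
      intro y hy
      have : v - y ≠ 0 := by
        have := hy.2
        intro h
        linarith
      apply ContinuousAt.continuousWithinAt
      fun_prop (disch := positivity)
    exact (hcont.integrableOn_Icc).mono_set Set.Ioc_subset_Icc_self
  · exact Filter.Eventually.of_forall fun y => by positivity

theorem andLaw_Iic {v x : ℝ} (hv : 1 / 2 < v) (hx : 0 ≤ x) (hx2 : x ≤ 1 / 2) :
    andLaw v (Set.Iic x) = ENNReal.ofReal ((v - 1 / 2) / (v - x)) := by
  have hv0 : 0 < v := by linarith
  have hvx : 0 < v - x := by linarith
  have h1 : (0 : ℝ) ≤ 1 - 1 / (2 * v) := by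
    rw [sub_nonneg, div_le_one (by positivity)]
    linarith
  rw [andLaw, Measure.add_apply, Measure.smul_apply, Measure.dirac_apply' _ measurableSet_Iic,
    density_Iic (by linarith) hx hx2 (by linarith)]
  have h2 : (0 : ℝ) ≤ (v - 1 / 2) / (v - x) - (v - 1 / 2) / v := by
    rw [sub_nonneg]
    apply div_le_div_of_nonneg_left <;> linarith
  simp only [Set.mem_Iic, hx, Set.indicator_of_mem, Pi.one_apply, smul_eq_mul, mul_one]
  rw [← ENNReal.ofReal_add h1 h2]
  congr 1
  field_simp
  ring

theorem orLaw_Iic {x : ℝ} (hx : 0 ≤ x) (hx2 : x ≤ 1 / 2) :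
    orLaw (Set.Iic x) = ENNReal.ofReal (x / (1 - x)) := by
  rw [orLaw, density_Iic (by norm_num) hx hx2 (by linarith)]
  have : 1 - x ≠ 0 := by linarith
  congr 1
  field_simp
  ring

/-- The distribution function of `andStar v` on `[0, 1/2]²`. -/
theorem jointCDF_andStar {v x y : ℝ} (hv : 1 / 2 < v) (hx : x ∈ Set.Icc (0 : ℝ) (1 / 2))
    (hy : y ∈ Set.Icc (0 : ℝ) (1 / 2)) :
    jointCDF (andStar v) x y = (v - 1 / 2) / (v - min x y) := by
  have hm : Measurable fun y : ℝ => (![y, y] : Bid) := by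
    rw [measurable_pi_iff]
    intro i
    fin_cases i <;> exact measurable_id
  have hS : MeasurableSet {b : Bid | b 0 ≤ x ∧ b 1 ≤ y} :=
    (measurableSet_le (measurable_pi_apply 0) measurable_const).inter
      (measurableSet_le (measurable_pi_apply 1) measurable_const)
  have h0 : 0 ≤ min x y := le_min hx.1 hy.1
  have h1 : min x y ≤ 1 / 2 := (min_le_left _ _).trans hx.2
  have hpre : (fun y : ℝ => (![y, y] : Bid)) ⁻¹' {b : Bid | b 0 ≤ x ∧ b 1 ≤ y}
      = Set.Iic (min x y) := by
    ext z
    simp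
  rw [jointCDF, Measure.real, andStar, Measure.map_apply hm hS, hpre, andLaw_Iic hv h0 h1,
    ENNReal.toReal_ofReal]
  apply div_nonneg <;> linarith

/-- The distribution function of `orStar` on `[0, 1/2]²`. -/
theorem jointCDF_orStar {x y : ℝ} (hx : x ∈ Set.Icc (0 : ℝ) (1 / 2))
    (hy : y ∈ Set.Icc (0 : ℝ) (1 / 2)) :
    jointCDF orStar x y = (x / (1 - x) + y / (1 - y)) / 2 := by
  have hm1 : Measurable fun y : ℝ => (![y, 0] : Bid) := by
    rw [measurable_pi_iff]
    intro i
    fin_cases i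
    · exact measurable_id
    · exact measurable_const
  have hm2 : Measurable fun y : ℝ => (![0, y] : Bid) := by
    rw [measurable_pi_iff]
    intro i
    fin_cases i
    · exact measurable_const
    · exact measurable_id
  have hS : MeasurableSet {b : Bid | b 0 ≤ x ∧ b 1 ≤ y} :=
    (measurableSet_le (measurable_pi_apply 0) measurable_const).inter
      (measurableSet_le (measurable_pi_apply 1) measurable_const)
  have hp1 : (fun y : ℝ => (![y, 0] : Bid)) ⁻¹' {b : Bid | b 0 ≤ x ∧ b 1 ≤ y}
      = Set.Iic x := by
    ext z
    simp [hy.1]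
  have hp2 : (fun y : ℝ => (![0, y] : Bid)) ⁻¹' {b : Bid | b 0 ≤ x ∧ b 1 ≤ y}
      = Set.Iic y := by
    ext z
    simp [hx.1]
  have hx0 : 0 ≤ x / (1 - x) := div_nonneg hx.1 (by linarith [hx.2])
  have hy0 : 0 ≤ y / (1 - y) := div_nonneg hy.1 (by linarith [hy.2])
  rw [jointCDF, Measure.real, orStar, Measure.add_apply, Measure.smul_apply, Measure.smul_apply,
    Measure.map_apply hm1 hS, Measure.map_apply hm2 hS, hp1, hp2, orLaw_Iic hx.1 hx.2,
    orLaw_Iic hy.1 hy.2, smul_eq_mul, smul_eq_mul, ENNReal.toReal_add, ENNReal.toReal_mul,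
    ENNReal.toReal_mul, ENNReal.toReal_ofReal hx0, ENNReal.toReal_ofReal hy0]
  · simp
    ring
  · exact ENNReal.mul_ne_top (by simp) ENNReal.ofReal_ne_top
  · exact ENNReal.mul_ne_top (by simp) ENNReal.ofReal_ne_top

end AndOr

end

/-!
Write `w i` for the probability that `AND` wins item `i` and `α`, `β` for the payoffs of `AND` and
`OR` in an equilibrium.

*Sufficiency.* Against `orStar`, a bid `a ≥ 0` of `AND` yields at most `a i - a j` in the event that
`OR` bids on item `i`, so nothing on average; against a strategy with the marginals of `andStar v`,
one item won at the price `x ≤ 1/2` yields exactly `v - 1/2`, and bidding on both items is spoilt by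
the atom of `AND` at the origin. As `OR` bids on one item only and the two bids of `AND` vanish
together, `AND` wins both items exactly when it wins the item on which `OR` bids. Hence all expected
quantities depend on the marginals only (`HasStarMarginals.expect_orStar`). For given marginals,
equal bids maximize the probability of winning both items, which gives weak dominance; the masses of
quadrants are payoffs against pure bids up to terms depending on the marginals, so another strategy
is strictly worse against some pure bid.

*Necessity.* The payoff of `AND` is supermodular in its bids (`payoffAnd_supermodular`). So best
responses of `AND` are closed under meets and joins, and against almost every bid of `OR` the sets
of bids of `AND` losing item `0` and item `1` are nested. Passing to extreme bids of `AND` has two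
consequences. The bids of both players cannot reach up to a common level above `1/2` on both items
(`false_of_common_top`). And the lowest bids of `AND` never win both items, so `α = 0`
(`utilityAnd_eq_zero_and`). By nestedness, a second bid of `OR` never helps, so `OR` does not bid
above `v - β` on either item (`ae_or_le`), hence neither does `AND`, and this common level has to
be `1/2`, that is `β = v - 1/2` (`utilityOr_eq_sub_half`).

Comparing with bids just above `x` shows that the bids on each item stochastically dominate those of
`andStar v` and `orStar`. On the other hand, in `v * payoffAnd + payoffOr` the products `w 0 * w 1`
cancel, and what is left is `v` minus a sum of one term for each item, its `transfer`. The expected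
transfers have the same sum `v - (v * α + β) = 1/2` in every equilibrium, while they are strictly
increasing with respect to stochastic dominance (`lintegral_transfer_le`). So the marginals are
those of `andStar v` and `orStar`. Finally, bids just above `(0, 0)` yield a bound for each player:
`OR` never bids `0` on both items, so exactly one of its bids is `0`, which determines its strategy;
and `AND` has all of the mass at `0` of its marginals at the origin.

A bid cannot be raised above `H`, and ties are randomized, so payoffs from bids just above `x` are
used as limits (`overbid`), the bid `H` is treated by `sub_le_utilityOr`, and `limitWin` records how
ties at an extreme bid are resolved in the limit.
-/

noncomputable section

namespace AndOr

open Filter Topology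

/-! ### Pointwise payoffs -/

section Pointwise

variable (τ : TieRule) (i : Fin 2)

theorem andWinsItem_of_lt {a o : ℝ} (h : o < a) : andWinsItem τ i a o = 1 := by
  simp [andWinsItem, h]

theorem andWinsItem_of_gt {a o : ℝ} (h : a < o) : andWinsItem τ i a o = 0 := by
  simp [andWinsItem, h.not_gt, h.ne]

theorem andWinsItem_self (a : ℝ) : andWinsItem τ i a a = τ.andWins i a := by
  simp [andWinsItem]

theorem andWinsItem_nonneg (a o : ℝ) : 0 ≤ andWinsItem τ i a o := by
  unfold andWinsItem
  split_ifs
  exacts [zero_le_one, (τ.mem_Icc i a).1, le_rfl]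

theorem andWinsItem_le_one (a o : ℝ) : andWinsItem τ i a o ≤ 1 := by
  unfold andWinsItem
  split_ifs
  exacts [le_rfl, (τ.mem_Icc i a).2, zero_le_one]

theorem andWinsItem_mono (o : ℝ) : Monotone fun a => andWinsItem τ i a o := by
  intro a b hab
  rcases lt_trichotomy a o with h | h | h
  · simpa [andWinsItem_of_gt τ i h] using andWinsItem_nonneg τ i b o
  · rcases hab.lt_or_eq with h' | h'
    · simpa [andWinsItem_of_lt τ i (h ▸ h')] using andWinsItem_le_one τ i a o
    · rw [h']
  · simp [andWinsItem_of_lt τ i h, andWinsItem_of_lt τ i (h.trans_le hab)]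

@[fun_prop]
theorem measurable_andWinsItem {X : Type*} [MeasurableSpace X] {f g : X → ℝ}
    (hf : Measurable f) (hg : Measurable g) : Measurable fun x => andWinsItem τ i (f x) (g x) := by
  unfold andWinsItem
  exact Measurable.ite (measurableSet_lt hg hf) measurable_const
    (Measurable.ite (measurableSet_eq_fun hf hg) ((τ.measurable i).comp hf) measurable_const)

end Pointwise

/-- The payoff of `AND` at a pure bid profile, averaged over the tie-breaking. -/
def payoffAnd (τ : TieRule) (a o : Bid) : ℝ :=
  ∏ i, andWinsItem τ i (a i) (o i) - ∑ i, a i * andWinsItem τ i (a i) (o i)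

/-- The payoff of `OR` at a pure bid profile, averaged over the tie-breaking. -/
def payoffOr (v : ℝ) (τ : TieRule) (a o : Bid) : ℝ :=
  v * (1 - ∏ i, andWinsItem τ i (a i) (o i)) - ∑ i, o i * (1 - andWinsItem τ i (a i) (o i))

theorem prod_of_ne {i j : Fin 2} (h : i ≠ j) (f : Fin 2 → ℝ) : ∏ k, f k = f i * f j := by
  fin_cases i <;> fin_cases j <;> simp_all [Fin.prod_univ_two, mul_comm]

theorem sum_of_ne {M : Type*} [AddCommMonoid M] {i j : Fin 2} (h : i ≠ j) (f : Fin 2 → M) :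
    ∑ k, f k = f i + f j := by
  fin_cases i <;> fin_cases j <;> simp_all [Fin.sum_univ_two, add_comm]

theorem eq_or_eq_of_ne {i j : Fin 2} (h : i ≠ j) (k : Fin 2) : k = i ∨ k = j := by
  omega

theorem exists_ne_fin_two (i : Fin 2) : ∃ j, i ≠ j := by
  fin_cases i
  exacts [⟨1, by decide⟩, ⟨0, by decide⟩]

theorem univ_finset_fin_two :
    (Finset.univ : Finset (Finset (Fin 2))) = {∅, {0}, {1}, Finset.univ} := by decide

theorem sum_finset_fin_two (f : Finset (Fin 2) → ℝ) :
    ∑ S, f S = f ∅ + f {0} + f {1} + f Finset.univ := by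
  rw [univ_finset_fin_two, Finset.sum_insert (by decide), Finset.sum_insert (by decide),
    Finset.sum_insert (by decide), Finset.sum_singleton]
  ring

section Outcome

variable (τ : TieRule) (a o : Bid)

theorem outcomeProb_univ : outcomeProb τ a o Finset.univ = ∏ i, andWinsItem τ i (a i) (o i) := by
  simp [outcomeProb]

theorem outcomeProb_empty : outcomeProb τ a o ∅ =
    1 - ∑ i, andWinsItem τ i (a i) (o i) + ∏ i, andWinsItem τ i (a i) (o i) := by
  simp [outcomeProb, Fin.prod_univ_two, Fin.sum_univ_two]
  ring

theorem outcomeProb_singleton (i : Fin 2) : outcomeProb τ a o {i} =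
    andWinsItem τ i (a i) (o i) - ∏ i, andWinsItem τ i (a i) (o i) := by
  fin_cases i <;> simp [outcomeProb, Fin.prod_univ_two] <;> ring

theorem compl_zero_fin_two : ({0} : Finset (Fin 2))ᶜ = {1} := by decide

theorem compl_one_fin_two : ({1} : Finset (Fin 2))ᶜ = {0} := by decide

theorem sum_outcomeProb_valueAnd : ∑ S, outcomeProb τ a o S * valueAnd S =
    ∏ i, andWinsItem τ i (a i) (o i) := by
  simp [valueAnd, outcomeProb_univ]

theorem sum_outcomeProb_valueOr (v : ℝ) : ∑ S, outcomeProb τ a o S * valueOr v Sᶜ =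
    v * (1 - ∏ i, andWinsItem τ i (a i) (o i)) := by
  rw [sum_finset_fin_two, compl_zero_fin_two, compl_one_fin_two]
  simp [valueOr, outcomeProb_singleton, outcomeProb_empty, Fin.sum_univ_two]
  ring

theorem sum_outcomeProb_payAnd : ∑ S, outcomeProb τ a o S * pay a S =
    ∑ i, a i * andWinsItem τ i (a i) (o i) := by
  simp [sum_finset_fin_two, pay, outcomeProb_singleton, outcomeProb_univ, Fin.sum_univ_two]
  ring

theorem sum_outcomeProb_payOr : ∑ S, outcomeProb τ a o S * pay o Sᶜ =
    ∑ i, o i * (1 - andWinsItem τ i (a i) (o i)) := by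
  rw [sum_finset_fin_two, compl_zero_fin_two, compl_one_fin_two]
  simp [pay, outcomeProb_singleton, outcomeProb_empty, Fin.sum_univ_two]
  ring

end Outcome

/-! ### Expected payoffs -/

theorem integrable_of_ae_abs_le {X : Type*} [MeasurableSpace X] {μ : Measure X}
    [IsFiniteMeasure μ] {f : X → ℝ} (hf : Measurable f) (C : ℝ) (h : ∀ᵐ x ∂μ, |f x| ≤ C) :
    Integrable f μ :=
  Integrable.of_bound hf.aestronglyMeasurable C (by simpa using h)

theorem abs_mul_le_of_mem {H x w : ℝ} (hx : x ∈ Set.Icc 0 H) (h0 : 0 ≤ w) (h1 : w ≤ 1) :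
    |x * w| ≤ H := by
  rw [abs_of_nonneg (mul_nonneg hx.1 h0)]
  nlinarith [hx.1, hx.2]

theorem prod_andWinsItem_nonneg (τ : TieRule) (a o : Bid) :
    0 ≤ ∏ i, andWinsItem τ i (a i) (o i) :=
  Finset.prod_nonneg fun i _ => andWinsItem_nonneg τ i _ _

theorem prod_andWinsItem_le (τ : TieRule) (a o : Bid) (i : Fin 2) :
    ∏ i, andWinsItem τ i (a i) (o i) ≤ andWinsItem τ i (a i) (o i) := by
  obtain ⟨j, hij⟩ := exists_ne_fin_two i
  rw [prod_of_ne hij]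
  exact mul_le_of_le_one_right (andWinsItem_nonneg _ _ _ _) (andWinsItem_le_one _ _ _ _)

theorem prod_andWinsItem_le_one (τ : TieRule) (a o : Bid) :
    ∏ i, andWinsItem τ i (a i) (o i) ≤ 1 :=
  (prod_andWinsItem_le τ a o 0).trans (andWinsItem_le_one _ _ _ _)

@[fun_prop]
theorem measurable_payoffAnd {X : Type*} [MeasurableSpace X] (τ : TieRule) {f g : X → Bid}
    (hf : Measurable f) (hg : Measurable g) : Measurable fun x => payoffAnd τ (f x) (g x) := by
  unfold payoffAnd
  fun_prop

@[fun_prop]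
theorem measurable_payoffOr {X : Type*} [MeasurableSpace X] (v : ℝ) (τ : TieRule) {f g : X → Bid}
    (hf : Measurable f) (hg : Measurable g) : Measurable fun x => payoffOr v τ (f x) (g x) := by
  unfold payoffOr
  fun_prop

theorem abs_payoffAnd_le {H : ℝ} (τ : TieRule) {a o : Bid} (ha : ∀ i, a i ∈ Set.Icc 0 H) :
    |payoffAnd τ a o| ≤ 1 + 2 * H := by
  have h (i) := abs_mul_le_of_mem (ha i) (andWinsItem_nonneg τ i (a i) (o i))
    (andWinsItem_le_one τ i (a i) (o i))
  have h0 := abs_le.1 (h 0)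
  have h1 := abs_le.1 (h 1)
  have h2 := prod_andWinsItem_nonneg τ a o
  have h3 := prod_andWinsItem_le_one τ a o
  unfold payoffAnd
  rw [Fin.sum_univ_two, abs_le]
  constructor <;> linarith

theorem abs_payoffOr_le {v H : ℝ} (hv : 0 ≤ v) (τ : TieRule) {a o : Bid}
    (ho : ∀ i, o i ∈ Set.Icc 0 H) : |payoffOr v τ a o| ≤ v + 2 * H := by
  have h (i) := abs_mul_le_of_mem (ho i) (sub_nonneg.2 (andWinsItem_le_one τ i (a i) (o i)))
    (sub_le_self 1 (andWinsItem_nonneg τ i (a i) (o i)))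
  have h0 := abs_le.1 (h 0)
  have h1 := abs_le.1 (h 1)
  have h2 := prod_andWinsItem_nonneg τ a o
  have h3 := prod_andWinsItem_le_one τ a o
  have h4 := mul_nonneg hv h2
  have h5 := mul_nonneg hv (sub_nonneg.2 h3)
  unfold payoffOr
  rw [Fin.sum_univ_two, abs_le]
  constructor <;> linarith

section Mixed

variable {v H : ℝ} {τ : TieRule} {F G : Measure Bid}

theorem ae_prod_fst [IsProbabilityMeasure F] [IsProbabilityMeasure G] {p : Bid → Prop}
    (h : ∀ᵐ a ∂F, p a) : ∀ᵐ x ∂(F.prod G), p x.1 :=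
  Measure.quasiMeasurePreserving_fst.ae h

theorem ae_prod_snd [IsProbabilityMeasure F] [IsProbabilityMeasure G] {p : Bid → Prop}
    (h : ∀ᵐ o ∂G, p o) : ∀ᵐ x ∂(F.prod G), p x.2 :=
  Measure.quasiMeasurePreserving_snd.ae h

theorem integrable_payoffAnd (hF : IsMixedStrategy H F) (hG : IsMixedStrategy H G) :
    Integrable (fun p : Bid × Bid => payoffAnd τ p.1 p.2) (F.prod G) := by
  have := hF.1
  have := hG.1
  refine integrable_of_ae_abs_le (by fun_prop) (1 + 2 * H) ?_
  filter_upwards [ae_prod_fst hF.2] with p hp using abs_payoffAnd_le τ hp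

theorem integrable_payoffOr (hv : 0 ≤ v) (hF : IsMixedStrategy H F) (hG : IsMixedStrategy H G) :
    Integrable (fun p : Bid × Bid => payoffOr v τ p.1 p.2) (F.prod G) := by
  have := hF.1
  have := hG.1
  refine integrable_of_ae_abs_le (by fun_prop) (v + 2 * H) ?_
  filter_upwards [ae_prod_snd hG.2] with p hp using abs_payoffOr_le hv τ hp

/-- Expected payoff of `AND` from the pure bid `a` against the mixed strategy `G`. -/
def pureAnd (τ : TieRule) (G : Measure Bid) (a : Bid) : ℝ := ∫ o, payoffAnd τ a o ∂G

/-- Expected payoff of `OR` from the pure bid `o` against the mixed strategy `F`. -/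
def pureOr (v : ℝ) (τ : TieRule) (F : Measure Bid) (o : Bid) : ℝ := ∫ a, payoffOr v τ a o ∂F

theorem utilityAnd_eq_integral :
    utilityAnd τ F G = ∫ p, payoffAnd τ p.1 p.2 ∂(F.prod G) := by
  unfold utilityAnd expect
  congr 1
  ext p
  simp_rw [mul_sub, Finset.sum_sub_distrib, sum_outcomeProb_valueAnd, sum_outcomeProb_payAnd]
  rfl

theorem utilityOr_eq_integral :
    utilityOr v τ F G = ∫ p, payoffOr v τ p.1 p.2 ∂(F.prod G) := by
  unfold utilityOr expect
  congr 1
  ext p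
  simp_rw [mul_sub, Finset.sum_sub_distrib, sum_outcomeProb_valueOr, sum_outcomeProb_payOr]
  rfl

theorem utilityAnd_eq (hF : IsMixedStrategy H F) (hG : IsMixedStrategy H G) :
    utilityAnd τ F G = ∫ a, pureAnd τ G a ∂F := by
  have := hF.1
  have := hG.1
  rw [utilityAnd_eq_integral, integral_prod _ (integrable_payoffAnd hF hG)]
  rfl

theorem utilityAnd_eq' (hF : IsMixedStrategy H F) (hG : IsMixedStrategy H G) :
    utilityAnd τ F G = ∫ o, ∫ a, payoffAnd τ a o ∂F ∂G := by
  have := hF.1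
  have := hG.1
  rw [utilityAnd_eq_integral, integral_prod_symm _ (integrable_payoffAnd hF hG)]

theorem utilityOr_eq (hv : 0 ≤ v) (hF : IsMixedStrategy H F) (hG : IsMixedStrategy H G) :
    utilityOr v τ F G = ∫ o, pureOr v τ F o ∂G := by
  have := hF.1
  have := hG.1
  rw [utilityOr_eq_integral, integral_prod_symm _ (integrable_payoffOr hv hF hG)]
  rfl

theorem integrable_pureAnd (hF : IsMixedStrategy H F) (hG : IsMixedStrategy H G) :
    Integrable (pureAnd τ G) F := by
  have := hF.1
  have := hG.1
  exact (integrable_payoffAnd hF hG).integral_prod_left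

theorem integrable_pureOr (hv : 0 ≤ v) (hF : IsMixedStrategy H F) (hG : IsMixedStrategy H G) :
    Integrable (pureOr v τ F) G := by
  have := hF.1
  have := hG.1
  exact (integrable_payoffOr hv hF hG).integral_prod_right

theorem integrable_payoffAnd_left [IsProbabilityMeasure G] (a : Bid) :
    Integrable (fun o => payoffAnd τ a o) G := by
  refine integrable_of_ae_abs_le (by fun_prop) (1 + ∑ i, |a i|) (.of_forall fun o => ?_)
  have h (i) : |a i * andWinsItem τ i (a i) (o i)| ≤ |a i| := by
    rw [abs_mul, abs_of_nonneg (andWinsItem_nonneg τ i (a i) (o i))]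
    exact mul_le_of_le_one_right (abs_nonneg _) (andWinsItem_le_one _ _ _ _)
  have h0 := abs_le.1 (h 0)
  have h1 := abs_le.1 (h 1)
  have h2 := prod_andWinsItem_nonneg τ a o
  have h3 := prod_andWinsItem_le_one τ a o
  unfold payoffAnd
  rw [Fin.sum_univ_two, Fin.sum_univ_two, abs_le]
  constructor <;> linarith [abs_nonneg (a 0), abs_nonneg (a 1)]

theorem integrable_payoffOr_left [IsProbabilityMeasure F] (hv : 0 ≤ v) (o : Bid) :
    Integrable (fun a => payoffOr v τ a o) F := by
  refine integrable_of_ae_abs_le (by fun_prop) (v + ∑ i, |o i|) (.of_forall fun a => ?_)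
  have h (i) : |o i * (1 - andWinsItem τ i (a i) (o i))| ≤ |o i| := by
    rw [abs_mul, abs_of_nonneg (sub_nonneg.2 (andWinsItem_le_one τ i (a i) (o i)))]
    exact mul_le_of_le_one_right (abs_nonneg _) (sub_le_self _ (andWinsItem_nonneg _ _ _ _))
  have h0 := abs_le.1 (h 0)
  have h1 := abs_le.1 (h 1)
  have h2 := mul_nonneg hv (prod_andWinsItem_nonneg τ a o)
  have h3 := mul_nonneg hv (sub_nonneg.2 (prod_andWinsItem_le_one τ a o))
  unfold payoffOr
  rw [Fin.sum_univ_two, Fin.sum_univ_two, abs_le]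
  constructor <;> linarith [abs_nonneg (o 0), abs_nonneg (o 1)]

theorem isMixedStrategy_dirac {b : Bid} (hb : ∀ i, b i ∈ Set.Icc 0 H) :
    IsMixedStrategy H (Measure.dirac b) := by
  refine ⟨inferInstance, ?_⟩
  rw [ae_dirac_iff]
  · exact hb
  · simp only [Set.mem_Icc, Fin.forall_fin_two]
    measurability

theorem utilityAnd_dirac {a : Bid} (ha : ∀ i, a i ∈ Set.Icc 0 H) (hG : IsMixedStrategy H G) :
    utilityAnd τ (Measure.dirac a) G = pureAnd τ G a := by
  rw [utilityAnd_eq (isMixedStrategy_dirac ha) hG, integral_dirac]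

theorem utilityAnd_dirac_right {o : Bid} (ho : ∀ i, o i ∈ Set.Icc 0 H)
    (hF : IsMixedStrategy H F) :
    utilityAnd τ F (Measure.dirac o) = ∫ a, payoffAnd τ a o ∂F := by
  rw [utilityAnd_eq' hF (isMixedStrategy_dirac ho), integral_dirac]

theorem utilityOr_dirac (hv : 0 ≤ v) {o : Bid} (ho : ∀ i, o i ∈ Set.Icc 0 H)
    (hF : IsMixedStrategy H F) :
    utilityOr v τ F (Measure.dirac o) = pureOr v τ F o := by
  rw [utilityOr_eq hv hF (isMixedStrategy_dirac ho), integral_dirac]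

end Mixed

/-! ### The two one-dimensional laws -/

section Laws

variable {v : ℝ}

theorem ae_density_mem (f : ℝ → ENNReal) :
    ∀ᵐ x ∂(volume.restrict (Set.Ioc (0 : ℝ) (1 / 2))).withDensity f, x ∈ Set.Ioc (0 : ℝ) (1 / 2) :=
  (withDensity_absolutelyContinuous _ _).ae_le (ae_restrict_mem measurableSet_Ioc)

theorem ae_orLaw_mem : ∀ᵐ x ∂orLaw, x ∈ Set.Ioc (0 : ℝ) (1 / 2) := ae_density_mem _

theorem ae_andLaw_mem : ∀ᵐ x ∂andLaw v, x ∈ Set.Icc (0 : ℝ) (1 / 2) := by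
  unfold andLaw
  rw [ae_add_measure_iff]
  constructor
  · refine Measure.ae_smul_measure ?_ _
    exact (ae_dirac_iff (measurableSet_Icc (a := (0 : ℝ)) (b := 1 / 2))).2 (by norm_num)
  · filter_upwards [ae_density_mem _] with x hx using Set.Ioc_subset_Icc_self hx

instance : NullSingletonClass orLaw := by
  unfold orLaw
  infer_instance

theorem andLaw_singleton {x : ℝ} (hx : 0 < x) : andLaw v {x} = 0 := by
  simp [andLaw, hx.ne]

theorem measure_univ_of_Iic {μ : Measure ℝ} (h : ∀ᵐ x ∂μ, x ≤ 1 / 2)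
    (h1 : μ (Set.Iic (1 / 2)) = 1) : IsProbabilityMeasure μ :=
  ⟨by rw [← h1]; exact (measure_congr (Filter.eventuallyEq_univ.2 h)).symm⟩

theorem isProbabilityMeasure_andLaw (hv : 1 / 2 < v) : IsProbabilityMeasure (andLaw v) := by
  refine measure_univ_of_Iic (by filter_upwards [ae_andLaw_mem] with x hx using hx.2) ?_
  rw [andLaw_Iic hv (by norm_num) le_rfl, div_self (by linarith), ENNReal.ofReal_one]

instance : IsProbabilityMeasure orLaw := by
  refine measure_univ_of_Iic (by filter_upwards [ae_orLaw_mem] with x hx using hx.2) ?_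
  rw [orLaw_Iic (by norm_num) le_rfl]
  norm_num

/-- The value of winning one item at a price `x` against `andLaw v` is constant on `[0, 1/2]`. -/
theorem mul_andLaw_Iic (hv : 1 / 2 < v) {x : ℝ} (h0 : 0 ≤ x) (h1 : x ≤ 1 / 2) :
    (v - x) * (andLaw v).real (Set.Iic x) = v - 1 / 2 := by
  rw [Measure.real, andLaw_Iic hv h0 h1, ENNReal.toReal_ofReal]
  · field_simp [show v - x ≠ 0 by linarith]
  · exact div_nonneg (by linarith) (by linarith)

theorem mul_andLaw_Iic_le (hv : 1 / 2 < v) {x : ℝ} (h0 : 0 ≤ x) :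
    (v - x) * (andLaw v).real (Set.Iic x) ≤ v - 1 / 2 := by
  have := isProbabilityMeasure_andLaw hv
  rcases le_total x (1 / 2) with h | h
  · exact (mul_andLaw_Iic hv h0 h).le
  · have h1 : (andLaw v).real (Set.Iic x) ≤ 1 := measureReal_le_one
    have h2 : 0 ≤ (andLaw v).real (Set.Iic x) := measureReal_nonneg
    nlinarith

/-- If the other item is free, then bidding `x` against `orLaw` yields exactly `x` to `AND`. -/
theorem mul_orLaw_Iic {x : ℝ} (h0 : 0 ≤ x) (h1 : x ≤ 1 / 2) :
    (1 - x) * orLaw.real (Set.Iic x) = x := by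
  rw [Measure.real, orLaw_Iic h0 h1, ENNReal.toReal_ofReal]
  · field_simp [show 1 - x ≠ 0 by linarith]
  · exact div_nonneg h0 (by linarith)

theorem mul_orLaw_Iic_le {x : ℝ} (h0 : 0 ≤ x) : (1 - x) * orLaw.real (Set.Iic x) ≤ x := by
  rcases le_total x (1 / 2) with h | h
  · exact (mul_orLaw_Iic h0 h).le
  · have h1 : orLaw.real (Set.Iic x) ≤ 1 := measureReal_le_one
    have h2 : 0 ≤ orLaw.real (Set.Iic x) := measureReal_nonneg
    nlinarith

end Laws

/-! ### The strategies `andStar` and `orStar` -/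

section Star

variable {v H : ℝ} {τ : TieRule}

@[fun_prop]
theorem measurable_pair {X : Type*} [MeasurableSpace X] {f g : X → ℝ} (hf : Measurable f)
    (hg : Measurable g) : Measurable fun x => (![f x, g x] : Bid) := by
  rw [measurable_pi_iff, Fin.forall_fin_two]
  exact ⟨hf, hg⟩

theorem ae_andStar {p : Bid → Prop} (h : ∀ᵐ y ∂andLaw v, p ![y, y])
    (hp : MeasurableSet {b | p b}) : ∀ᵐ b ∂andStar v, p b := by
  unfold andStar
  rwa [ae_map_iff (by fun_prop) hp]

theorem ae_orStar {p : Bid → Prop} (h : ∀ᵐ x ∂orLaw, p ![x, 0] ∧ p ![0, x])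
    (hp : MeasurableSet {b | p b}) : ∀ᵐ b ∂orStar, p b := by
  unfold orStar
  rw [ae_add_measure_iff]
  constructor
  · refine Measure.ae_smul_measure ?_ _
    rw [ae_map_iff (by fun_prop) hp]
    exact h.mono fun x hx => hx.1
  · refine Measure.ae_smul_measure ?_ _
    rw [ae_map_iff (by fun_prop) hp]
    exact h.mono fun x hx => hx.2

theorem integral_orStar {f : Bid → ℝ} (hm : Measurable f) (hf : Integrable f orStar) :
    ∫ o, f o ∂orStar = (∫ x, f ![x, 0] ∂orLaw + ∫ x, f ![0, x] ∂orLaw) / 2 := by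
  unfold orStar at *
  rw [integral_add_measure hf.left_of_add_measure hf.right_of_add_measure, integral_smul_measure,
    integral_smul_measure, integral_map (by fun_prop) hm.aestronglyMeasurable,
    integral_map (by fun_prop) hm.aestronglyMeasurable]
  simp
  ring

theorem measurableSet_box (H : ℝ) :
    MeasurableSet {b : Bid | ∀ i, b i ∈ Set.Icc (0 : ℝ) H} := by
  simp only [Set.mem_Icc, Fin.forall_fin_two]
  measurability

theorem isMixedStrategy_andStar (hv : 1 / 2 < v) (hH : 1 / 2 < H) :
    IsMixedStrategy H (andStar v) := by
  have := isProbabilityMeasure_andLaw hv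
  refine ⟨Measure.isProbabilityMeasure_map (by fun_prop), ae_andStar ?_ (measurableSet_box H)⟩
  filter_upwards [ae_andLaw_mem] with y hy
  rw [Fin.forall_fin_two]
  exact ⟨⟨hy.1, hy.2.trans hH.le⟩, ⟨hy.1, hy.2.trans hH.le⟩⟩

theorem isMixedStrategy_orStar (hH : 1 / 2 < H) : IsMixedStrategy H orStar := by
  constructor
  · have h1 : IsProbabilityMeasure (orLaw.map fun x => (![x, 0] : Bid)) :=
      Measure.isProbabilityMeasure_map (by fun_prop)
    have h2 : IsProbabilityMeasure (orLaw.map fun x => (![0, x] : Bid)) :=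
      Measure.isProbabilityMeasure_map (by fun_prop)
    constructor
    simp [orStar, ENNReal.inv_two_add_inv_two]
  · refine ae_orStar ?_ (measurableSet_box H)
    filter_upwards [ae_orLaw_mem] with x hx
    simp only [Fin.forall_fin_two]
    refine ⟨⟨⟨hx.1.le, hx.2.trans hH.le⟩, ?_⟩, ?_, ⟨hx.1.le, hx.2.trans hH.le⟩⟩ <;>
      simp <;> linarith

/-- The strategies of `AND` described by the equilibrium conditions: both marginals are `andLaw v`
and the two bids vanish simultaneously, so that the atom at the origin is that of `andStar v`. -/
structure HasStarMarginals (v : ℝ) (F : Measure Bid) : Prop where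
  map_eq : ∀ i, F.map (fun a => a i) = andLaw v
  zero_iff : ∀ᵐ a ∂F, a 0 = 0 ↔ a 1 = 0

theorem hasStarMarginals_andStar : HasStarMarginals v (andStar v) := by
  refine ⟨fun i => ?_, ae_andStar (by simp) ?_⟩
  · unfold andStar
    rw [Measure.map_map (by fun_prop) (by fun_prop)]
    convert Measure.map_id
    fin_cases i <;> rfl
  · measurability

namespace HasStarMarginals

variable {F : Measure Bid} (hF : HasStarMarginals v F)
include hF

theorem ae_of_ae (i : Fin 2) {p : ℝ → Prop} (h : ∀ᵐ y ∂andLaw v, p y) : ∀ᵐ a ∂F, p (a i) := by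
  rw [← hF.map_eq i] at h
  exact ae_of_ae_map (measurable_pi_apply i).aemeasurable h

theorem isProbabilityMeasure (hv : 1 / 2 < v) : IsProbabilityMeasure F := by
  have := isProbabilityMeasure_andLaw hv
  rw [← hF.map_eq 0] at this
  exact Measure.isProbabilityMeasure_of_map (fun a => a 0)

theorem ae_mem : ∀ᵐ a ∂F, ∀ i, a i ∈ Set.Icc (0 : ℝ) (1 / 2) := by
  rw [ae_all_iff]
  exact fun i => hF.ae_of_ae i ae_andLaw_mem

theorem ae_ne {x : ℝ} (hx : 0 < x) (i : Fin 2) : ∀ᵐ a ∂F, a i ≠ x := by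
  refine hF.ae_of_ae i (p := fun y => y ≠ x) ?_
  rw [ae_iff]
  simpa using andLaw_singleton hx

theorem ae_zero_iff (i j : Fin 2) : ∀ᵐ a ∂F, a i = 0 ↔ a j = 0 := by
  filter_upwards [hF.zero_iff] with a ha
  fin_cases i <;> fin_cases j <;> simp [ha]

theorem integral_comp (i : Fin 2) {f : ℝ → ℝ} (hf : Measurable f) :
    ∫ a, f (a i) ∂F = ∫ y, f y ∂andLaw v := by
  rw [← hF.map_eq i, integral_map (measurable_pi_apply i).aemeasurable hf.aestronglyMeasurable]

theorem measureReal_Iic (i : Fin 2) (x : ℝ) :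
    F.real {a | a i ≤ x} = (andLaw v).real (Set.Iic x) := by
  rw [← hF.map_eq i, map_measureReal_apply (by fun_prop) measurableSet_Iic]
  rfl

end HasStarMarginals

end Star

/-! ### The equilibrium property -/

section Sufficiency

variable {v H : ℝ} {τ : TieRule} {F : Measure Bid} {i j : Fin 2}

/-- Payoff of `AND` against `OR` bidding only on item `i`, by the law `orLaw`. -/
theorem integral_payoffAnd_axis (hij : i ≠ j) (a : Bid) {f : ℝ → Bid}
    (hi : ∀ x, f x i = x) (hj : ∀ x, f x j = 0) :
    ∫ x, payoffAnd τ a (f x) ∂orLaw =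
      orLaw.real (Set.Iic (a i)) * (andWinsItem τ j (a j) 0 - a i)
        - a j * andWinsItem τ j (a j) 0 := by
  have h : (fun x => payoffAnd τ a (f x)) =ᵐ[orLaw] fun x =>
      (Set.Iic (a i)).indicator (fun _ => andWinsItem τ j (a j) 0 - a i) x
        - a j * andWinsItem τ j (a j) 0 := by
    have hne : ∀ᵐ x ∂orLaw, x ≠ a i := by simp [ae_iff]
    filter_upwards [hne] with x hx
    unfold payoffAnd
    rw [prod_of_ne hij, sum_of_ne hij, hi, hj]
    rcases hx.lt_or_gt with hx | hx
    · rw [andWinsItem_of_lt τ i hx, Set.indicator_of_mem (Set.mem_Iic.2 hx.le)]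
      ring
    · rw [andWinsItem_of_gt τ i hx, Set.indicator_of_notMem (by simpa using hx)]
      ring
  rw [integral_congr_ae h, integral_sub ((integrable_const _).indicator measurableSet_Iic)
    (integrable_const _), integral_indicator measurableSet_Iic]
  simp

/-- Summed over the two items on which `OR` may bid, these bounds cancel. -/
theorem integral_payoffAnd_axis_le (hij : i ≠ j) {a : Bid} (ha : ∀ i, 0 ≤ a i) {f : ℝ → Bid}
    (hi : ∀ x, f x i = x) (hj : ∀ x, f x j = 0) :
    ∫ x, payoffAnd τ a (f x) ∂orLaw ≤ a i - a j := by
  rw [integral_payoffAnd_axis hij a hi hj]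
  have h1 := mul_orLaw_Iic_le (ha i)
  have h2 : 0 ≤ orLaw.real (Set.Iic (a i)) := measureReal_nonneg
  rcases (ha j).lt_or_eq with h | h
  · rw [andWinsItem_of_lt τ j h]
    linarith
  · rw [← h]
    nlinarith [andWinsItem_le_one τ j 0 0]

theorem pureAnd_orStar_eq (τ : TieRule) (a : Bid) : pureAnd τ orStar a =
    (∫ x, payoffAnd τ a ![x, 0] ∂orLaw + ∫ x, payoffAnd τ a ![0, x] ∂orLaw) / 2 := by
  have := (isMixedStrategy_orStar (H := 1) (by norm_num)).1
  exact integral_orStar (by fun_prop) (integrable_payoffAnd_left a)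

theorem pureAnd_orStar_le {a : Bid} (ha : ∀ i, 0 ≤ a i) : pureAnd τ orStar a ≤ 0 := by
  have h1 := integral_payoffAnd_axis_le (τ := τ) (i := 0) (j := 1) (by decide) ha
    (f := fun x => ![x, 0]) (fun _ => rfl) (fun _ => rfl)
  have h2 := integral_payoffAnd_axis_le (τ := τ) (i := 1) (j := 0) (by decide) ha
    (f := fun x => ![0, x]) (fun _ => rfl) (fun _ => rfl)
  rw [pureAnd_orStar_eq]
  linarith

theorem integral_payoffAnd_axis_eq (hij : i ≠ j) {a : Bid}
    (ha : ∀ i, a i ∈ Set.Icc (0 : ℝ) (1 / 2)) (h0 : a i = 0 ↔ a j = 0) {f : ℝ → Bid}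
    (hi : ∀ x, f x i = x) (hj : ∀ x, f x j = 0) :
    ∫ x, payoffAnd τ a (f x) ∂orLaw = a i - a j := by
  rw [integral_payoffAnd_axis hij a hi hj]
  have h1 := mul_orLaw_Iic (ha i).1 (ha i).2
  rcases (ha j).1.lt_or_eq with h | h
  · rw [andWinsItem_of_lt τ j h]
    linarith
  · rw [h0.2 h.symm, sub_zero, one_mul] at h1
    rw [h0.2 h.symm, h1, ← h]
    ring

theorem HasStarMarginals.pureAnd_orStar_eq_zero (hF : HasStarMarginals v F) :
    ∀ᵐ a ∂F, pureAnd τ orStar a = 0 := by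
  filter_upwards [hF.ae_mem, hF.zero_iff] with a ha h0
  rw [pureAnd_orStar_eq,
    integral_payoffAnd_axis_eq (i := 0) (j := 1) (by decide) ha h0 (fun _ => rfl) (fun _ => rfl),
    integral_payoffAnd_axis_eq (i := 1) (j := 0) (by decide) ha h0.symm (fun _ => rfl)
      (fun _ => rfl)]
  ring

theorem HasStarMarginals.measureReal_zero (hF : HasStarMarginals v F) :
    F.real {a | a 0 ≤ 0 ∧ a 1 ≤ 0} = (andLaw v).real (Set.Iic 0) := by
  rw [← hF.measureReal_Iic 0]
  refine measureReal_congr ?_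
  filter_upwards [hF.zero_iff, hF.ae_mem] with a ha h0
  refine propext ⟨fun h => h.1, fun h => ⟨h, (ha.1 (le_antisymm h (h0 0).1)).le⟩⟩

/-- Winning an item alone is worth at most `v - 1/2` to `OR`, and bidding on both items wins
at least once too often: at the atom `(0, 0)` of `AND`. -/
theorem HasStarMarginals.pureOr_le (hF : HasStarMarginals v F) (hv : 1 / 2 < v) {o : Bid}
    (ho : ∀ i, 0 ≤ o i) : pureOr v τ F o ≤ v - 1 / 2 := by
  have := hF.isProbabilityMeasure hv
  have hS (i : Fin 2) : MeasurableSet {a : Bid | a i ≤ o i} :=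
    measurableSet_le (measurable_pi_apply i) measurable_const
  have hS0 : MeasurableSet {a : Bid | a 0 ≤ 0 ∧ a 1 ≤ 0} :=
    (measurableSet_le (measurable_pi_apply 0) measurable_const).inter
      (measurableSet_le (measurable_pi_apply 1) measurable_const)
  have hint (i : Fin 2) : Integrable ({a : Bid | a i ≤ o i}.indicator fun _ => v - o i) F :=
    (integrable_const _).indicator (hS i)
  have hint0 : Integrable ({a : Bid | a 0 ≤ 0 ∧ a 1 ≤ 0}.indicator fun _ => v) F :=
    (integrable_const _).indicator hS0
  have key : ∀ᵐ a ∂F, payoffOr v τ a o ≤ {a : Bid | a 0 ≤ o 0}.indicator (fun _ => v - o 0) a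
      + {a : Bid | a 1 ≤ o 1}.indicator (fun _ => v - o 1) a
      - {a : Bid | a 0 ≤ 0 ∧ a 1 ≤ 0}.indicator (fun _ => v) a := by
    have hne (i : Fin 2) : ∀ᵐ a ∂F, 0 < o i → a i ≠ o i := by
      rcases (ho i).lt_or_eq with h | h
      · filter_upwards [hF.ae_ne h i] with a ha _ using ha
      · exact .of_forall fun a h' => absurd h' (by rw [← h]; exact lt_irrefl _)
    filter_upwards [hF.zero_iff, hF.ae_mem, hne 0, hne 1] with a hz ha h0 h1
    have hw (i : Fin 2) (hi : 0 < o i → a i ≠ o i) (hoi : 0 < o i) : andWinsItem τ i (a i) (o i) =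
        1 - {a : Bid | a i ≤ o i}.indicator (fun _ => 1) a := by
      rcases (hi hoi).lt_or_gt with h | h
      · rw [andWinsItem_of_gt τ i h, Set.indicator_of_mem (by exact h.le)]
        ring
      · rw [andWinsItem_of_lt τ i h, Set.indicator_of_notMem (by simpa using h)]
        ring
    have ind (i : Fin 2) (c : ℝ) : {a : Bid | a i ≤ o i}.indicator (fun _ => c) a =
        c * {a : Bid | a i ≤ o i}.indicator (fun _ => 1) a := by
      by_cases h : a i ≤ o i <;> simp [h]
    have hI (i : Fin 2) : 0 ≤ {a : Bid | a i ≤ o i}.indicator (fun _ => (1 : ℝ)) a :=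
      Set.indicator_nonneg (fun _ _ => zero_le_one) _
    have hv0 : 0 < v := by linarith
    unfold payoffOr
    rw [Fin.prod_univ_two, Fin.sum_univ_two]
    by_cases hz0 : a 0 = 0
    · have hz1 := hz.1 hz0
      have e (i : Fin 2) (hi : a i = 0) : a i ≤ o i := hi ▸ ho i
      rw [Set.indicator_of_mem (by exact e 0 hz0), Set.indicator_of_mem (by exact e 1 hz1),
        Set.indicator_of_mem (by exact ⟨hz0.le, hz1.le⟩)]
      have b0 := andWinsItem_nonneg τ 0 (a 0) (o 0)
      have b1 := andWinsItem_nonneg τ 1 (a 1) (o 1)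
      have key (i : Fin 2) (hi : a i = 0) : o i * (1 - andWinsItem τ i (a i) (o i)) = o i := by
        rcases (ho i).lt_or_eq with h | h
        · rw [andWinsItem_of_gt τ i (hi ▸ h)]
          ring
        · rw [← h]
          ring
      rw [key 0 hz0, key 1 hz1]
      nlinarith [mul_nonneg b0 b1]
    · have hz1 : a 1 ≠ 0 := fun h => hz0 (hz.2 h)
      have p0 : 0 < a 0 := lt_of_le_of_ne (ha 0).1 (Ne.symm hz0)
      have p1 : 0 < a 1 := lt_of_le_of_ne (ha 1).1 (Ne.symm hz1)
      rw [Set.indicator_of_notMem (s := {a : Bid | a 0 ≤ 0 ∧ a 1 ≤ 0})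
        (by simp [p0.not_ge])]
      have e (i : Fin 2) (hi : 0 < o i → a i ≠ o i) (pi : 0 < a i) :
          andWinsItem τ i (a i) (o i) = 1 - {a : Bid | a i ≤ o i}.indicator (fun _ => 1) a := by
        rcases (ho i).lt_or_eq with h | h
        · exact hw i hi h
        · rw [andWinsItem_of_lt τ i (h ▸ pi), Set.indicator_of_notMem (by
            rw [← h]; simpa using pi)]
          ring
      rw [e 0 h0 p0, e 1 h1 p1, ind 0 (v - o 0), ind 1 (v - o 1)]
      nlinarith [mul_nonneg (hI 0) (hI 1), mul_nonneg hv0.le (mul_nonneg (hI 0) (hI 1))]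
  have h1 := integral_mono_ae (integrable_payoffOr_left (by linarith) o)
    (((hint 0).add (hint 1)).sub hint0) key
  rw [integral_sub' ((hint 0).add (hint 1)) hint0, integral_add' (hint 0) (hint 1),
    integral_indicator_const _ (hS 0), integral_indicator_const _ (hS 1),
    integral_indicator_const _ hS0, hF.measureReal_Iic, hF.measureReal_Iic,
    hF.measureReal_zero] at h1
  have h2 := mul_andLaw_Iic_le hv (ho 0)
  have h3 := mul_andLaw_Iic_le hv (ho 1)
  have h4 := mul_andLaw_Iic hv le_rfl (by norm_num)
  simp only [smul_eq_mul] at h1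
  unfold pureOr
  linarith

theorem HasStarMarginals.pureOr_axis (hF : HasStarMarginals v F) (hv : 1 / 2 < v) (hij : i ≠ j)
    {o : Bid} (hi : o i ∈ Set.Ioc (0 : ℝ) (1 / 2)) (hj : o j = 0) :
    pureOr v τ F o = v - 1 / 2 := by
  have := hF.isProbabilityMeasure hv
  rw [← mul_andLaw_Iic hv hi.1.le hi.2, ← hF.measureReal_Iic i]
  have h : (fun a => payoffOr v τ a o) =ᵐ[F] {a : Bid | a i ≤ o i}.indicator fun _ => v - o i := by
    filter_upwards [hF.ae_ne hi.1 i, hF.ae_mem, hF.ae_zero_iff i j] with a hne ha hz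
    unfold payoffOr
    rw [prod_of_ne hij, sum_of_ne hij, hj]
    rcases hne.lt_or_gt with h | h
    · rw [andWinsItem_of_gt τ i h, Set.indicator_of_mem (by exact h.le)]
      ring
    · have hp : 0 < a j :=
        lt_of_le_of_ne (ha j).1 fun h' => (hi.1.trans h).ne' (hz.2 h'.symm)
      rw [andWinsItem_of_lt τ i h, andWinsItem_of_lt τ j hp,
        Set.indicator_of_notMem (by simpa using h)]
      ring
  unfold pureOr
  rw [integral_congr_ae h, integral_indicator_const _
    (measurableSet_le (measurable_pi_apply i) measurable_const), smul_eq_mul, mul_comm]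

theorem measurable_integral_left {F : Measure Bid} [SFinite F] {f : Bid → Bid → ℝ}
    (hf : Measurable fun p : Bid × Bid => f p.2 p.1) : Measurable fun o => ∫ a, f a o ∂F :=
  hf.stronglyMeasurable.integral_prod_right'.measurable

theorem measurable_pureOr [SFinite F] : Measurable (pureOr v τ F) :=
  measurable_integral_left (by fun_prop)

theorem HasStarMarginals.utilityAnd_orStar (hF : HasStarMarginals v F) (hH : 1 / 2 < H)
    (hF' : IsMixedStrategy H F) : utilityAnd τ F orStar = 0 := by
  rw [utilityAnd_eq hF' (isMixedStrategy_orStar hH), integral_congr_ae hF.pureAnd_orStar_eq_zero,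
    integral_zero]

theorem HasStarMarginals.utilityOr_orStar (hF : HasStarMarginals v F) (hv : 1 / 2 < v)
    (hH : 1 / 2 < H) (hF' : IsMixedStrategy H F) : utilityOr v τ F orStar = v - 1 / 2 := by
  have hG := isMixedStrategy_orStar hH
  have := hG.1
  have := hF'.1
  have h : ∀ᵐ o ∂orStar, pureOr v τ F o = v - 1 / 2 := by
    refine ae_orStar ?_ (measurableSet_eq_fun measurable_pureOr measurable_const)
    filter_upwards [ae_orLaw_mem] with x hx
    exact ⟨hF.pureOr_axis hv (i := 0) (j := 1) (by decide) hx rfl,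
      hF.pureOr_axis hv (i := 1) (j := 0) (by decide) hx rfl⟩
  rw [utilityOr_eq (by linarith) hF' hG, integral_congr_ae h]
  simp

theorem HasStarMarginals.isNashEquilibrium (hF : HasStarMarginals v F) (hv : 1 / 2 < v)
    (hH : 1 / 2 < H) (hF' : IsMixedStrategy H F) : IsNashEquilibrium v H τ F orStar := by
  refine ⟨hF', isMixedStrategy_orStar hH, fun F₁ h₁ => ?_, fun G₁ h₁ => ?_⟩
  · rw [hF.utilityAnd_orStar hH hF', utilityAnd_eq h₁ (isMixedStrategy_orStar hH)]
    refine integral_nonpos_of_ae ?_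
    filter_upwards [h₁.2] with a ha using pureAnd_orStar_le fun i => (ha i).1
  · rw [hF.utilityOr_orStar hv hH hF', utilityOr_eq (by linarith) hF' h₁]
    have := h₁.1
    calc ∫ o, pureOr v τ F o ∂G₁ ≤ ∫ _, (v - 1 / 2) ∂G₁ := by
          refine integral_mono_ae (integrable_pureOr (by linarith) hF' h₁) (integrable_const _) ?_
          filter_upwards [h₁.2] with o ho using hF.pureOr_le hv fun i => (ho i).1
      _ = v - 1 / 2 := by simp

end Sufficiency

/-! ### Outcomes against `orStar` -/

section Integrability

variable {v H : ℝ} {τ : TieRule} {F G : Measure Bid}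

theorem integrable_prod_andWinsItem {μ : Measure (Bid × Bid)} [IsProbabilityMeasure μ] :
    Integrable (fun p : Bid × Bid => ∏ i, andWinsItem τ i (p.1 i) (p.2 i)) μ := by
  refine integrable_of_ae_abs_le (by fun_prop) 1 (.of_forall fun p => ?_)
  rw [abs_of_nonneg (prod_andWinsItem_nonneg τ p.1 p.2)]
  exact prod_andWinsItem_le_one τ p.1 p.2

theorem abs_andWinsItem_le_one (i : Fin 2) (a o : ℝ) : |andWinsItem τ i a o| ≤ 1 := by
  rw [abs_of_nonneg (andWinsItem_nonneg τ i _ _)]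
  exact andWinsItem_le_one τ i _ _

theorem integrable_andWinsItem {μ : Measure (Bid × Bid)} [IsProbabilityMeasure μ] (i : Fin 2) :
    Integrable (fun p : Bid × Bid => andWinsItem τ i (p.1 i) (p.2 i)) μ :=
  integrable_of_ae_abs_le (by fun_prop) 1 (.of_forall fun _ => abs_andWinsItem_le_one _ _ _)

theorem integrable_bid_mul_andWinsItem (hF : IsMixedStrategy H F) [IsProbabilityMeasure G]
    (i : Fin 2) :
    Integrable (fun p : Bid × Bid => p.1 i * andWinsItem τ i (p.1 i) (p.2 i)) (F.prod G) := by
  have := hF.1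
  refine integrable_of_ae_abs_le (by fun_prop) H ?_
  filter_upwards [ae_prod_fst hF.2] with p hp
  exact abs_mul_le_of_mem (hp i) (andWinsItem_nonneg _ _ _ _) (andWinsItem_le_one _ _ _ _)

theorem integrable_bid_mul_one_sub_andWinsItem [IsProbabilityMeasure F]
    (hG : IsMixedStrategy H G) (i : Fin 2) :
    Integrable (fun p : Bid × Bid => p.2 i * (1 - andWinsItem τ i (p.1 i) (p.2 i)))
      (F.prod G) := by
  have := hG.1
  refine integrable_of_ae_abs_le (by fun_prop) H ?_
  filter_upwards [ae_prod_snd hG.2] with p hp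
  exact abs_mul_le_of_mem (hp i) (sub_nonneg.2 (andWinsItem_le_one _ _ _ _))
    (sub_le_self _ (andWinsItem_nonneg _ _ _ _))

end Integrability

section Outcome

variable {v H : ℝ} {τ : TieRule} {F : Measure Bid} {i j : Fin 2}

/-- Average over the tie-breaking of a quantity which is a function of the outcome plus multiples
of the payments. -/
theorem sum_outcomeProb_affine (τ : TieRule) (c : Finset (Fin 2) → ℝ) (d e : ℝ) (a o : Bid) :
    ∑ S, outcomeProb τ a o S * (c S + d * pay a S + e * pay o Sᶜ) =
      c ∅ + ∑ i, (c {i} - c ∅) * andWinsItem τ i (a i) (o i)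
        + (c Finset.univ - ∑ i, c {i} + c ∅) * ∏ i, andWinsItem τ i (a i) (o i)
        + d * ∑ i, a i * andWinsItem τ i (a i) (o i)
        + e * ∑ i, o i * (1 - andWinsItem τ i (a i) (o i)) := by
  rw [← sum_outcomeProb_payAnd, ← sum_outcomeProb_payOr]
  simp_rw [mul_add, Finset.sum_add_distrib, mul_left_comm _ d, mul_left_comm _ e, ← Finset.mul_sum]
  rw [sum_finset_fin_two, outcomeProb_empty, outcomeProb_singleton, outcomeProb_singleton,
    outcomeProb_univ, Fin.sum_univ_two, Fin.sum_univ_two, Fin.sum_univ_two]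
  ring

theorem HasStarMarginals.integrable_comp (hF : HasStarMarginals v F) (hv : 1 / 2 < v) (i : Fin 2)
    {f : ℝ → ℝ} (hf : Measurable f) (C : ℝ) (h : ∀ y ∈ Set.Icc (0 : ℝ) (1 / 2), |f y| ≤ C) :
    Integrable (fun a => f (a i)) F := by
  have := hF.isProbabilityMeasure hv
  refine integrable_of_ae_abs_le (by fun_prop) C ?_
  filter_upwards [hF.ae_mem] with a ha using h _ (ha i)

/-- If `OR` bids on item `i` only, then `AND` wins both items exactly when it wins item `i`: its bid on
the other item vanishes only together with that on item `i`. So the expectation of the expression in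
`sum_outcomeProb_affine` is a sum of integrals against the marginals. -/
theorem HasStarMarginals.integral_affine_axis (hF : HasStarMarginals v F) (hv : 1 / 2 < v)
    (hij : i ≠ j) {o : Bid} (hi : 0 < o i) (hj : o j = 0) (k₀ k d e : ℝ) (l : Fin 2 → ℝ) :
    ∫ a, (k₀ + ∑ i, l i * andWinsItem τ i (a i) (o i)
        + k * ∏ i, andWinsItem τ i (a i) (o i)
        + d * ∑ i, a i * andWinsItem τ i (a i) (o i)
        + e * ∑ i, o i * (1 - andWinsItem τ i (a i) (o i))) ∂F =
      ∫ y, (k₀ + (l i + k + d * y - e * o i) * andWinsItem τ i y (o i) + e * o i) ∂andLaw v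
        + ∫ y, (l j + d * y) * andWinsItem τ j y 0 ∂andLaw v := by
  rw [← hF.integral_comp i (by fun_prop), ← hF.integral_comp j (by fun_prop), ← integral_add]
  · refine integral_congr_ae ?_
    filter_upwards [hF.ae_ne hi i, hF.ae_mem, hF.ae_zero_iff i j] with a hne ha hz
    rw [prod_of_ne hij, sum_of_ne hij, sum_of_ne hij, sum_of_ne hij, hj]
    rcases hne.lt_or_gt with h | h
    · rw [andWinsItem_of_gt τ i h]
      ring
    · have hp : 0 < a j := lt_of_le_of_ne (ha j).1 fun h' => (hi.trans h).ne' (hz.2 h'.symm)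
      rw [andWinsItem_of_lt τ i h, andWinsItem_of_lt τ j hp]
      ring
  · refine hF.integrable_comp hv i (f := fun y => k₀ + (l i + k + d * y - e * o i) *
      andWinsItem τ i y (o i) + e * o i) (by fun_prop)
      (|k₀| + (|l i| + |k| + |d| + |e * o i|) + |e * o i|) fun y hy => ?_
    refine (abs_add_le _ _).trans
      (add_le_add ((abs_add_le _ _).trans (add_le_add le_rfl ?_)) le_rfl)
    rw [abs_mul]
    refine (mul_le_of_le_one_right (abs_nonneg _) (abs_andWinsItem_le_one _ _ _)).trans ?_
    refine (abs_sub _ _).trans (add_le_add ((abs_add_le _ _).trans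
      (add_le_add (abs_add_le _ _) ?_)) le_rfl)
    rw [abs_mul, abs_of_nonneg hy.1]
    exact mul_le_of_le_one_right (abs_nonneg _) (by linarith [hy.2])
  · refine hF.integrable_comp hv j (f := fun y => (l j + d * y) * andWinsItem τ j y 0)
      (by fun_prop) (|l j| + |d|) fun y hy => ?_
    rw [abs_mul]
    refine (mul_le_of_le_one_right (abs_nonneg _) (abs_andWinsItem_le_one _ _ _)).trans ?_
    refine (abs_add_le _ _).trans (add_le_add le_rfl ?_)
    rw [abs_mul, abs_of_nonneg hy.1]
    exact mul_le_of_le_one_right (abs_nonneg _) (by linarith [hy.2])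

/-- Against `orStar`, whether `AND` wins both items is decided by a single item, so expected
outcomes and payments depend on the strategy of `AND` only through its marginals. -/
theorem HasStarMarginals.expect_orStar (hF : HasStarMarginals v F) (hv : 1 / 2 < v)
    (hH : 1 / 2 < H) (hF' : IsMixedStrategy H F) (c : Finset (Fin 2) → ℝ) (d e : ℝ)
    {f : Bid → Bid → Finset (Fin 2) → ℝ}
    (hf : ∀ a o S, f a o S = c S + d * pay a S + e * pay o Sᶜ) :
    expect τ F orStar f = expect τ (andStar v) orStar f := by
  have key (F : Measure Bid) (hF : HasStarMarginals v F) (hF' : IsMixedStrategy H F) :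
      expect τ F orStar f = ∫ o, ∫ a, (c ∅ + ∑ i, (c {i} - c ∅) * andWinsItem τ i (a i) (o i)
        + (c Finset.univ - ∑ i, c {i} + c ∅) * ∏ i, andWinsItem τ i (a i) (o i)
        + d * ∑ i, a i * andWinsItem τ i (a i) (o i)
        + e * ∑ i, o i * (1 - andWinsItem τ i (a i) (o i))) ∂F ∂orStar := by
    have := hF'.1
    have hG := isMixedStrategy_orStar hH
    have := hG.1
    unfold expect
    simp_rw [hf, sum_outcomeProb_affine]
    rw [integral_prod_symm]
    exact ((((integrable_const _).add (integrable_finsetSum _ fun i _ =>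
      (integrable_andWinsItem i).const_mul _)).add (integrable_prod_andWinsItem.const_mul _)).add
      ((integrable_finsetSum _ fun i _ => integrable_bid_mul_andWinsItem hF' i).const_mul _)).add
      ((integrable_finsetSum _ fun i _ =>
        integrable_bid_mul_one_sub_andWinsItem hG i).const_mul _)
  have hS := hasStarMarginals_andStar (v := v)
  have hS' := isMixedStrategy_andStar hv hH
  rw [key F hF hF', key _ hS hS']
  have := hF'.1
  have := hS'.1
  refine integral_congr_ae (ae_orStar ?_ ?_)
  · filter_upwards [ae_orLaw_mem] with x hx
    constructor
    · rw [hF.integral_affine_axis hv (i := 0) (j := 1) (by decide) (by exact hx.1) rfl,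
        hS.integral_affine_axis hv (i := 0) (j := 1) (by decide) (by exact hx.1) rfl]
    · rw [hF.integral_affine_axis hv (i := 1) (j := 0) (by decide) (by exact hx.1) rfl,
        hS.integral_affine_axis hv (i := 1) (j := 0) (by decide) (by exact hx.1) rfl]
  · exact measurableSet_eq_fun (measurable_integral_left (by fun_prop))
      (measurable_integral_left (by fun_prop))

end Outcome

/-! ### Weak dominance -/

section Dominance

variable {v H : ℝ} {τ : TieRule} {F : Measure Bid} {i j : Fin 2}

theorem integrable_prod_andWinsItem_left {F : Measure Bid} [IsProbabilityMeasure F] (o : Bid) :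
    Integrable (fun a : Bid => ∏ i, andWinsItem τ i (a i) (o i)) F := by
  refine integrable_of_ae_abs_le (by fun_prop) 1 (.of_forall fun a => ?_)
  rw [abs_of_nonneg (prod_andWinsItem_nonneg τ a o)]
  exact prod_andWinsItem_le_one τ a o

theorem integrable_andWinsItem_left {F : Measure Bid} [IsProbabilityMeasure F] (i : Fin 2)
    (x : ℝ) : Integrable (fun a : Bid => andWinsItem τ i (a i) x) F :=
  integrable_of_ae_abs_le (by fun_prop) 1 (.of_forall fun _ => abs_andWinsItem_le_one _ _ _)

theorem HasStarMarginals.integral_payoffAnd (hF : HasStarMarginals v F) (hv : 1 / 2 < v) (o : Bid) :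
    ∫ a, payoffAnd τ a o ∂F = ∫ a, ∏ i, andWinsItem τ i (a i) (o i) ∂F
      - ∑ i, ∫ y, y * andWinsItem τ i y (o i) ∂andLaw v := by
  have := hF.isProbabilityMeasure hv
  have hint (i : Fin 2) : Integrable (fun a => a i * andWinsItem τ i (a i) (o i)) F :=
    hF.integrable_comp hv i (f := fun y => y * andWinsItem τ i y (o i)) (by fun_prop) (1 / 2)
      fun y hy => abs_mul_le_of_mem hy (andWinsItem_nonneg _ _ _ _) (andWinsItem_le_one _ _ _ _)
  unfold payoffAnd
  rw [integral_sub (integrable_prod_andWinsItem_left o) (integrable_finsetSum _ fun i _ => hint i),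
    integral_finsetSum _ fun i _ => hint i]
  congr 1
  refine Finset.sum_congr rfl fun i _ => ?_
  exact hF.integral_comp i (f := fun y => y * andWinsItem τ i y (o i)) (by fun_prop)

/-- Equal bids maximize the probability of winning both items for given marginals. -/
theorem HasStarMarginals.integral_prod_andWinsItem_le (hF : HasStarMarginals v F) (hv : 1 / 2 < v)
    {o : Bid} (ho : ∀ i, 0 ≤ o i) :
    ∫ a, ∏ i, andWinsItem τ i (a i) (o i) ∂F ≤
      ∫ a, ∏ i, andWinsItem τ i (a i) (o i) ∂andStar v := by
  have := hF.isProbabilityMeasure hv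
  have key {i j : Fin 2} (hij : i ≠ j) (hi : 0 < o i) (hle : o j ≤ o i) :
      ∫ a, ∏ i, andWinsItem τ i (a i) (o i) ∂F ≤
        ∫ a, ∏ i, andWinsItem τ i (a i) (o i) ∂andStar v := by
    have hS := hasStarMarginals_andStar (v := v)
    have hdiag : ∀ᵐ a ∂andStar v, a i = a j :=
      ae_andStar (.of_forall fun y => by fin_cases i <;> fin_cases j <;> rfl)
        (measurableSet_eq_fun (measurable_pi_apply i) (measurable_pi_apply j))
    calc ∫ a, ∏ i, andWinsItem τ i (a i) (o i) ∂F
        ≤ ∫ a, andWinsItem τ i (a i) (o i) ∂F :=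
          integral_mono (integrable_prod_andWinsItem_left o) (integrable_andWinsItem_left i (o i))
            fun a => prod_andWinsItem_le τ a o i
      _ = ∫ a, andWinsItem τ i (a i) (o i) ∂andStar v := by
          rw [hF.integral_comp i (f := fun y => andWinsItem τ i y (o i)) (by fun_prop),
            hS.integral_comp i (f := fun y => andWinsItem τ i y (o i)) (by fun_prop)]
      _ = ∫ a, ∏ i, andWinsItem τ i (a i) (o i) ∂andStar v := by
          refine integral_congr_ae ?_
          filter_upwards [hdiag, hS.ae_ne hi i] with a ha hne
          rw [prod_of_ne hij]
          rcases hne.lt_or_gt with h | h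
          · simp [andWinsItem_of_gt τ i h]
          · simp [andWinsItem_of_lt τ j (show o j < a j by linarith)]
  by_cases hz : o 0 = 0 ∧ o 1 = 0
  · -- Both bids of `OR` are `0`: only the atom at the origin matters.
    have e (F : Measure Bid) (hF : HasStarMarginals v F) :
        ∫ a, ∏ i, andWinsItem τ i (a i) (o i) ∂F =
          ∫ y, andWinsItem τ 0 y 0 * andWinsItem τ 1 y 0 ∂andLaw v := by
      rw [← hF.integral_comp 0 (by fun_prop)]
      refine integral_congr_ae ?_
      filter_upwards [hF.zero_iff, hF.ae_mem] with a haz ha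
      rw [Fin.prod_univ_two, hz.1, hz.2]
      by_cases h' : a 0 = 0
      · rw [haz.1 h', h']
      · have h'' : a 1 ≠ 0 := fun h => h' (haz.2 h)
        rw [andWinsItem_of_lt τ 1 (lt_of_le_of_ne (ha 1).1 h''.symm),
          andWinsItem_of_lt τ 1 (lt_of_le_of_ne (ha 0).1 (Ne.symm h'))]
    rw [e F hF, e _ hasStarMarginals_andStar]
  · have h0 := ho 0
    have h1 := ho 1
    rcases le_total (o 0) (o 1) with h | h
    · refine key (i := 1) (j := 0) (by decide) (lt_of_le_of_ne h1 fun h' => hz ⟨?_, h'.symm⟩) h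
      exact le_antisymm (h'.symm ▸ h) h0
    · refine key (i := 0) (j := 1) (by decide) (lt_of_le_of_ne h0 fun h' => hz ⟨h'.symm, ?_⟩) h
      exact le_antisymm (h'.symm ▸ h) h1

theorem HasStarMarginals.integral_payoffAnd_le (hF : HasStarMarginals v F) (hv : 1 / 2 < v)
    {o : Bid} (ho : ∀ i, 0 ≤ o i) :
    ∫ a, payoffAnd τ a o ∂F ≤ ∫ a, payoffAnd τ a o ∂andStar v := by
  rw [hF.integral_payoffAnd hv, hasStarMarginals_andStar.integral_payoffAnd hv]
  exact sub_le_sub_right (hF.integral_prod_andWinsItem_le hv ho) _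

theorem HasStarMarginals.weaklyDominatedAnd (hF : HasStarMarginals v F) (hv : 1 / 2 < v)
    (hH : 1 / 2 < H) (hF' : IsMixedStrategy H F) : WeaklyDominatedAnd H τ F (andStar v) := by
  intro G hG
  have hS := isMixedStrategy_andStar hv hH
  have := hF'.1
  have := hG.1
  have := hS.1
  rw [utilityAnd_eq' hF' hG, utilityAnd_eq' hS hG]
  refine integral_mono_ae (integrable_payoffAnd hF' hG).integral_prod_right
    (integrable_payoffAnd hS hG).integral_prod_right ?_
  filter_upwards [hG.2] with o ho using hF.integral_payoffAnd_le hv fun i => (ho i).1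

theorem measurableSet_Ioi_box (x : Bid) : MeasurableSet {a : Bid | ∀ i, x i < a i} := by
  rw [Set.ofPred_forall]
  exact MeasurableSet.iInter fun i => measurableSet_lt measurable_const (measurable_pi_apply i)

/-- Probability laws on the plane are determined by their masses on open upper quadrants. -/
theorem ext_of_Ioi_box {F F' : Measure Bid} [IsProbabilityMeasure F]
    (h : ∀ x : Bid, F {a | ∀ i, x i < a i} = F' {a | ∀ i, x i < a i}) : F = F' := by
  have hpi : ∀ x : Bid, {a : Bid | ∀ i, x i < a i} = Set.pi Set.univ fun i => Set.Ioi (x i) := by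
    intro x
    ext a
    simp
  have hspan : ∀ _ : Fin 2, IsCountablySpanning (Set.range (Set.Ioi : ℝ → Set ℝ)) := fun _ =>
    ⟨fun n : ℕ => Set.Ioi (-(n : ℝ)), fun n => ⟨_, rfl⟩, Set.eq_univ_of_forall fun x => by
      obtain ⟨n, hn⟩ := exists_nat_gt (-x)
      exact Set.mem_iUnion.2 ⟨n, Set.mem_Ioi.2 (by linarith)⟩⟩
  refine Measure.ext_of_generateFrom_of_iUnion
    (Set.pi Set.univ '' Set.pi Set.univ fun _ : Fin 2 => Set.range (Set.Ioi : ℝ → Set ℝ))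
    (fun n : ℕ => {a | ∀ i, -(n : ℝ) < a i}) ?_ ?_ ?_ ?_ (fun n => measure_ne_top _ _) ?_
  · refine Eq.trans ?_ (generateFrom_pi_eq hspan)
    congr 1
    ext1 i
    rw [← borel_eq_generateFrom_Ioi]
    exact BorelSpace.measurable_eq
  · have hpi : ∀ _ : Fin 2, IsPiSystem (Set.range (Set.Ioi : ℝ → Set ℝ)) :=
      fun _ => isPiSystem_Ioi
    exact IsPiSystem.pi hpi
  · refine Set.eq_univ_of_forall fun a => ?_
    obtain ⟨n, hn⟩ := exists_nat_gt (max (-a 0) (-a 1))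
    refine Set.mem_iUnion.2 ⟨n, Fin.forall_fin_two.2 ?_⟩
    have h0 := le_max_left (-a 0) (-a 1)
    have h1 := le_max_right (-a 0) (-a 1)
    constructor <;> linarith
  · intro n
    exact ⟨fun _ => Set.Ioi (-(n : ℝ)), fun i _ => ⟨_, rfl⟩, (hpi fun _ => -(n : ℝ)).symm⟩
  · rintro _ ⟨t, ht, rfl⟩
    choose x hx using fun i => ht i (Set.mem_univ i)
    obtain rfl : (fun i => Set.Ioi (x i)) = t := funext hx
    rw [← hpi]
    exact h x

/-- On quadrants whose corner is not positive, the law of `AND`'s bids is given by a marginal. -/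
theorem HasStarMarginals.measure_Ioi_box (hF : HasStarMarginals v F) (hij : i ≠ j) {x : Bid}
    (hx : x i < 0 ∨ x i = 0 ∧ 0 ≤ x j) :
    F {a | ∀ i, x i < a i} = andLaw v (Set.Ioi (x j)) := by
  rw [← hF.map_eq j, Measure.map_apply (measurable_pi_apply j) measurableSet_Ioi]
  refine measure_congr ?_
  filter_upwards [hF.ae_mem, hF.ae_zero_iff i j] with a ha hz
  refine propext ⟨fun h => h j, fun h k => ?_⟩
  have hj : x j < a j := h
  rcases eq_or_eq_of_ne hij k with rfl | rfl
  · rcases hx with hx | ⟨hx, hx'⟩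
    · exact hx.trans_le (ha k).1
    · rw [hx]
      exact lt_of_le_of_ne (ha k).1 fun h' => (hx'.trans_lt hj).ne' (hz.1 h'.symm)
  · exact hj

theorem HasStarMarginals.integral_prod_of_pos (hF : HasStarMarginals v F) {o : Bid}
    (ho : ∀ i, 0 < o i) :
    ∫ a, ∏ i, andWinsItem τ i (a i) (o i) ∂F = F.real {a | ∀ i, o i < a i} := by
  rw [← integral_indicator_one (measurableSet_Ioi_box o)]
  refine integral_congr_ae ?_
  filter_upwards [hF.ae_ne (ho 0) 0, hF.ae_ne (ho 1) 1] with a h0 h1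
  rw [Fin.prod_univ_two]
  rcases h0.lt_or_gt with h0 | h0
  · rw [andWinsItem_of_gt τ 0 h0, zero_mul, Set.indicator_of_notMem]
    exact fun h => h0.not_gt (h 0)
  · rcases h1.lt_or_gt with h1 | h1
    · rw [andWinsItem_of_gt τ 1 h1, mul_zero, Set.indicator_of_notMem]
      exact fun h => h1.not_gt (h 1)
    · rw [andWinsItem_of_lt τ 0 h0, andWinsItem_of_lt τ 1 h1, Set.indicator_of_mem]
      · simp
      · exact Fin.forall_fin_two.2 ⟨h0, h1⟩

/-- Against bids in `(0, 1/2)²`, the payoff of `AND` is the mass of an open upper quadrant up to a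
term depending on the marginals only, and the other quadrants are covered by `measure_Ioi_box`. -/
theorem HasStarMarginals.eq_andStar (hF : HasStarMarginals v F) (hv : 1 / 2 < v)
    (h : ∀ o : Bid, (∀ i, o i ∈ Set.Ioo (0 : ℝ) (1 / 2)) →
      ∫ a, payoffAnd τ a o ∂andStar v ≤ ∫ a, payoffAnd τ a o ∂F) : F = andStar v := by
  have := hF.isProbabilityMeasure hv
  have hS := hasStarMarginals_andStar (v := v)
  have := hS.isProbabilityMeasure hv
  refine ext_of_Ioi_box fun x => ?_
  have hne : (0 : Fin 2) ≠ 1 := by decide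
  rcases lt_trichotomy (x 0) 0 with h0 | h0 | h0
  · rw [hF.measure_Ioi_box hne (.inl h0), hS.measure_Ioi_box hne (.inl h0)]
  · rcases lt_or_ge (x 1) 0 with h1 | h1
    · rw [hF.measure_Ioi_box hne.symm (.inl h1), hS.measure_Ioi_box hne.symm (.inl h1)]
    · rw [hF.measure_Ioi_box hne (.inr ⟨h0, h1⟩), hS.measure_Ioi_box hne (.inr ⟨h0, h1⟩)]
  · rcases lt_trichotomy (x 1) 0 with h1 | h1 | h1
    · rw [hF.measure_Ioi_box hne.symm (.inl h1), hS.measure_Ioi_box hne.symm (.inl h1)]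
    · rw [hF.measure_Ioi_box hne.symm (.inr ⟨h1, h0.le⟩),
        hS.measure_Ioi_box hne.symm (.inr ⟨h1, h0.le⟩)]
    · have hx : ∀ i, 0 < x i := Fin.forall_fin_two.2 ⟨h0, h1⟩
      by_cases hx' : ∀ i, x i < 1 / 2
      · have h2 := h x fun i => ⟨hx i, hx' i⟩
        rw [hF.integral_payoffAnd hv, hS.integral_payoffAnd hv, sub_le_sub_iff_right,
          hF.integral_prod_of_pos hx, hS.integral_prod_of_pos hx] at h2
        have h3 := hF.integral_prod_andWinsItem_le (τ := τ) hv fun i => (hx i).le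
        rw [hF.integral_prod_of_pos hx, hS.integral_prod_of_pos hx] at h3
        exact (measureReal_eq_measureReal_iff).1 (le_antisymm h3 h2)
      · push Not at hx'
        obtain ⟨i, hi⟩ := hx'
        have e (F : Measure Bid) (hF : HasStarMarginals v F) : F {a | ∀ i, x i < a i} = 0 := by
          refine measure_eq_zero_iff_ae_notMem.2 ?_
          filter_upwards [hF.ae_mem] with a ha h
          linarith [(ha i).2, h i]
        rw [e F hF, e _ hS]

theorem HasStarMarginals.exists_utilityAnd_lt (hF : HasStarMarginals v F) (hv : 1 / 2 < v)
    (hH : 1 / 2 < H) (hF' : IsMixedStrategy H F) (hne : F ≠ andStar v) :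
    ∃ G, IsMixedStrategy H G ∧ utilityAnd τ F G < utilityAnd τ (andStar v) G := by
  by_contra! hcon
  refine hne (hF.eq_andStar (τ := τ) hv fun o ho => ?_)
  have ho' : ∀ i, o i ∈ Set.Icc (0 : ℝ) H := fun i => ⟨(ho i).1.le, (ho i).2.le.trans hH.le⟩
  have h := hcon _ (isMixedStrategy_dirac ho')
  rwa [utilityAnd_dirac_right ho' hF',
    utilityAnd_dirac_right ho' (isMixedStrategy_andStar hv hH)] at h

end Dominance

/-! ### Best responses -/

section BestResponse

variable {v H : ℝ} {τ : TieRule} {F G : Measure Bid}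

theorem ae_eq_const_of_le_of_integral_eq {X : Type*} [MeasurableSpace X] {μ : Measure X}
    [IsProbabilityMeasure μ] {f : X → ℝ} {c : ℝ} (hf : Integrable f μ) (hle : ∀ᵐ x ∂μ, f x ≤ c)
    (h : ∫ x, f x ∂μ = c) : ∀ᵐ x ∂μ, f x = c := by
  have h0 : ∫ x, (c - f x) ∂μ = 0 := by
    rw [integral_sub (integrable_const _) hf, h]
    simp
  have h1 := (integral_eq_zero_iff_of_nonneg_ae
    (by filter_upwards [hle] with x hx using sub_nonneg.2 hx)
    ((integrable_const c).sub hf)).1 h0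
  filter_upwards [h1] with x hx
  simpa [sub_eq_zero, eq_comm] using hx

namespace IsNashEquilibrium

theorem pureAnd_le (hN : IsNashEquilibrium v H τ F G) {a : Bid}
    (ha : ∀ i, a i ∈ Set.Icc 0 H) : pureAnd τ G a ≤ utilityAnd τ F G := by
  rw [← utilityAnd_dirac ha hN.2.1]
  exact hN.2.2.1 _ (isMixedStrategy_dirac ha)

theorem pureOr_le (hN : IsNashEquilibrium v H τ F G) (hv : 0 ≤ v) {o : Bid}
    (ho : ∀ i, o i ∈ Set.Icc 0 H) : pureOr v τ F o ≤ utilityOr v τ F G := by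
  rw [← utilityOr_dirac hv ho hN.1]
  exact hN.2.2.2 _ (isMixedStrategy_dirac ho)

theorem ae_pureAnd_eq (hN : IsNashEquilibrium v H τ F G) :
    ∀ᵐ a ∂F, pureAnd τ G a = utilityAnd τ F G := by
  have := hN.1.1
  refine ae_eq_const_of_le_of_integral_eq (integrable_pureAnd hN.1 hN.2.1) ?_
    (utilityAnd_eq hN.1 hN.2.1).symm
  filter_upwards [hN.1.2] with a ha using hN.pureAnd_le ha

theorem ae_pureOr_eq (hN : IsNashEquilibrium v H τ F G) (hv : 0 ≤ v) :
    ∀ᵐ o ∂G, pureOr v τ F o = utilityOr v τ F G := by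
  have := hN.2.1.1
  refine ae_eq_const_of_le_of_integral_eq (integrable_pureOr hv hN.1 hN.2.1) ?_
    (utilityOr_eq hv hN.1 hN.2.1).symm
  filter_upwards [hN.2.1.2] with o ho using hN.pureOr_le hv ho

theorem utilityAnd_nonneg (hN : IsNashEquilibrium v H τ F G) (hH : 0 ≤ H) :
    0 ≤ utilityAnd τ F G := by
  refine le_trans ?_ (hN.pureAnd_le (a := fun _ => 0) fun _ => ⟨le_rfl, hH⟩)
  refine integral_nonneg fun o => ?_
  simp only [payoffAnd, zero_mul, Finset.sum_const_zero, sub_zero]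
  exact prod_andWinsItem_nonneg τ (fun _ => 0) o

theorem utilityOr_nonneg (hN : IsNashEquilibrium v H τ F G) (hv : 0 ≤ v) (hH : 0 ≤ H) :
    0 ≤ utilityOr v τ F G := by
  refine le_trans ?_ (hN.pureOr_le hv (o := fun _ => 0) fun _ => ⟨le_rfl, hH⟩)
  refine integral_nonneg fun a => ?_
  simp only [payoffOr, zero_mul, Finset.sum_const_zero, sub_zero]
  exact mul_nonneg hv (sub_nonneg.2 (prod_andWinsItem_le_one τ a (fun _ => 0)))

end IsNashEquilibrium

theorem tendsto_pureAnd [IsProbabilityMeasure G] {b : ℕ → Bid} {x : Bid}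
    (hb : ∀ n i, b n i ∈ Set.Icc 0 H) (hx : ∀ i, Tendsto (fun n => b n i) atTop (𝓝 (x i)))
    {w : Fin 2 → ℝ → ℝ}
    (hw : ∀ i t, Tendsto (fun n => andWinsItem τ i (b n i) t) atTop (𝓝 (w i t))) :
    Tendsto (fun n => pureAnd τ G (b n)) atTop
      (𝓝 (∫ o, (∏ i, w i (o i) - ∑ i, x i * w i (o i)) ∂G)) := by
  refine tendsto_integral_of_dominated_convergence (fun _ => 1 + 2 * H)
    (fun n => Measurable.aestronglyMeasurable (by fun_prop)) (integrable_const _)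
    (fun n => .of_forall fun o => by simpa using abs_payoffAnd_le τ (hb n))
    (.of_forall fun o => ?_)
  exact (tendsto_finsetProd _ fun i _ => hw i (o i)).sub
    (tendsto_finsetSum _ fun i _ => (hx i).mul (hw i (o i)))

theorem tendsto_pureOr [IsProbabilityMeasure F] (hv : 0 ≤ v) {b : ℕ → Bid} {x : Bid}
    (hb : ∀ n i, b n i ∈ Set.Icc 0 H) (hx : ∀ i, Tendsto (fun n => b n i) atTop (𝓝 (x i)))
    {w : Fin 2 → ℝ → ℝ}
    (hw : ∀ i t, Tendsto (fun n => andWinsItem τ i t (b n i)) atTop (𝓝 (w i t))) :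
    Tendsto (fun n => pureOr v τ F (b n)) atTop
      (𝓝 (∫ a, (v * (1 - ∏ i, w i (a i)) - ∑ i, x i * (1 - w i (a i))) ∂F)) := by
  refine tendsto_integral_of_dominated_convergence (fun _ => v + 2 * H)
    (fun n => Measurable.aestronglyMeasurable (by fun_prop)) (integrable_const _)
    (fun n => .of_forall fun o => by simpa using abs_payoffOr_le hv τ (hb n))
    (.of_forall fun a => ?_)
  exact ((tendsto_const_nhds.sub (tendsto_finsetProd _ fun i _ => hw i (a i))).const_mul v).sub
    (tendsto_finsetSum _ fun i _ => (hx i).mul (tendsto_const_nhds.sub (hw i (a i))))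

/-- Bids slightly above `x`, within the allowed range. -/
def overbid (H : ℝ) (x : Bid) (n : ℕ) : Bid := fun i => x i + (H - x i) * (1 / ((n : ℝ) + 1))

section Overbid

variable {x : Bid} (hx : ∀ i, x i ∈ Set.Ico 0 H)
include hx

theorem overbid_mem (n : ℕ) (i : Fin 2) : overbid H x n i ∈ Set.Icc 0 H := by
  have h1 : (0 : ℝ) < 1 / ((n : ℝ) + 1) := by positivity
  have h2 : 1 / ((n : ℝ) + 1) ≤ 1 := by
    rw [div_le_one (by positivity)]
    linarith [Nat.cast_nonneg (α := ℝ) n]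
  obtain ⟨h3, h4⟩ := hx i
  unfold overbid
  constructor <;> nlinarith

theorem lt_overbid (n : ℕ) (i : Fin 2) : x i < overbid H x n i := by
  have h1 : (0 : ℝ) < 1 / ((n : ℝ) + 1) := by positivity
  have := mul_pos (sub_pos.2 (hx i).2) h1
  unfold overbid
  linarith

omit hx in
theorem tendsto_overbid (i : Fin 2) : Tendsto (fun n => overbid H x n i) atTop (𝓝 (x i)) := by
  have h := (tendsto_one_div_add_atTop_nhds_zero_nat (𝕜 := ℝ)).const_mul (H - x i)
  simpa [overbid] using h.const_add (x i)

theorem tendsto_andWinsItem_overbid (i : Fin 2) (t : ℝ) :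
    Tendsto (fun n => andWinsItem τ i (overbid H x n i) t) atTop
      (𝓝 ((Set.Iic (x i)).indicator (fun _ => 1) t)) := by
  refine tendsto_const_nhds.congr' ?_
  by_cases h : t ≤ x i
  · refine .of_forall fun n => ?_
    beta_reduce
    rw [Set.indicator_of_mem (by exact h), andWinsItem_of_lt τ i (h.trans_lt (lt_overbid hx n i))]
  · rw [Set.indicator_of_notMem (by exact h)]
    filter_upwards [(tendsto_overbid (H := H) i).eventually_lt_const (not_le.1 h)] with n hn
    rw [andWinsItem_of_gt τ i hn]

theorem tendsto_andWinsItem_overbid' (i : Fin 2) (t : ℝ) :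
    Tendsto (fun n => andWinsItem τ i t (overbid H x n i)) atTop
      (𝓝 (1 - (Set.Iic (x i)).indicator (fun _ => 1) t)) := by
  refine tendsto_const_nhds.congr' ?_
  by_cases h : t ≤ x i
  · refine .of_forall fun n => ?_
    beta_reduce
    rw [Set.indicator_of_mem (by exact h), andWinsItem_of_gt τ i (h.trans_lt (lt_overbid hx n i))]
    ring
  · rw [Set.indicator_of_notMem (by exact h)]
    filter_upwards [(tendsto_overbid (H := H) i).eventually_lt_const (not_le.1 h)] with n hn
    rw [andWinsItem_of_lt τ i hn]
    ring

end Overbid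

theorem measurableSet_coord_le (i : Fin 2) (x : ℝ) : MeasurableSet {a : Bid | a i ≤ x} :=
  measurableSet_le (measurable_pi_apply i) measurable_const

theorem measurableSet_le_box (x : Bid) : MeasurableSet {a : Bid | ∀ i, a i ≤ x i} := by
  rw [Set.ofPred_forall]
  exact MeasurableSet.iInter fun i => measurableSet_coord_le i (x i)

theorem indicator_le_box (x a : Bid) : {a : Bid | ∀ i, a i ≤ x i}.indicator (fun _ => (1 : ℝ)) a =
    ∏ i, (Set.Iic (x i)).indicator (fun _ => (1 : ℝ)) (a i) := by
  simp only [Fin.prod_univ_two, Set.indicator, Set.mem_Iic, Set.mem_ofPred_eq, Fin.forall_fin_two]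
  split_ifs <;> simp_all

theorem integral_indicator_Iic [IsProbabilityMeasure F] (i : Fin 2) (x : ℝ) :
    ∫ a : Bid, (Set.Iic x).indicator (fun _ => (1 : ℝ)) (a i) ∂F = F.real {a | a i ≤ x} := by
  rw [← integral_indicator_one (measurableSet_coord_le i x)]
  rfl

theorem integrable_indicator_Iic [IsProbabilityMeasure F] (i : Fin 2) (x : ℝ) :
    Integrable (fun a : Bid => (Set.Iic x).indicator (fun _ => (1 : ℝ)) (a i)) F :=
  (integrable_const (1 : ℝ)).indicator (measurableSet_coord_le i x)

/-- Bidding just above `x` wins all ties at `x`, at a cost which is that of `x` in the limit. -/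
theorem IsNashEquilibrium.overbid_and (hN : IsNashEquilibrium v H τ F G) {x : Bid}
    (hx : ∀ i, x i ∈ Set.Ico 0 H) :
    G.real {o | ∀ i, o i ≤ x i} - ∑ i, x i * G.real {o | o i ≤ x i} ≤ utilityAnd τ F G := by
  have := hN.2.1.1
  have h := le_of_tendsto' (tendsto_pureAnd (G := G) (τ := τ) (overbid_mem hx) tendsto_overbid
    (tendsto_andWinsItem_overbid hx)) fun n => hN.pureAnd_le (overbid_mem hx n)
  simp_rw [← indicator_le_box] at h
  have hi (i : Fin 2) := (integrable_indicator_Iic (F := G) i (x i)).const_mul (x i)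
  rw [integral_sub ((integrable_const _).indicator (measurableSet_le_box x))
    (integrable_finsetSum _ fun i _ => hi i), integral_finsetSum _ fun i _ => hi i,
    integral_indicator_const _ (measurableSet_le_box x)] at h
  simp_rw [integral_const_mul, integral_indicator_Iic] at h
  simpa using h

/-- The bound for `OR` obtained from bids just above `x`. -/
theorem IsNashEquilibrium.overbid_or (hN : IsNashEquilibrium v H τ F G) (hv : 0 ≤ v) {x : Bid}
    (hx : ∀ i, x i ∈ Set.Ico 0 H) :
    ∑ i, (v - x i) * F.real {a | a i ≤ x i} - v * F.real {a | ∀ i, a i ≤ x i}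
      ≤ utilityOr v τ F G := by
  have := hN.1.1
  have h := le_of_tendsto' (tendsto_pureOr (F := F) (τ := τ) hv (overbid_mem hx) tendsto_overbid
    (tendsto_andWinsItem_overbid' hx)) fun n => hN.pureOr_le hv (overbid_mem hx n)
  have e : (fun a : Bid => v * (1 - ∏ i, (1 - (Set.Iic (x i)).indicator (fun _ => 1) (a i)))
      - ∑ i, x i * (1 - (1 - (Set.Iic (x i)).indicator (fun _ => 1) (a i)))) = fun a =>
      ∑ i, (v - x i) * (Set.Iic (x i)).indicator (fun _ => 1) (a i)
        - v * {a : Bid | ∀ i, a i ≤ x i}.indicator (fun _ => 1) a := by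
    ext a
    rw [indicator_le_box]
    simp only [Fin.prod_univ_two, Fin.sum_univ_two]
    ring
  rw [e] at h
  have hi (i : Fin 2) := (integrable_indicator_Iic (F := F) i (x i)).const_mul (v - x i)
  rw [integral_sub (integrable_finsetSum _ fun i _ => hi i)
    (((integrable_const _).indicator (measurableSet_le_box x)).const_mul _),
    integral_finsetSum _ fun i _ => hi i, integral_const_mul,
    integral_indicator_const _ (measurableSet_le_box x)] at h
  simp_rw [integral_const_mul, integral_indicator_Iic] at h
  simpa using h

end BestResponse

/-! ### Complementarity of `AND`'s bids -/

section Supermodular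

variable {v H : ℝ} {τ : TieRule} {F G : Measure Bid}

/-- The payoff of `AND` is supermodular in its bids: the gain from rearranging two bids
comonotonically is at least the mismatch of the winning probabilities. -/
theorem payoffAnd_supermodular (τ : TieRule) (a a' o : Bid) :
    max 0 (-∏ i, (andWinsItem τ i (a i) (o i) - andWinsItem τ i (a' i) (o i))) ≤
      payoffAnd τ (a ⊓ a') o + payoffAnd τ (a ⊔ a') o
        - (payoffAnd τ a o + payoffAnd τ a' o) := by
  have h0 := @andWinsItem_mono τ 0 (o 0)
  have h1 := @andWinsItem_mono τ 1 (o 1)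
  simp only [payoffAnd, Fin.prod_univ_two, Fin.sum_univ_two, Pi.inf_apply, Pi.sup_apply]
  rcases le_total (a 0) (a' 0) with e0 | e0 <;> rcases le_total (a 1) (a' 1) with e1 | e1 <;>
    have d0 := h0 e0 <;> have d1 := h1 e1 <;> simp only at d0 d1 <;>
    simp only [e0, e1, inf_of_le_left, inf_of_le_right, sup_of_le_left, sup_of_le_right] <;>
    apply max_le <;> nlinarith [mul_nonneg (sub_nonneg.2 d0) (sub_nonneg.2 d1)]

theorem inf_mem_box {a a' : Bid} (h : ∀ i, a i ∈ Set.Icc 0 H) (h' : ∀ i, a' i ∈ Set.Icc 0 H)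
    (i : Fin 2) : (a ⊓ a') i ∈ Set.Icc 0 H :=
  ⟨le_inf (h i).1 (h' i).1, inf_le_left.trans (h i).2⟩

theorem sup_mem_box {a a' : Bid} (h : ∀ i, a i ∈ Set.Icc 0 H) (h' : ∀ i, a' i ∈ Set.Icc 0 H)
    (i : Fin 2) : (a ⊔ a') i ∈ Set.Icc 0 H :=
  ⟨(h i).1.trans le_sup_left, sup_le (h i).2 (h' i).2⟩

theorem pureAnd_supermodular [IsProbabilityMeasure G] (τ : TieRule) (a a' : Bid) :
    pureAnd τ G a + pureAnd τ G a' ≤ pureAnd τ G (a ⊓ a') + pureAnd τ G (a ⊔ a') := by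
  unfold pureAnd
  rw [← integral_add (integrable_payoffAnd_left _) (integrable_payoffAnd_left _),
    ← integral_add (integrable_payoffAnd_left _) (integrable_payoffAnd_left _)]
  refine integral_mono ((integrable_payoffAnd_left _).add (integrable_payoffAnd_left _))
    ((integrable_payoffAnd_left _).add (integrable_payoffAnd_left _)) fun o => ?_
  have := (le_max_left _ _).trans (payoffAnd_supermodular τ a a' o)
  simp only
  linarith

/-- Best responses of `AND` are closed under meets and joins. -/
theorem IsNashEquilibrium.ae_inf_sup (hN : IsNashEquilibrium v H τ F G) :
    ∀ᵐ p ∂F.prod F, pureAnd τ G (p.1 ⊓ p.2) = utilityAnd τ F G ∧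
      pureAnd τ G (p.1 ⊔ p.2) = utilityAnd τ F G := by
  have := hN.1.1
  have := hN.2.1.1
  filter_upwards [ae_prod_fst hN.ae_pureAnd_eq, ae_prod_snd hN.ae_pureAnd_eq,
    ae_prod_fst hN.1.2, ae_prod_snd hN.1.2] with p h1 h2 h3 h4
  have h5 := pureAnd_supermodular (G := G) τ p.1 p.2
  have h6 := hN.pureAnd_le (inf_mem_box h3 h4)
  have h7 := hN.pureAnd_le (sup_mem_box h3 h4)
  constructor <;> linarith

/-- Against almost every bid of `OR`, `AND`'s chances of winning the two items are ordered in the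
same way. -/
theorem IsNashEquilibrium.ae_comonotone (hN : IsNashEquilibrium v H τ F G) :
    ∀ᵐ o ∂G, ∀ᵐ p ∂F.prod F,
      0 ≤ ∏ i, (andWinsItem τ i (p.1 i) (o i) - andWinsItem τ i (p.2 i) (o i)) := by
  have := hN.1.1
  have := hN.2.1.1
  rw [← Measure.ae_ae_comm (p := fun (p : Bid × Bid) (o : Bid) =>
    0 ≤ ∏ i, (andWinsItem τ i (p.1 i) (o i) - andWinsItem τ i (p.2 i) (o i)))
    (measurableSet_le measurable_const (by fun_prop))]
  filter_upwards [ae_prod_fst hN.ae_pureAnd_eq, ae_prod_snd hN.ae_pureAnd_eq, hN.ae_inf_sup]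
    with p h1 h2 h3
  have hI (a : Bid) : Integrable (fun o => payoffAnd τ a o) G := integrable_payoffAnd_left a
  have hD : ∫ o, (payoffAnd τ (p.1 ⊓ p.2) o + payoffAnd τ (p.1 ⊔ p.2) o
        - (payoffAnd τ p.1 o + payoffAnd τ p.2 o)) ∂G = 0 := by
    have hI₂ (a b : Bid) : Integrable (fun o => payoffAnd τ a o + payoffAnd τ b o) G :=
      (hI a).add (hI b)
    rw [integral_sub (hI₂ _ _) (hI₂ _ _), integral_add (hI _) (hI _),
      integral_add (hI _) (hI _)]
    unfold pureAnd at h1 h2 h3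
    rw [h1, h2, h3.1, h3.2]
    ring
  have h4 := (integral_eq_zero_iff_of_nonneg
    (fun o => (le_max_left _ _).trans (payoffAnd_supermodular τ p.1 p.2 o))
    (((hI _).add (hI _)).sub ((hI _).add (hI _)))).1 hD
  filter_upwards [h4] with o ho
  have h5 := (le_max_right _ _).trans (payoffAnd_supermodular τ p.1 p.2 o)
  rw [ho] at h5
  simpa using h5

end Supermodular

/-! ### Extreme bids of `AND` -/

section Extreme

variable {v H : ℝ} {τ : TieRule} {F G : Measure Bid}

theorem exists_pair_mem [IsProbabilityMeasure F] {S : Fin 2 → Set ℝ}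
    (hS : ∀ i, F {a | a i ∈ S i} ≠ 0) {P : Bid × Bid → Prop} (hP : ∀ᵐ p ∂F.prod F, P p) :
    ∃ p : Bid × Bid, p.1 0 ∈ S 0 ∧ p.2 1 ∈ S 1 ∧ P p := by
  have h : (F.prod F) ({a | a 0 ∈ S 0} ×ˢ {a | a 1 ∈ S 1}) ≠ 0 := by
    rw [Measure.prod_prod]
    exact mul_ne_zero (hS 0) (hS 1)
  obtain ⟨p, ⟨h0, h1⟩, h2⟩ := ((frequently_ae_mem_iff.2 h).and_eventually hP).exists
  exact ⟨p, h0, h1, h2⟩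

/-- If joint best responses of `AND` can be chosen in shrinking sets around `x`, then the limit of
their payoffs is the equilibrium payoff. -/
theorem IsNashEquilibrium.integral_limit_eq (hN : IsNashEquilibrium v H τ F G)
    {op : ℝ → ℝ → ℝ} (hcomm : ∀ s t, op s t = op t s)
    (hop : ∀ s ∈ Set.Icc 0 H, ∀ t ∈ Set.Icc 0 H, op s t ∈ Set.Icc 0 H)
    (hbest : ∀ᵐ p ∂F.prod F, pureAnd τ G (fun i => op (p.1 i) (p.2 i)) = utilityAnd τ F G)
    {S : Fin 2 → ℕ → Set ℝ} (hS : ∀ i n, F {a | a i ∈ S i n} ≠ 0)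
    (hSop : ∀ i n, ∀ᵐ a ∂F, ∀ t ∈ S i n, op t (a i) ∈ S i n) {x : Bid} {w : Fin 2 → ℝ → ℝ}
    (hlim : ∀ i (t : ℕ → ℝ), (∀ n, t n ∈ S i n) → Tendsto t atTop (𝓝 (x i)) ∧
      ∀ o, Tendsto (fun n => andWinsItem τ i (t n) o) atTop (𝓝 (w i o))) :
    ∫ o, (∏ i, w i (o i) - ∑ i, x i * w i (o i)) ∂G = utilityAnd τ F G := by
  have := hN.1.1
  have := hN.2.1.1
  have key (n : ℕ) : ∃ b : Bid, (∀ i, b i ∈ S i n) ∧ (∀ i, b i ∈ Set.Icc 0 H) ∧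
      pureAnd τ G b = utilityAnd τ F G := by
    obtain ⟨p, h0, h1, h2, h3, h4, h5, h6⟩ := exists_pair_mem (F := F) (fun i => hS i n)
      (hbest.and ((ae_prod_fst hN.1.2).and ((ae_prod_snd hN.1.2).and
        ((ae_prod_snd (hSop 0 n)).and (ae_prod_fst (hSop 1 n))))))
    refine ⟨_, Fin.forall_fin_two.2 ⟨h5 _ h0, ?_⟩, fun i => hop _ (h3 i) _ (h4 i), h2⟩
    rw [hcomm]
    exact h6 _ h1
  choose b hb hb' hbest' using key
  refine tendsto_nhds_unique (tendsto_pureAnd (τ := τ) hb'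
    (fun i => (hlim i _ fun n => hb n i).1) fun i => (hlim i _ fun n => hb n i).2) ?_
  simp_rw [hbest']
  exact tendsto_const_nhds

/-- The limit, for bids of `AND` on item `i` approaching an extreme point `x` of their law, of the
probability of winning against `o`. If `x` is not an atom, it is approached by other bids, which
win against `x` with probability `s`. -/
def limitWin (τ : TieRule) (F : Measure Bid) (i : Fin 2) (s x o : ℝ) : ℝ :=
  if o < x then 1 else if o = x then if F {a | a i = x} = 0 then s else τ.andWins i x else 0

theorem limitWin_mem (i : Fin 2) {s : ℝ} (hs : s ∈ Set.Icc (0 : ℝ) 1) (x o : ℝ) :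
    limitWin τ F i s x o ∈ Set.Icc (0 : ℝ) 1 := by
  unfold limitWin
  split_ifs
  exacts [⟨zero_le_one, le_rfl⟩, hs, τ.mem_Icc i x, ⟨le_rfl, zero_le_one⟩]

@[fun_prop]
theorem measurable_limitWin {X : Type*} [MeasurableSpace X] (i : Fin 2) (s x : ℝ) {f : X → ℝ}
    (hf : Measurable f) : Measurable fun o => limitWin τ F i s x (f o) := by
  unfold limitWin
  exact Measurable.ite (measurableSet_lt hf measurable_const) measurable_const
    (Measurable.ite (measurableSet_eq_fun hf measurable_const) measurable_const measurable_const)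

theorem tendsto_andWinsItem_of_lim {t : ℕ → ℝ} {x o : ℝ} (i : Fin 2)
    (ht : Tendsto t atTop (𝓝 x)) (ho : o ≠ x) (s : ℝ) :
    Tendsto (fun n => andWinsItem τ i (t n) o) atTop (𝓝 (limitWin τ F i s x o)) := by
  refine tendsto_const_nhds.congr' ?_
  rcases ho.lt_or_gt with h | h
  · filter_upwards [ht.eventually_const_lt h] with n hn
    rw [andWinsItem_of_lt τ i hn, limitWin, if_pos h]
  · filter_upwards [ht.eventually_lt_const h] with n hn
    rw [andWinsItem_of_gt τ i hn, limitWin, if_neg h.not_gt, if_neg ho]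

/-- Bids of `AND` on item `i` just below their essential supremum `x`, or equal to it if it is an
atom. -/
def topSet (F : Measure Bid) (i : Fin 2) (x : ℝ) (n : ℕ) : Set ℝ :=
  if F {a | a i = x} = 0 then Set.Ioo (x - 1 / ((n : ℝ) + 1)) x else {x}

/-- Bids of `AND` on item `i` just above their essential infimum `x`, or equal to it if it is an
atom. -/
def bottomSet (F : Measure Bid) (i : Fin 2) (x : ℝ) (n : ℕ) : Set ℝ :=
  if F {a | a i = x} = 0 then Set.Ioo x (x + 1 / ((n : ℝ) + 1)) else {x}

theorem topSet_lim (i : Fin 2) {x : ℝ} {t : ℕ → ℝ} (ht : ∀ n, t n ∈ topSet F i x n) :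
    Tendsto t atTop (𝓝 x) ∧
      ∀ o, Tendsto (fun n => andWinsItem τ i (t n) o) atTop (𝓝 (limitWin τ F i 0 x o)) := by
  by_cases hx : F {a | a i = x} = 0
  · simp only [topSet, hx, if_true, Set.mem_Ioo] at ht
    have h : Tendsto t atTop (𝓝 x) := by
      have h0 := (tendsto_one_div_add_atTop_nhds_zero_nat (𝕜 := ℝ)).const_sub x
      rw [sub_zero] at h0
      exact tendsto_of_tendsto_of_tendsto_of_le_of_le h0 tendsto_const_nhds
        (fun n => (ht n).1.le) fun n => (ht n).2.le
    refine ⟨h, fun o => ?_⟩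
    by_cases ho : o = x
    · simp only [ho, limitWin, lt_irrefl, if_false, if_true, hx]
      simp only [andWinsItem_of_gt τ i (ht _).2]
      exact tendsto_const_nhds
    · exact tendsto_andWinsItem_of_lim i h ho 0
  · simp only [topSet, hx, if_false, Set.mem_singleton_iff] at ht
    obtain rfl : t = fun _ => x := funext ht
    refine ⟨tendsto_const_nhds, fun o => ?_⟩
    by_cases ho : o = x
    · simp only [ho, limitWin, lt_irrefl, if_false, if_true, hx, andWinsItem_self]
      exact tendsto_const_nhds
    · exact tendsto_andWinsItem_of_lim i tendsto_const_nhds ho 0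

theorem bottomSet_lim (i : Fin 2) {x : ℝ} {t : ℕ → ℝ} (ht : ∀ n, t n ∈ bottomSet F i x n) :
    Tendsto t atTop (𝓝 x) ∧
      ∀ o, Tendsto (fun n => andWinsItem τ i (t n) o) atTop (𝓝 (limitWin τ F i 1 x o)) := by
  by_cases hx : F {a | a i = x} = 0
  · simp only [bottomSet, hx, if_true, Set.mem_Ioo] at ht
    have h : Tendsto t atTop (𝓝 x) := by
      have h0 := (tendsto_one_div_add_atTop_nhds_zero_nat (𝕜 := ℝ)).const_add x
      rw [add_zero] at h0
      exact tendsto_of_tendsto_of_tendsto_of_le_of_le tendsto_const_nhds h0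
        (fun n => (ht n).1.le) fun n => (ht n).2.le
    refine ⟨h, fun o => ?_⟩
    by_cases ho : o = x
    · simp only [ho, limitWin, lt_irrefl, if_false, if_true, hx]
      simp only [andWinsItem_of_lt τ i (ht _).1]
      exact tendsto_const_nhds
    · exact tendsto_andWinsItem_of_lim i h ho 1
  · simp only [bottomSet, hx, if_false, Set.mem_singleton_iff] at ht
    obtain rfl : t = fun _ => x := funext ht
    refine ⟨tendsto_const_nhds, fun o => ?_⟩
    by_cases ho : o = x
    · simp only [ho, limitWin, lt_irrefl, if_false, if_true, hx, andWinsItem_self]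
      exact tendsto_const_nhds
    · exact tendsto_andWinsItem_of_lim i tendsto_const_nhds ho 1

theorem measure_topSet_ne_zero {i : Fin 2} {x : ℝ} (hle : ∀ᵐ a ∂F, a i ≤ x)
    (hpos : ∀ y < x, F {a | y < a i} ≠ 0) (n : ℕ) : F {a | a i ∈ topSet F i x n} ≠ 0 := by
  by_cases hx : F {a | a i = x} = 0
  · have h1 : (0 : ℝ) < 1 / ((n : ℝ) + 1) := by positivity
    refine fun h0 => hpos (x - 1 / ((n : ℝ) + 1)) (by linarith) ?_
    rw [measure_eq_zero_iff_ae_notMem] at hx h0 ⊢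
    filter_upwards [hle, hx, h0] with a ha hax h h'
    simp only [topSet, (measure_eq_zero_iff_ae_notMem.2 hx : F {a | a i = x} = 0), if_true] at h
    exact h ⟨h', lt_of_le_of_ne ha hax⟩
  · simp [topSet, hx]

theorem measure_bottomSet_ne_zero {i : Fin 2} {x : ℝ} (hle : ∀ᵐ a ∂F, x ≤ a i)
    (hpos : ∀ y > x, F {a | a i < y} ≠ 0) (n : ℕ) : F {a | a i ∈ bottomSet F i x n} ≠ 0 := by
  by_cases hx : F {a | a i = x} = 0
  · have h1 : (0 : ℝ) < 1 / ((n : ℝ) + 1) := by positivity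
    refine fun h0 => hpos (x + 1 / ((n : ℝ) + 1)) (by linarith) ?_
    rw [measure_eq_zero_iff_ae_notMem] at hx h0 ⊢
    filter_upwards [hle, hx, h0] with a ha hax h h'
    simp only [bottomSet, (measure_eq_zero_iff_ae_notMem.2 hx : F {a | a i = x} = 0), if_true] at h
    exact h ⟨lt_of_le_of_ne ha (Ne.symm hax), h'⟩
  · simp [bottomSet, hx]

theorem ae_max_mem_topSet {i : Fin 2} {x : ℝ} (hle : ∀ᵐ a ∂F, a i ≤ x) (n : ℕ) :
    ∀ᵐ a ∂F, ∀ t ∈ topSet F i x n, max t (a i) ∈ topSet F i x n := by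
  by_cases hx : F {a | a i = x} = 0
  · filter_upwards [hle, measure_eq_zero_iff_ae_notMem.1 hx] with a ha hax t ht
    simp only [topSet, hx, if_true] at ht ⊢
    exact ⟨ht.1.trans_le (le_max_left _ _), max_lt ht.2 (lt_of_le_of_ne ha hax)⟩
  · filter_upwards [hle] with a ha t ht
    simp only [topSet, hx, if_false, Set.mem_singleton_iff] at ht ⊢
    rw [ht, max_eq_left ha]

theorem ae_min_mem_bottomSet {i : Fin 2} {x : ℝ} (hle : ∀ᵐ a ∂F, x ≤ a i) (n : ℕ) :
    ∀ᵐ a ∂F, ∀ t ∈ bottomSet F i x n, min t (a i) ∈ bottomSet F i x n := by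
  by_cases hx : F {a | a i = x} = 0
  · filter_upwards [hle, measure_eq_zero_iff_ae_notMem.1 hx] with a ha hax t ht
    simp only [bottomSet, hx, if_true] at ht ⊢
    exact ⟨lt_min ht.1 (lt_of_le_of_ne ha (Ne.symm hax)), (min_le_left _ _).trans_lt ht.2⟩
  · filter_upwards [hle] with a ha t ht
    simp only [bottomSet, hx, if_false, Set.mem_singleton_iff] at ht ⊢
    rw [ht, min_eq_left ha]

theorem IsNashEquilibrium.integral_top (hN : IsNashEquilibrium v H τ F G) {x : Bid}
    (hle : ∀ i, ∀ᵐ a ∂F, a i ≤ x i) (hpos : ∀ i, ∀ y < x i, F {a | y < a i} ≠ 0) :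
    ∫ o, (∏ i, limitWin τ F i 0 (x i) (o i) - ∑ i, x i * limitWin τ F i 0 (x i) (o i)) ∂G =
      utilityAnd τ F G :=
  hN.integral_limit_eq max_comm
    (fun _ hs _ ht => ⟨hs.1.trans (le_max_left _ _), max_le hs.2 ht.2⟩)
    (hN.ae_inf_sup.mono fun _ h => h.2)
    (fun i => measure_topSet_ne_zero (hle i) (hpos i)) (fun i => ae_max_mem_topSet (hle i))
    fun i _ ht => topSet_lim i ht

theorem IsNashEquilibrium.integral_bottom (hN : IsNashEquilibrium v H τ F G) {x : Bid}
    (hle : ∀ i, ∀ᵐ a ∂F, x i ≤ a i) (hpos : ∀ i, ∀ y > x i, F {a | a i < y} ≠ 0) :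
    ∫ o, (∏ i, limitWin τ F i 1 (x i) (o i) - ∑ i, x i * limitWin τ F i 1 (x i) (o i)) ∂G =
      utilityAnd τ F G :=
  hN.integral_limit_eq min_comm
    (fun _ hs _ ht => ⟨le_min hs.1 ht.1, (min_le_left _ _).trans hs.2⟩)
    (hN.ae_inf_sup.mono fun _ h => h.1)
    (fun i => measure_bottomSet_ne_zero (hle i) (hpos i)) (fun i => ae_min_mem_bottomSet (hle i))
    fun i _ ht => bottomSet_lim i ht

end Extreme

/-! ### Equilibrium payoffs and the range of the bids -/

section Range

variable {v H : ℝ} {τ : TieRule} {F G : Measure Bid}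

/-- The essential infimum of a bid of `AND`, with its characteristic properties. -/
theorem exists_essInf [IsProbabilityMeasure F] (i : Fin 2) {H : ℝ}
    (hF : ∀ᵐ a ∂F, a i ∈ Set.Icc 0 H) :
    ∃ x ∈ Set.Icc 0 H, (∀ᵐ a ∂F, x ≤ a i) ∧ ∀ y > x, F {a | a i < y} ≠ 0 := by
  have hne : {x | ∀ᵐ a ∂F, x ≤ a i}.Nonempty := ⟨0, hF.mono fun a ha => ha.1⟩
  have hub : ∀ x ∈ {x | ∀ᵐ a ∂F, x ≤ a i}, x ≤ H := by
    intro x hx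
    obtain ⟨a, h1, h2⟩ := (hF.and hx).exists
    exact h2.trans h1.2
  have hbdd : BddAbove {x | ∀ᵐ a ∂F, x ≤ a i} := ⟨H, hub⟩
  refine ⟨sSup {x | ∀ᵐ a ∂F, x ≤ a i}, ⟨le_csSup hbdd (hF.mono fun a ha => ha.1),
    csSup_le hne hub⟩, ?_, fun y hy h => ?_⟩
  · obtain ⟨u, -, hu, hmem⟩ := exists_seq_tendsto_sSup hne hbdd
    filter_upwards [ae_all_iff.2 hmem] with a ha using le_of_tendsto' hu ha
  · refine hy.not_ge (le_csSup hbdd ?_)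
    filter_upwards [measure_eq_zero_iff_ae_notMem.1 h] with a ha using not_lt.1 ha

namespace IsNashEquilibrium

/-- The payoff of `OR` from bidding on a single item. -/
theorem mul_measureReal_le (hN : IsNashEquilibrium v H τ F G) (hv : 0 ≤ v) (i : Fin 2) {x : ℝ}
    (hx : x ∈ Set.Ico 0 H) : (v - x) * F.real {a | a i ≤ x} ≤ utilityOr v τ F G := by
  have := hN.1.1
  obtain ⟨j, hij⟩ := exists_ne_fin_two i
  have h := hN.overbid_or hv (x := Function.update (fun _ => 0) i x) fun k => by
    rcases eq_or_eq_of_ne hij k with rfl | rfl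
    · simpa using hx
    · simpa [hij.symm] using hx.1.trans_lt hx.2
  rw [sum_of_ne hij] at h
  simp only [Function.update_self, Function.update_of_ne hij.symm, sub_zero] at h
  have h2 : F.real {a : Bid | ∀ k, a k ≤ Function.update (fun _ => (0 : ℝ)) i x k} ≤
      F.real {a | a j ≤ 0} :=
    measureReal_mono fun a ha => by simpa [hij.symm] using ha j
  nlinarith

/-- The bids of both players cannot reach up to a common level `t > 1/2` on both items: `AND`
could only bid `(t, t)` if it always lost there, and then `OR` would pay twice without need. -/
theorem false_of_common_top (hN : IsNashEquilibrium v H τ F G) (hv : 0 ≤ v) {t : ℝ}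
    (ht : 1 / 2 < t) (htH : t ≤ H) (hF : ∀ i, ∀ᵐ a ∂F, a i ≤ t) (hG : ∀ i, ∀ᵐ o ∂G, o i ≤ t)
    (hpos : ∀ i, ∀ y < t, F {a | y < a i} ≠ 0) : False := by
  have := hN.1.1
  have := hN.2.1.1
  have h1 := hN.integral_top (x := fun _ => t) hF hpos
  have hw (i : Fin 2) (o : ℝ) := limitWin_mem (τ := τ) (F := F) i (s := 0)
    ⟨le_rfl, zero_le_one⟩ t o
  have hint (i : Fin 2) : Integrable (fun o : Bid => limitWin τ F i 0 t (o i)) G :=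
    integrable_of_ae_abs_le (by fun_prop) 1 (.of_forall fun o => by
      rw [abs_of_nonneg (hw i _).1]
      exact (hw i _).2)
  have hint2 : Integrable (fun o : Bid => ∏ i, limitWin τ F i 0 t (o i)) G :=
    integrable_of_ae_abs_le (by fun_prop) 1 (.of_forall fun o => by
      rw [Fin.prod_univ_two, abs_of_nonneg (mul_nonneg (hw 0 _).1 (hw 1 _).1)]
      exact mul_le_one₀ (hw 0 _).2 (hw 1 _).1 (hw 1 _).2)
  have hint3 : Integrable (fun o : Bid => (t - 1 / 2) * ∑ i, limitWin τ F i 0 t (o i)) G :=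
    (integrable_finsetSum _ fun i _ => hint i).const_mul _
  have hnn (o : Bid) : 0 ≤ (t - 1 / 2) * ∑ i, limitWin τ F i 0 t (o i) :=
    mul_nonneg (by linarith) (Finset.sum_nonneg fun i _ => (hw i _).1)
  have h2 : ∫ o, ((t - 1 / 2) * ∑ i, limitWin τ F i 0 t (o i)) ∂G = 0 := by
    refine le_antisymm ?_ (integral_nonneg hnn)
    have h3 := h1.trans_ge (hN.utilityAnd_nonneg (by linarith))
    have h4 : ∫ o, (∏ i, limitWin τ F i 0 t (o i) - ∑ i, t * limitWin τ F i 0 t (o i)) ∂G ≤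
        ∫ o, -((t - 1 / 2) * ∑ i, limitWin τ F i 0 t (o i)) ∂G := by
      refine integral_mono (hint2.sub (integrable_finsetSum _ fun i _ => (hint i).const_mul t))
        hint3.neg fun o => ?_
      simp only [Fin.prod_univ_two, Fin.sum_univ_two]
      have := (hw 0 (o 0)).1
      have := (hw 0 (o 0)).2
      have := (hw 1 (o 1)).1
      have := (hw 1 (o 1)).2
      nlinarith
    rw [integral_neg] at h4
    linarith
  have h3 := (integral_eq_zero_iff_of_nonneg hnn hint3).1 h2
  obtain ⟨o, ho, hle, hbest⟩ := (h3.and ((ae_all_iff.2 hG).and (hN.ae_pureOr_eq hv))).exists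
  have hzero (i : Fin 2) : limitWin τ F i 0 t (o i) = 0 := by
    have h4 : ∑ i, limitWin τ F i 0 t (o i) = 0 :=
      (mul_eq_zero.1 ho).resolve_left (by linarith)
    exact (Finset.sum_eq_zero_iff_of_nonneg fun i _ => (hw i _).1).1 h4 i (Finset.mem_univ i)
  obtain rfl : o = fun _ => t := by
    funext i
    refine (hle i).eq_of_not_lt fun h => ?_
    have := hzero i
    rw [limitWin, if_pos h] at this
    exact one_ne_zero this
  have hlose : ∀ᵐ a ∂F, ∀ i, andWinsItem τ i (a i) t = 0 := by
    refine ae_all_iff.2 fun i => ?_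
    have h4 := hzero i
    simp only [limitWin, lt_irrefl, if_false, if_true] at h4
    by_cases hx : F {a | a i = t} = 0
    · filter_upwards [hF i, measure_eq_zero_iff_ae_notMem.1 hx] with a ha hax
      exact andWinsItem_of_gt τ i (lt_of_le_of_ne ha hax)
    · rw [if_neg hx] at h4
      filter_upwards [hF i] with a ha
      rcases ha.lt_or_eq with h | h
      · exact andWinsItem_of_gt τ i h
      · rw [h, andWinsItem_self, h4]
  have h5 : pureOr v τ F (fun _ => t) = v - 2 * t := by
    have e : (fun a => payoffOr v τ a fun _ => t) =ᵐ[F] fun _ => v - 2 * t := by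
      filter_upwards [hlose] with a ha
      simp only [payoffOr, ha, Fin.prod_univ_two, Fin.sum_univ_two]
      ring
    unfold pureOr
    rw [integral_congr_ae e]
    simp
  have h6 : v - t ≤ pureOr v τ F ![t, 0] := by
    have e : ∀ᵐ a ∂F, v - t ≤ payoffOr v τ a ![t, 0] := by
      filter_upwards [hlose] with a ha
      simp [payoffOr, ha]
    have h := integral_mono_ae (integrable_const _) (integrable_payoffOr_left hv _) e
    simpa [pureOr] using h
  have h7 := hN.pureOr_le hv (o := ![t, 0]) (Fin.forall_fin_two.2
    ⟨⟨by simp only [Matrix.cons_val_zero]; linarith, htH⟩, ⟨le_rfl, by simp; linarith⟩⟩)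
  linarith

/-- If `AND` never bid above `y` on some item, then `OR` could win it at the price `y`. -/
theorem measure_lt_ne_zero (hN : IsNashEquilibrium v H τ F G) (hv : 0 ≤ v) {t : ℝ} (ht : t ≤ H)
    (hle : utilityOr v τ F G ≤ v - t) (i : Fin 2) (y : ℝ) (hy : y < t) :
    F {a | y < a i} ≠ 0 := by
  have := hN.1.1
  intro h
  have h1 : ∀ᵐ a ∂F, a i ≤ y := by
    filter_upwards [measure_eq_zero_iff_ae_notMem.1 h] with a ha using not_lt.1 ha
  obtain ⟨a, h2, h3⟩ := (h1.and hN.1.2).exists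
  have h4 := hN.mul_measureReal_le hv i (x := y) ⟨(h3 i).1.trans h2, hy.trans_le ht⟩
  have h5 : F.real {a | a i ≤ y} = 1 := by
    rw [Measure.real, (prob_compl_eq_zero_iff (measurableSet_coord_le i y)).1 h1]
    rfl
  rw [h5] at h4
  linarith

/-- If the payoff of `OR` were below `v - H`, then `AND` would bid up to `H` on both items, contrary to
`false_of_common_top`. This extends the bounds from overbidding to the bid `H`, where ties cannot be
outbid. -/
theorem sub_le_utilityOr (hN : IsNashEquilibrium v H τ F G) (hv : 0 ≤ v) (hH : 1 / 2 < H) :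
    v - H ≤ utilityOr v τ F G := by
  by_contra! h
  exact hN.false_of_common_top hv hH le_rfl (fun i => hN.1.2.mono fun a ha => (ha i).2)
    (fun i => hN.2.1.2.mono fun a ha => (ha i).2) fun i y hy =>
      hN.measure_lt_ne_zero hv le_rfl h.le i y hy

theorem measureReal_le_top (hN : IsNashEquilibrium v H τ F G) (i : Fin 2) :
    F.real {a | a i ≤ H} = 1 := by
  have := hN.1.1
  have h : ∀ᵐ a ∂F, a i ≤ H := hN.1.2.mono fun a ha => (ha i).2
  rw [Measure.real, (prob_compl_eq_zero_iff (measurableSet_coord_le i H)).1 h]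
  rfl

theorem mul_measureReal_le_of_mem_Icc (hN : IsNashEquilibrium v H τ F G) (hv : 0 ≤ v) (hH : 1 / 2 < H)
    (i : Fin 2) {x : ℝ} (hx : x ∈ Set.Icc 0 H) :
    (v - x) * F.real {a | a i ≤ x} ≤ utilityOr v τ F G := by
  rcases hx.2.lt_or_eq with h | rfl
  · exact hN.mul_measureReal_le hv i ⟨hx.1, h⟩
  · rw [hN.measureReal_le_top, mul_one]
    exact hN.sub_le_utilityOr hv hH

theorem overbid_or_of_mem_Icc (hN : IsNashEquilibrium v H τ F G) (hv : 0 ≤ v) (hH : 1 / 2 < H) {x : Bid}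
    (hx : ∀ i, x i ∈ Set.Icc 0 H) :
    ∑ i, (v - x i) * F.real {a | a i ≤ x i} - v * F.real {a | ∀ i, a i ≤ x i}
      ≤ utilityOr v τ F G := by
  by_cases h : ∀ i, x i < H
  · exact hN.overbid_or hv fun i => ⟨(hx i).1, h i⟩
  · push Not at h
    obtain ⟨i, hi⟩ := h
    obtain ⟨j, hij⟩ := exists_ne_fin_two i
    have hi' : x i = H := le_antisymm (hx i).2 hi
    have e : F.real {a | ∀ i, a i ≤ x i} = F.real {a | a j ≤ x j} := by
      refine measureReal_congr ?_
      filter_upwards [hN.1.2] with a ha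
      refine propext ⟨fun h => h j, fun h k => ?_⟩
      rcases eq_or_eq_of_ne hij k with rfl | rfl
      · exact hi' ▸ (ha k).2
      · exact h
    rw [sum_of_ne hij, e, hi', hN.measureReal_le_top]
    have h1 := hN.sub_le_utilityOr hv hH
    have h2 : 0 ≤ F.real {a | a j ≤ x j} := measureReal_nonneg
    have h3 := mul_nonneg (hx j).1 h2
    linarith

/-- A payoff of `0` would force `AND` to bid at least `v > 1/2` on both items. Then `AND` must never win
anything, so that `OR` pays at least `2 * v`. -/
theorem utilityOr_pos (hN : IsNashEquilibrium v H τ F G) (hv : 1 / 2 < v) (hH : 1 / 2 < H) :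
    0 < utilityOr v τ F G := by
  by_contra! h
  have hv0 : 0 ≤ v := by linarith
  have := hN.1.1
  have := hN.2.1.1
  have hvH : v ≤ H := by linarith [hN.sub_le_utilityOr hv0 hH]
  have hlow (i : Fin 2) : ∀ᵐ a ∂F, v ≤ a i := by
    obtain ⟨x, hx, hle, hpos⟩ := exists_essInf i (hN.1.2.mono fun a ha => ha i)
    have hvx : v ≤ x := by
      by_contra! hxv
      obtain ⟨y, hy1, hy2⟩ := exists_between hxv
      have h1 := hN.mul_measureReal_le hv0 i (x := y) ⟨hx.1.trans hy1.le, hy2.trans_le hvH⟩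
      have h2 : 0 < F.real {a | a i ≤ y} := by
        refine (ENNReal.toReal_pos (hpos y hy1) (measure_ne_top _ _)).trans_le
          (measureReal_mono fun a ha => ?_)
        exact (show a i < y from ha).le
      nlinarith
    exact hle.mono fun a ha => hvx.trans ha
  have hlose : ∀ᵐ a ∂F, ∀ᵐ o ∂G, ∀ i, andWinsItem τ i (a i) (o i) = 0 := by
    filter_upwards [ae_all_iff.2 hlow, hN.ae_pureAnd_eq] with a ha hbest
    have hle (o : Bid) : payoffAnd τ a o ≤
        -((v - 1 / 2) * ∑ i, andWinsItem τ i (a i) (o i)) := by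
      have w0 := andWinsItem_nonneg τ 0 (a 0) (o 0)
      have w1 := andWinsItem_nonneg τ 1 (a 1) (o 1)
      have := andWinsItem_le_one τ 0 (a 0) (o 0)
      have := andWinsItem_le_one τ 1 (a 1) (o 1)
      simp only [payoffAnd, Fin.prod_univ_two, Fin.sum_univ_two]
      nlinarith [mul_le_mul_of_nonneg_right (ha 0) w0, mul_le_mul_of_nonneg_right (ha 1) w1]
    have hnn (o : Bid) : 0 ≤ (v - 1 / 2) * ∑ i, andWinsItem τ i (a i) (o i) :=
      mul_nonneg (by linarith) (Finset.sum_nonneg fun i _ => andWinsItem_nonneg τ i _ _)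
    have hα := hN.utilityAnd_nonneg (by linarith)
    have h1 : ∫ o, payoffAnd τ a o ∂G = 0 := by
      refine le_antisymm (integral_nonpos fun o => ?_) (hα.trans_eq hbest.symm)
      exact (hle o).trans (neg_nonpos.2 (hnn o))
    have h2 := (integral_eq_zero_iff_of_nonneg (f := fun o => -payoffAnd τ a o)
      (fun o => by have := (hle o).trans (neg_nonpos.2 (hnn o)); simpa using this)
      (integrable_payoffAnd_left a).neg).1 (by rw [integral_neg, h1, neg_zero])
    filter_upwards [h2] with o ho
    have h3 : payoffAnd τ a o = 0 := by simpa using ho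
    have h4 : ∑ i, andWinsItem τ i (a i) (o i) = 0 := by
      have := hle o
      have := hnn o
      exact (mul_eq_zero.1 (by linarith : (v - 1 / 2) * ∑ i, andWinsItem τ i (a i) (o i) = 0)
        ).resolve_left (by linarith)
    exact fun i => (Finset.sum_eq_zero_iff_of_nonneg fun i _ =>
      andWinsItem_nonneg τ i (a i) (o i)).1 h4 i (Finset.mem_univ i)
  have h1 : utilityOr v τ F G ≤ ∫ _, -v ∂F := by
    rw [utilityOr_eq_integral, integral_prod _ (integrable_payoffOr hv0 hN.1 hN.2.1)]
    refine integral_mono_ae (integrable_payoffOr hv0 hN.1 hN.2.1).integral_prod_left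
      (integrable_const _) ?_
    filter_upwards [hlose, ae_all_iff.2 hlow] with a ha hal
    have h2 : ∫ o, payoffOr v τ a o ∂G ≤ ∫ _, -v ∂G := by
      refine integral_mono_ae (integrable_of_ae_abs_le (by fun_prop) (v + 2 * H) ?_)
        (integrable_const _) ?_
      · filter_upwards [hN.2.1.2] with o ho using abs_payoffOr_le hv0 τ ho
      · filter_upwards [ha] with o ho
        have h3 (i : Fin 2) : v ≤ o i := by
          refine (hal i).trans (not_lt.1 fun h => ?_)
          have := ho i
          rw [andWinsItem_of_lt τ i h] at this
          exact one_ne_zero this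
        simp only [payoffOr, ho, Fin.prod_univ_two, Fin.sum_univ_two]
        linarith [h3 0, h3 1]
    simpa using h2
  have h2 := hN.utilityOr_nonneg hv0 (by linarith)
  simp at h1
  linarith

/-- At the essential infima of `AND`'s bids, `AND` never wins both items. Otherwise some bid of
`OR` would be optimal although it wins only ties, each with probability less than `1`. Its payoff
is an average of those of winning all ties on some of the items and losing the others; all of them
are at most the equilibrium payoff, and losing everything is worse. -/
theorem ae_prod_limitWin_eq_zero (hN : IsNashEquilibrium v H τ F G) (hv : 1 / 2 < v)
    (hH : 1 / 2 < H) {x : Bid} (hle : ∀ i, ∀ᵐ a ∂F, x i ≤ a i) :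
    ∀ᵐ o ∂G, ∏ i, limitWin τ F i 1 (x i) (o i) = 0 := by
  have hv0 : 0 ≤ v := by linarith
  have := hN.1.1
  filter_upwards [hN.ae_pureOr_eq hv0, hN.2.1.2] with o hbest hbox
  by_contra hne
  have hw (i : Fin 2) : 0 < limitWin τ F i 1 (x i) (o i) :=
    lt_of_le_of_ne (limitWin_mem i ⟨zero_le_one, le_rfl⟩ _ _).1
      (Ne.symm (Finset.prod_ne_zero_iff.1 hne i (Finset.mem_univ i)))
  have hw' (i : Fin 2) : limitWin τ F i 1 (x i) (o i) ≤ 1 :=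
    (limitWin_mem i ⟨zero_le_one, le_rfl⟩ _ _).2
  have hf : ∀ᵐ a ∂F, ∀ i, andWinsItem τ i (a i) (o i) =
      1 - (1 - limitWin τ F i 1 (x i) (o i)) * (Set.Iic (o i)).indicator (fun _ => 1) (a i) := by
    refine ae_all_iff.2 fun i => ?_
    have h0 := hw i
    rcases lt_trichotomy (o i) (x i) with h | h | h
    · filter_upwards [hle i] with a ha
      rw [andWinsItem_of_lt τ i (h.trans_le ha), limitWin, if_pos h]
      ring
    · by_cases hx : F {a | a i = x i} = 0
      · filter_upwards [hle i, measure_eq_zero_iff_ae_notMem.1 hx] with a ha hax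
        rw [h, andWinsItem_of_lt τ i (lt_of_le_of_ne ha (Ne.symm hax)), limitWin,
          if_neg (lt_irrefl _), if_pos rfl, if_pos hx]
        ring
      · filter_upwards [hle i] with a ha
        rw [h, limitWin, if_neg (lt_irrefl _), if_pos rfl, if_neg hx]
        rcases ha.lt_or_eq with h' | h'
        · rw [andWinsItem_of_lt τ i h', Set.indicator_of_notMem (by simpa using h')]
          ring
        · rw [← h', andWinsItem_self, Set.indicator_of_mem (by simp)]
          ring
    · rw [limitWin, if_neg h.not_gt, if_neg h.ne'] at h0
      exact absurd h0 (lt_irrefl _)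
  have h0 := hN.mul_measureReal_le_of_mem_Icc hv0 hH 0 (hbox 0)
  have h1 := hN.mul_measureReal_le_of_mem_Icc hv0 hH 1 (hbox 1)
  have h2 := hN.overbid_or_of_mem_Icc hv0 hH hbox
  have hβ := hN.utilityOr_pos hv hH
  obtain ⟨r, hr⟩ : ∃ r : Fin 2 → ℝ, ∀ i, r i = 1 - limitWin τ F i 1 (x i) (o i) :=
    ⟨_, fun _ => rfl⟩
  have hr0 (i : Fin 2) : 0 ≤ r i := by linarith [hr i, hw' i]
  have hr1 (i : Fin 2) : r i < 1 := by linarith [hr i, hw i]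
  have hU : pureOr v τ F o = ∑ i, (v - o i) * r i * F.real {a | a i ≤ o i}
      - v * (r 0 * r 1) * F.real {a | ∀ i, a i ≤ o i} := by
    have e : (fun a => payoffOr v τ a o) =ᵐ[F] fun a =>
        ∑ i, (v - o i) * r i * (Set.Iic (o i)).indicator (fun _ => 1) (a i)
          - v * (r 0 * r 1) * {a : Bid | ∀ i, a i ≤ o i}.indicator (fun _ => 1) a := by
      filter_upwards [hf] with a ha
      rw [indicator_le_box]
      simp only [payoffOr, ha, ← hr, Fin.prod_univ_two, Fin.sum_univ_two]
      ring
    have hi (i : Fin 2) := (integrable_indicator_Iic (F := F) i (o i)).const_mul ((v - o i) * r i)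
    unfold pureOr
    rw [integral_congr_ae e, integral_sub (integrable_finsetSum _ fun i _ => hi i)
      (((integrable_const _).indicator (measurableSet_le_box o)).const_mul _),
      integral_finsetSum _ fun i _ => hi i, integral_const_mul,
      integral_indicator_const _ (measurableSet_le_box o)]
    simp_rw [integral_const_mul, integral_indicator_Iic]
    simp
  rw [hbest] at hU
  rw [Fin.sum_univ_two] at hU h2
  have q0 := sub_pos.2 (hr1 0)
  have q1 := sub_pos.2 (hr1 1)
  -- The weights of winning the ties on item `0` only, on item `1` only, on both, and on none.
  have k0 := mul_le_mul_of_nonneg_left h0 (mul_nonneg (hr0 0) q1.le)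
  have k1 := mul_le_mul_of_nonneg_left h1 (mul_nonneg q0.le (hr0 1))
  have k2 := mul_le_mul_of_nonneg_left h2 (mul_nonneg (hr0 0) (hr0 1))
  have k3 := mul_pos (mul_pos q0 q1) hβ
  nlinarith

/-- The lowest bids of `AND` are best responses in the limit; as they never win both items, the payoff
of `AND` is `0`, and a positive lowest bid never wins its item either. -/
theorem utilityAnd_eq_zero_and (hN : IsNashEquilibrium v H τ F G) (hv : 1 / 2 < v)
    (hH : 1 / 2 < H) : utilityAnd τ F G = 0 ∧ ∀ x : Bid, (∀ i, ∀ᵐ a ∂F, x i ≤ a i) →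
      (∀ i, ∀ y > x i, F {a | a i < y} ≠ 0) → (∀ i, 0 ≤ x i) →
      ∀ᵐ o ∂G, ∀ i, x i * limitWin τ F i 1 (x i) (o i) = 0 := by
  have := hN.1.1
  have := hN.2.1.1
  have hα := hN.utilityAnd_nonneg (by linarith)
  have key (x : Bid) (hle : ∀ i, ∀ᵐ a ∂F, x i ≤ a i)
      (hpos : ∀ i, ∀ y > x i, F {a | a i < y} ≠ 0) (hx : ∀ i, 0 ≤ x i) :
      utilityAnd τ F G = 0 ∧ ∀ᵐ o ∂G, ∀ i, x i * limitWin τ F i 1 (x i) (o i) = 0 := by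
    have h1 := hN.integral_bottom hle hpos
    have hw (i : Fin 2) (o : ℝ) := limitWin_mem (τ := τ) (F := F) i (s := 1)
      ⟨zero_le_one, le_rfl⟩ (x i) o
    have hnn (o : Bid) (i : Fin 2) : 0 ≤ x i * limitWin τ F i 1 (x i) (o i) :=
      mul_nonneg (hx i) (hw i _).1
    have e : (fun o : Bid => ∏ i, limitWin τ F i 1 (x i) (o i)
        - ∑ i, x i * limitWin τ F i 1 (x i) (o i)) =ᵐ[G]
        fun o => -∑ i, x i * limitWin τ F i 1 (x i) (o i) := by
      filter_upwards [hN.ae_prod_limitWin_eq_zero hv hH hle] with o ho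
      rw [ho, zero_sub]
    rw [integral_congr_ae e, integral_neg] at h1
    have hsum (o : Bid) : 0 ≤ ∑ i, x i * limitWin τ F i 1 (x i) (o i) :=
      Finset.sum_nonneg fun i _ => hnn o i
    have h2 : 0 ≤ ∫ o, ∑ i, x i * limitWin τ F i 1 (x i) (o i) ∂G := integral_nonneg hsum
    have hint : Integrable (fun o : Bid => ∑ i, x i * limitWin τ F i 1 (x i) (o i)) G := by
      refine integrable_finsetSum _ fun i _ => Integrable.const_mul ?_ _
      refine integrable_of_ae_abs_le (by fun_prop) 1 (.of_forall fun o => ?_)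
      rw [abs_of_nonneg (hw i _).1]
      exact (hw i _).2
    refine ⟨by linarith, ?_⟩
    have h3 := (integral_eq_zero_iff_of_nonneg hsum hint).1 (by linarith)
    filter_upwards [h3] with o ho i
    exact (Finset.sum_eq_zero_iff_of_nonneg fun i _ => hnn o i).1 ho i (Finset.mem_univ i)
  refine ⟨?_, fun x h1 h2 h3 => (key x h1 h2 h3).2⟩
  choose x hx hle hpos using fun i => exists_essInf (F := F) i (hN.1.2.mono fun a ha => ha i)
  exact (key x hle hpos fun i => (hx i).1).1

end IsNashEquilibrium

end Range

/-! ### Resolving the ties -/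

section Ties

variable {v H : ℝ} {τ : TieRule} {F G : Measure Bid} {i j : Fin 2}

/-- The bids of `AND` which lose item `i` to the bid `x`, when ties are lost if `s` holds and won
otherwise. -/
def loseSet (i : Fin 2) (x : ℝ) (s : Bool) : Set Bid := {a | if s then a i ≤ x else a i < x}

/-- The probability that ties at the bid `x` on item `i` are lost (if `s` holds) or won by `AND`. -/
def tieWeight (τ : TieRule) (i : Fin 2) (x : ℝ) (s : Bool) : ℝ :=
  if s then 1 - τ.andWins i x else τ.andWins i x

theorem measurableSet_loseSet (i : Fin 2) (x : ℝ) (s : Bool) :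
    MeasurableSet (loseSet i x s) := by
  cases s
  · simpa [loseSet] using measurableSet_lt (measurable_pi_apply i) measurable_const
  · simpa [loseSet] using measurableSet_coord_le i x

theorem loseSet_subset (i : Fin 2) (x : ℝ) (s : Bool) : loseSet i x s ⊆ {a | a i ≤ x} := by
  intro a ha
  cases s
  · exact le_of_lt (by simpa [loseSet] using ha)
  · simpa [loseSet] using ha

theorem tieWeight_nonneg (i : Fin 2) (x : ℝ) (s : Bool) : 0 ≤ tieWeight τ i x s := by
  have := τ.mem_Icc i x
  cases s
  · simpa [tieWeight] using this.1
  · simpa [tieWeight] using this.2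

theorem sum_tieWeight (i : Fin 2) (x : ℝ) : ∑ s, tieWeight τ i x s = 1 := by
  simp [tieWeight]

/-- Randomized tie-breaking is a mixture of the two deterministic rules. -/
theorem one_sub_andWinsItem (i : Fin 2) (a : Bid) (x : ℝ) : 1 - andWinsItem τ i (a i) x =
    ∑ s, tieWeight τ i x s * (loseSet i x s).indicator (fun _ => 1) a := by
  rcases lt_trichotomy (a i) x with h | h | h
  · simp [andWinsItem_of_gt τ i h, loseSet, tieWeight, Set.indicator, h, h.le]
  · simp [h, andWinsItem_self, loseSet, tieWeight, Set.indicator]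
  · simp [andWinsItem_of_lt τ i h, loseSet, tieWeight, Set.indicator, h.not_gt, h.not_ge]

theorem andWinsItem_lt_of_mem_loseSet {x : ℝ} {s : Bool} (hs : 0 < tieWeight τ i x s)
    {a a' : Bid} (ha : a ∈ loseSet i x s) (ha' : a' ∉ loseSet i x s) :
    andWinsItem τ i (a i) x < andWinsItem τ i (a' i) x := by
  cases s
  · simp only [tieWeight, loseSet, Bool.false_eq_true, if_false, Set.mem_ofPred_eq, not_lt]
      at hs ha ha'
    rw [andWinsItem_of_gt τ i ha]
    exact hs.trans_le ((andWinsItem_self τ i x).symm.le.trans (andWinsItem_mono τ i x ha'))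
  · simp only [tieWeight, loseSet, if_true, Set.mem_ofPred_eq, not_le] at hs ha ha'
    rw [andWinsItem_of_lt τ i ha']
    refine (andWinsItem_mono τ i x ha).trans_lt ?_
    simp only [andWinsItem_self]
    linarith

/-- Where the chances of `AND` are ordered in the same way on both items, the sets of bids losing
the items are nested. -/
theorem loseSet_nested [IsProbabilityMeasure F] {o : Bid}
    (hco : ∀ᵐ p ∂F.prod F,
      0 ≤ ∏ i, (andWinsItem τ i (p.1 i) (o i) - andWinsItem τ i (p.2 i) (o i)))
    (hij : i ≠ j) {s t : Bool} (hs : 0 < tieWeight τ i (o i) s) (ht : 0 < tieWeight τ j (o j) t) :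
    F (loseSet i (o i) s \ loseSet j (o j) t) = 0 ∨
      F (loseSet j (o j) t \ loseSet i (o i) s) = 0 := by
  by_contra! h
  have h1 : (F.prod F) ((loseSet i (o i) s \ loseSet j (o j) t) ×ˢ
      (loseSet j (o j) t \ loseSet i (o i) s)) ≠ 0 := by
    rw [Measure.prod_prod]
    exact mul_ne_zero h.1 h.2
  obtain ⟨p, ⟨⟨h2, h3⟩, h4, h5⟩, h6⟩ := ((frequently_ae_mem_iff.2 h1).and_eventually hco).exists
  rw [prod_of_ne hij] at h6
  have h7 := andWinsItem_lt_of_mem_loseSet hs h2 h5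
  have h8 := andWinsItem_lt_of_mem_loseSet ht h4 h3
  nlinarith

/-- The payoff of `OR` is the mixture of its payoffs under the four deterministic tie-breaking rules at
the bid `o`. -/
theorem pureOr_eq_sum_tieWeight [IsProbabilityMeasure F] (hij : i ≠ j) (o : Bid) :
    pureOr v τ F o = ∑ s, ∑ t, tieWeight τ i (o i) s * tieWeight τ j (o j) t *
      ((v - o i) * F.real (loseSet i (o i) s) + (v - o j) * F.real (loseSet j (o j) t)
        - v * F.real (loseSet i (o i) s ∩ loseSet j (o j) t)) := by
  have e (a : Bid) : payoffOr v τ a o = ∑ s, ∑ t,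
      tieWeight τ i (o i) s * tieWeight τ j (o j) t *
      ((v - o i) * (loseSet i (o i) s).indicator (fun _ => 1) a
        + (v - o j) * (loseSet j (o j) t).indicator (fun _ => 1) a
        - v * (loseSet i (o i) s ∩ loseSet j (o j) t).indicator (fun _ => 1) a) := by
    have hi := one_sub_andWinsItem (τ := τ) i a (o i)
    have hj := one_sub_andWinsItem (τ := τ) j a (o j)
    have hsi := sum_tieWeight (τ := τ) i (o i)
    have hsj := sum_tieWeight (τ := τ) j (o j)
    have hint (s t : Bool) : (loseSet i (o i) s ∩ loseSet j (o j) t).indicator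
        (fun _ => (1 : ℝ)) a = (loseSet i (o i) s).indicator (fun _ => 1) a *
          (loseSet j (o j) t).indicator (fun _ => 1) a := by
      by_cases h1 : a ∈ loseSet i (o i) s <;> by_cases h2 : a ∈ loseSet j (o j) t <;> simp [h1, h2]
    simp only [payoffOr, prod_of_ne hij, sum_of_ne hij, hint, Fintype.sum_bool] at hi hj hsi hsj ⊢
    rw [sub_eq_iff_eq_add', ← sub_eq_iff_eq_add] at hi hj
    rw [← hi, ← hj]
    linear_combination (-(v - o i) * (tieWeight τ i (o i) true *
      (loseSet i (o i) true).indicator (fun _ => 1) a + tieWeight τ i (o i) false *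
      (loseSet i (o i) false).indicator (fun _ => 1) a)) * hsj
      - (v - o j) * (tieWeight τ j (o j) true *
      (loseSet j (o j) true).indicator (fun _ => 1) a + tieWeight τ j (o j) false *
      (loseSet j (o j) false).indicator (fun _ => 1) a) * hsi
  have hI {S : Set Bid} (hS : MeasurableSet S) (c : ℝ) :
      Integrable (fun a => c * S.indicator (fun _ => (1 : ℝ)) a) F :=
    ((integrable_const _).indicator hS).const_mul c
  have hm (s) := measurableSet_loseSet i (o i) s
  have hm' (t) := measurableSet_loseSet j (o j) t
  have hI₁ (s t) : Integrable (fun a => (v - o i) * (loseSet i (o i) s).indicator (fun _ => 1) a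
      + (v - o j) * (loseSet j (o j) t).indicator (fun _ => 1) a) F :=
    (hI (hm s) (v - o i)).add (hI (hm' t) (v - o j))
  have hI₂ (s t) : Integrable (fun a => (v - o i) * (loseSet i (o i) s).indicator (fun _ => 1) a
      + (v - o j) * (loseSet j (o j) t).indicator (fun _ => 1) a
      - v * (loseSet i (o i) s ∩ loseSet j (o j) t).indicator (fun _ => 1) a) F :=
    (hI₁ s t).sub (hI ((hm s).inter (hm' t)) v)
  unfold pureOr
  simp_rw [e]
  rw [integral_finsetSum _ fun s _ => integrable_finsetSum _ fun t _ => (hI₂ s t).const_mul _]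
  refine Finset.sum_congr rfl fun s _ => ?_
  rw [integral_finsetSum _ fun t _ => (hI₂ s t).const_mul _]
  refine Finset.sum_congr rfl fun t _ => ?_
  rw [integral_const_mul, integral_sub (hI₁ s t) (hI ((hm s).inter (hm' t)) v),
    integral_add (hI (hm s) _) (hI (hm' t) _)]
  simp_rw [integral_const_mul]
  rw [integral_indicator_const _ (hm s), integral_indicator_const _ (hm' t),
    integral_indicator_const _ ((hm s).inter (hm' t))]
  simp

theorem integral_one_sub_andWinsItem [IsProbabilityMeasure F] (i : Fin 2) (x : ℝ) :
    ∫ a, (1 - andWinsItem τ i (a i) x) ∂F = ∑ s, tieWeight τ i x s * F.real (loseSet i x s) := by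
  simp_rw [one_sub_andWinsItem]
  rw [integral_finsetSum _ fun s _ =>
    ((integrable_const (1 : ℝ)).indicator (measurableSet_loseSet i x s)).const_mul _]
  refine Finset.sum_congr rfl fun s _ => ?_
  rw [integral_const_mul, integral_indicator_const _ (measurableSet_loseSet i x s)]
  simp

/-- A bid of `OR` on item `i` above the level `v - β`, where `β` bounds the payoffs from bidding
on single items, costs `OR` at least the excess whenever it wins: as the losing bids of `AND` are
nested, a second bid never adds to the chance of winning something. -/
theorem pureOr_le_sub [IsProbabilityMeasure F] {o : Bid} {β : ℝ}
    (hco : ∀ᵐ p ∂F.prod F,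
      0 ≤ ∏ i, (andWinsItem τ i (p.1 i) (o i) - andWinsItem τ i (p.2 i) (o i)))
    (hij : i ≠ j) (hβ : 0 ≤ β) (hβv : β ≤ v) (hj : (v - o j) * F.real {a | a j ≤ o j} ≤ β)
    (hoj : 0 ≤ o j) :
    pureOr v τ F o ≤ β - (o i - (v - β)) * ∫ a, (1 - andWinsItem τ i (a i) (o i)) ∂F := by
  have key (s t : Bool) : tieWeight τ i (o i) s * tieWeight τ j (o j) t *
      ((v - o i) * F.real (loseSet i (o i) s) + (v - o j) * F.real (loseSet j (o j) t)
        - v * F.real (loseSet i (o i) s ∩ loseSet j (o j) t)) ≤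
      tieWeight τ i (o i) s * tieWeight τ j (o j) t *
        (β - (o i - (v - β)) * F.real (loseSet i (o i) s)) := by
    rcases (tieWeight_nonneg (τ := τ) i (o i) s).lt_or_eq with hs | hs
    · rcases (tieWeight_nonneg (τ := τ) j (o j) t).lt_or_eq with ht | ht
      · refine mul_le_mul_of_nonneg_left ?_ (mul_pos hs ht).le
        have p1 : 0 ≤ F.real (loseSet i (o i) s) := measureReal_nonneg
        have p2 : 0 ≤ F.real (loseSet j (o j) t) := measureReal_nonneg
        have p3 : F.real (loseSet i (o i) s) ≤ 1 := measureReal_le_one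
        rcases loseSet_nested hco hij hs ht with h | h
        · have e : F.real (loseSet i (o i) s ∩ loseSet j (o j) t) =
              F.real (loseSet i (o i) s) := by
            have := measureReal_inter_add_sdiff (μ := F) (s := loseSet i (o i) s)
              (measurableSet_loseSet j (o j) t)
            rw [← this, Measure.real, Measure.real, h]
            simp
          have h1 : F.real (loseSet j (o j) t) ≤ F.real {a | a j ≤ o j} :=
            measureReal_mono (loseSet_subset j (o j) t)
          have h2 : (v - o j) * F.real (loseSet j (o j) t) ≤ β := by
            rcases le_total (o j) v with h3 | h3
            · exact (mul_le_mul_of_nonneg_left h1 (by linarith)).trans hj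
            · exact (mul_nonpos_of_nonpos_of_nonneg (by linarith) p2).trans hβ
          rw [e]
          nlinarith
        · have e : F.real (loseSet i (o i) s ∩ loseSet j (o j) t) =
              F.real (loseSet j (o j) t) := by
            have := measureReal_inter_add_sdiff (μ := F) (s := loseSet j (o j) t)
              (measurableSet_loseSet i (o i) s)
            rw [Set.inter_comm, ← this, Measure.real, Measure.real, h]
            simp
          rw [e]
          nlinarith [mul_nonneg hoj p2, mul_le_mul_of_nonneg_left p3 hβ]
      · simp [← ht]
    · simp [← hs]
  have hsj := sum_tieWeight (τ := τ) j (o j)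
  have hsi := sum_tieWeight (τ := τ) i (o i)
  rw [pureOr_eq_sum_tieWeight hij, integral_one_sub_andWinsItem]
  refine (Finset.sum_le_sum fun s _ => Finset.sum_le_sum fun t _ => key s t).trans (le_of_eq ?_)
  simp only [Fintype.sum_bool] at hsi hsj ⊢
  linear_combination (tieWeight τ i (o i) true *
      (β - (o i - (v - β)) * F.real (loseSet i (o i) true)) + tieWeight τ i (o i) false *
      (β - (o i - (v - β)) * F.real (loseSet i (o i) false))) * hsj + β * hsi

end Ties

/-! ### The highest bids -/

namespace IsNashEquilibrium

variable {v H : ℝ} {τ : TieRule} {F G : Measure Bid}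

theorem utilityOr_le (hN : IsNashEquilibrium v H τ F G) (hv : 0 ≤ v) : utilityOr v τ F G ≤ v := by
  have := hN.2.1.1
  have := hN.1.1
  rw [utilityOr_eq_integral]
  have h : ∫ p, payoffOr v τ p.1 p.2 ∂F.prod G ≤ ∫ _, v ∂F.prod G := by
    refine integral_mono_ae (integrable_payoffOr hv hN.1 hN.2.1) (integrable_const _) ?_
    filter_upwards [ae_prod_snd hN.2.1.2] with p hp
    have h1 := mul_nonneg hv (prod_andWinsItem_nonneg τ p.1 p.2)
    have h2 : 0 ≤ ∑ i, p.2 i * (1 - andWinsItem τ i (p.1 i) (p.2 i)) :=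
      Finset.sum_nonneg fun i _ => mul_nonneg (hp i).1
        (sub_nonneg.2 (andWinsItem_le_one τ i _ _))
    unfold payoffOr
    linarith
  simpa using h

/-- By `pureOr_le_sub`, a bid of `OR` above this level could only be optimal if it never won. Then it
would be no more than the lowest bid of `AND`, which would be positive and win, contrary to
`utilityAnd_eq_zero_and`. -/
theorem ae_or_le (hN : IsNashEquilibrium v H τ F G) (hv : 1 / 2 < v) (hH : 1 / 2 < H) :
    ∀ᵐ o ∂G, ∀ i, o i ≤ v - utilityOr v τ F G := by
  have hv0 : 0 ≤ v := by linarith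
  have := hN.1.1
  have hβ := hN.utilityOr_pos hv hH
  have hβv := hN.utilityOr_le hv0
  choose x hx hle hpos using fun i => exists_essInf (F := F) i (hN.1.2.mono fun a ha => ha i)
  filter_upwards [hN.ae_comonotone, hN.ae_pureOr_eq hv0, hN.2.1.2,
    (hN.utilityAnd_eq_zero_and hv hH).2 x hle hpos fun i => (hx i).1] with o hco hbest hbox hzero i
  by_contra! hlt
  obtain ⟨j, hij⟩ := exists_ne_fin_two i
  have h1 := pureOr_le_sub (τ := τ) (v := v) hco hij hβ.le hβv
    (hN.mul_measureReal_le_of_mem_Icc hv0 hH j (hbox j)) (hbox j).1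
  have hnn (a : Bid) : 0 ≤ 1 - andWinsItem τ i (a i) (o i) :=
    sub_nonneg.2 (andWinsItem_le_one τ i _ _)
  have h2 : ∫ a, (1 - andWinsItem τ i (a i) (o i)) ∂F = 0 := by
    refine le_antisymm ?_ (integral_nonneg hnn)
    rw [hbest] at h1
    by_contra! h
    nlinarith
  have h3 : ∀ᵐ a ∂F, andWinsItem τ i (a i) (o i) = 1 := by
    have h := (integral_eq_zero_iff_of_nonneg hnn
      ((integrable_const 1).sub (integrable_andWinsItem_left i (o i)))).1 h2
    filter_upwards [h] with a ha
    have : 1 - andWinsItem τ i (a i) (o i) = 0 := ha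
    linarith
  -- `AND` always outbids `OR` on item `i`, so `o i` is at most the lowest bid `x i` of `AND`.
  have h4 : o i ≤ x i := by
    by_contra! h
    obtain ⟨a, ha, ha'⟩ := ((frequently_ae_mem_iff.2 (hpos i _ h)).and_eventually h3).exists
    rw [andWinsItem_of_gt τ i (by exact ha)] at ha'
    exact zero_ne_one ha'
  have h5 : limitWin τ F i 1 (x i) (o i) = 1 := by
    rcases h4.lt_or_eq with h | h
    · rw [limitWin, if_pos h]
    · rw [limitWin, if_neg h.not_lt, if_pos h]
      split_ifs with hx0
      · rfl
      · obtain ⟨a, ha, ha'⟩ := ((frequently_ae_mem_iff.2 hx0).and_eventually h3).exists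
        rw [show a i = x i from ha, h, andWinsItem_self] at ha'
        exact ha'
  have h6 := hzero i
  rw [h5, mul_one] at h6
  linarith

/-- Above the highest bids of `OR` there is no reason to bid more. -/
theorem ae_and_le (hN : IsNashEquilibrium v H τ F G) (hv : 1 / 2 < v) (hH : 1 / 2 < H) :
    ∀ᵐ a ∂F, ∀ i, a i ≤ v - utilityOr v τ F G := by
  have hv0 : 0 ≤ v := by linarith
  have := hN.2.1.1
  have hβv := hN.utilityOr_le hv0
  filter_upwards [hN.ae_pureAnd_eq, hN.1.2] with a hbest hbox i
  by_contra! hlt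
  obtain ⟨j, hij⟩ := exists_ne_fin_two i
  obtain ⟨y, hy1, hy2⟩ := exists_between hlt
  -- Lowering the bid on item `i` to `y` saves money without losing the item.
  have h1 := hN.pureAnd_le (a := Function.update a i y) fun k => by
    rcases eq_or_eq_of_ne hij k with rfl | rfl
    · simp only [Function.update_self]
      exact ⟨by linarith, hy2.le.trans (hbox k).2⟩
    · simpa only [Function.update_of_ne hij.symm] using hbox k
  have e : (fun o => payoffAnd τ (Function.update a i y) o) =ᵐ[G]
      fun o => payoffAnd τ a o + (a i - y) := by
    filter_upwards [hN.ae_or_le hv hH] with o ho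
    simp only [payoffAnd, prod_of_ne hij, sum_of_ne hij, Function.update_self,
      Function.update_of_ne hij.symm, andWinsItem_of_lt τ i ((ho i).trans_lt hy1),
      andWinsItem_of_lt τ i ((ho i).trans_lt hlt)]
    ring
  have h2 : pureAnd τ G (Function.update a i y) = pureAnd τ G a + (a i - y) := by
    unfold pureAnd
    rw [integral_congr_ae e, integral_add (integrable_payoffAnd_left a) (integrable_const _)]
    simp
  linarith

/-- Both players bid up to the same level `v - β` on both items. It is at least `1/2`, because
`AND` could win both items at this price, and at most `1/2` by `false_of_common_top`. -/
theorem utilityOr_eq_sub_half (hN : IsNashEquilibrium v H τ F G) (hv : 1 / 2 < v)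
    (hH : 1 / 2 < H) : utilityOr v τ F G = v - 1 / 2 := by
  have hv0 : 0 ≤ v := by linarith
  have := hN.2.1.1
  have hG := hN.ae_or_le hv hH
  have hF := hN.ae_and_le hv hH
  have hH' := hN.sub_le_utilityOr hv0 hH
  have hβv := hN.utilityOr_le hv0
  obtain ⟨h, hh⟩ : ∃ h, h = v - utilityOr v τ F G := ⟨_, rfl⟩
  rw [← hh] at hG hF
  have h1 : 1 / 2 ≤ h := by
    by_contra! hlt
    have h2 := hN.overbid_and (x := fun _ => h) fun _ => ⟨by linarith, by linarith⟩
    have h3 : G.real {o : Bid | ∀ i, o i ≤ h} = 1 := by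
      rw [Measure.real, (prob_compl_eq_zero_iff (measurableSet_le_box fun _ => h)).1 hG]
      rfl
    rw [h3, (hN.utilityAnd_eq_zero_and hv hH).1, Fin.sum_univ_two] at h2
    have h4 (i : Fin 2) : G.real {o : Bid | o i ≤ h} ≤ 1 := measureReal_le_one
    nlinarith [h4 0, h4 1]
  rcases h1.lt_or_eq with h2 | h2
  · refine (hN.false_of_common_top hv0 h2 (by linarith) (ae_all_iff.1 hF) (ae_all_iff.1 hG)
      fun i y hy => hN.measure_lt_ne_zero hv0 (by linarith) (by linarith) i y hy).elim
  · linarith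

end IsNashEquilibrium

/-! ### Stochastic dominance on the line -/

section Dominance

variable {μ ν : Measure ℝ}

theorem measure_Iio_le_of_Iic (h : ∀ x, μ (Set.Iic x) ≤ ν (Set.Iic x)) (x : ℝ) :
    μ (Set.Iio x) ≤ ν (Set.Iio x) := by
  obtain ⟨u, hu, hlt, hlim⟩ := exists_seq_strictMono_tendsto x
  rw [← iUnion_Iic_eq_Iio_of_lt_of_tendsto hlt hlim]
  have hm : Monotone fun n => Set.Iic (u n) := fun m n hmn => Set.Iic_subset_Iic.2 (hu.monotone hmn)
  rw [hm.measure_iUnion, hm.measure_iUnion]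
  exact iSup_mono fun n => h (u n)

theorem measure_le_of_isLowerSet [IsProbabilityMeasure μ] [IsProbabilityMeasure ν]
    (h : ∀ x, μ (Set.Iic x) ≤ ν (Set.Iic x)) {L : Set ℝ} (hL : IsLowerSet L) : μ L ≤ ν L := by
  rcases L.eq_empty_or_nonempty with rfl | hne
  · simp
  · by_cases hbdd : BddAbove L
    · by_cases hs : sSup L ∈ L
      · have e : L = Set.Iic (sSup L) :=
          Set.Subset.antisymm (fun x hx => le_csSup hbdd hx) fun x hx => hL hx hs
        rw [e]
        exact h _
      · have e : L = Set.Iio (sSup L) := by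
          refine Set.Subset.antisymm (fun x hx => ?_) fun x hx => ?_
          · exact lt_of_le_of_ne (le_csSup hbdd hx) fun h => hs (h ▸ hx)
          · obtain ⟨y, hy, hxy⟩ := exists_lt_of_lt_csSup hne hx
            exact hL hxy.le hy
        rw [e]
        exact measure_Iio_le_of_Iic h _
    · have e : L = Set.univ := by
        refine Set.eq_univ_of_forall fun x => ?_
        obtain ⟨y, hy, hxy⟩ := not_bddAbove_iff.1 hbdd x
        exact hL hxy.le hy
      simp [e]

theorem measure_lt_le_of_monotone [IsProbabilityMeasure μ] [IsProbabilityMeasure ν]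
    (h : ∀ x, μ (Set.Iic x) ≤ ν (Set.Iic x)) {f : ℝ → ℝ} (hf : Monotone f) (t : ℝ) :
    ν {x | t < f x} ≤ μ {x | t < f x} := by
  have hL : IsLowerSet {x | f x ≤ t} := fun x y hyx hx => (hf hyx).trans hx
  have hm : MeasurableSet {x | f x ≤ t} := measurableSet_le hf.measurable measurable_const
  have e : {x | t < f x} = {x | f x ≤ t}ᶜ := by
    ext x
    simp
  rw [e, prob_compl_eq_one_sub hm, prob_compl_eq_one_sub hm]
  exact tsub_le_tsub_left (measure_le_of_isLowerSet h hL) _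

/-- The integral of a monotone function increases with respect to stochastic dominance. -/
theorem lintegral_le_of_monotone [IsProbabilityMeasure μ] [IsProbabilityMeasure ν]
    (h : ∀ x, μ (Set.Iic x) ≤ ν (Set.Iic x)) {f : ℝ → ℝ} (hf : Monotone f)
    (hμ : ∀ᵐ x ∂μ, 0 ≤ f x) (hν : ∀ᵐ x ∂ν, 0 ≤ f x) :
    ∫⁻ x, ENNReal.ofReal (f x) ∂ν ≤ ∫⁻ x, ENNReal.ofReal (f x) ∂μ := by
  rw [lintegral_eq_lintegral_meas_lt μ hμ hf.measurable.aemeasurable,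
    lintegral_eq_lintegral_meas_lt ν hν hf.measurable.aemeasurable]
  exact lintegral_mono fun t => measure_lt_le_of_monotone h hf t

/-- Two laws on `[0, c]` which are comparable with respect to stochastic dominance and give the
same integral to a strictly increasing function are equal: by the layer cake formula, almost all
superlevel sets have the same mass. -/
theorem eq_of_lintegral_eq [IsProbabilityMeasure μ] [IsProbabilityMeasure ν]
    (h : ∀ x, μ (Set.Iic x) ≤ ν (Set.Iic x)) {f : ℝ → ℝ} {c : ℝ} (hf : Monotone f)
    (hf' : StrictMonoOn f (Set.Icc 0 c)) (h0 : ∀ x ∈ Set.Icc 0 c, 0 ≤ f x)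
    (hμ : ∀ᵐ x ∂μ, x ∈ Set.Icc 0 c) (hν : ∀ᵐ x ∂ν, x ∈ Set.Icc 0 c)
    (heq : ∫⁻ x, ENNReal.ofReal (f x) ∂μ = ∫⁻ x, ENNReal.ofReal (f x) ∂ν)
    (hfin : ∫⁻ x, ENNReal.ofReal (f x) ∂ν ≠ ⊤) : μ = ν := by
  have hμ0 : ∀ᵐ x ∂μ, 0 ≤ f x := hμ.mono fun x hx => h0 x hx
  have hν0 : ∀ᵐ x ∂ν, 0 ≤ f x := hν.mono fun x hx => h0 x hx
  have hae : ∀ᵐ t ∂volume.restrict (Set.Ioi (0 : ℝ)), ν {x | t < f x} = μ {x | t < f x} := by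
    rw [lintegral_eq_lintegral_meas_lt μ hμ0 hf.measurable.aemeasurable,
      lintegral_eq_lintegral_meas_lt ν hν0 hf.measurable.aemeasurable] at heq
    rw [lintegral_eq_lintegral_meas_lt ν hν0 hf.measurable.aemeasurable] at hfin
    refine ae_eq_of_ae_le_of_lintegral_le (.of_forall fun t => measure_lt_le_of_monotone h hf t)
      hfin (Antitone.measurable fun s t hst => ?_).aemeasurable heq.le
    exact measure_mono fun x hx => hst.trans_lt hx
  refine Measure.ext_of_Iic μ ν fun x => le_antisymm (h x) ?_
  rcases lt_or_ge x 0 with hx | hx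
  · have : ν (Set.Iic x) = 0 := by
      refine measure_eq_zero_iff_ae_notMem.2 (hν.mono fun y hy hyx => ?_)
      exact (hx.trans_le hy.1).not_ge hyx
    rw [this]
    exact zero_le
  rcases lt_or_ge x c with hxc | hxc
  · have key (y : ℝ) (hy : y ∈ Set.Ioo x c) : μ (Set.Ioi y) ≤ ν (Set.Ioi x) := by
      have hlt : f x < f y := hf' ⟨hx, hxc.le⟩ ⟨hx.trans hy.1.le, hy.2.le⟩ hy.1
      have hne : volume.restrict (Set.Ioi (0 : ℝ)) (Set.Ioo (f x) (f y)) ≠ 0 := by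
        rw [Measure.restrict_apply measurableSet_Ioo, Set.inter_eq_left.2]
        · simpa using hlt
        · exact fun t ht => (h0 x ⟨hx, hxc.le⟩).trans_lt ht.1
      obtain ⟨t, ht, he⟩ := ((frequently_ae_mem_iff.2 hne).and_eventually hae).exists
      calc μ (Set.Ioi y) ≤ μ {x | t < f x} :=
            measure_mono fun z hz => ht.2.trans_le (hf (le_of_lt hz))
        _ = ν {x | t < f x} := he.symm
        _ ≤ ν (Set.Ioi x) := by
            refine measure_mono fun z hz => Set.mem_Ioi.2 (not_le.1 fun hzx => ?_)
            exact (ht.1.trans hz).not_ge (hf hzx)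
    have hle : μ (Set.Ioi x) ≤ ν (Set.Ioi x) := by
      obtain ⟨u, hu, hmem, hlim⟩ := exists_seq_strictAnti_tendsto' hxc
      have hm : Monotone fun n => Set.Ioi (u n) :=
        fun m n hmn => Set.Ioi_subset_Ioi (hu.antitone hmn)
      have e : ⋃ n, Set.Ioi (u n) = Set.Ioi x := by
        refine Set.Subset.antisymm (Set.iUnion_subset fun n => Set.Ioi_subset_Ioi (hmem n).1.le)
          fun z hz => ?_
        obtain ⟨n, hn⟩ := (hlim.eventually_lt_const hz).exists
        exact Set.mem_iUnion.2 ⟨n, hn⟩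
      rw [← e, hm.measure_iUnion, e]
      exact iSup_le fun n => key _ (hmem n)
    rw [← Set.compl_Iic, prob_compl_eq_one_sub measurableSet_Iic,
      prob_compl_eq_one_sub measurableSet_Iic] at hle
    exact (ENNReal.sub_le_sub_iff_left prob_le_one ENNReal.one_ne_top).1 hle
  · have : μ (Set.Iic x) = 1 := by
      rw [← prob_compl_eq_zero_iff measurableSet_Iic]
      exact (hμ.mono fun y hy => hy.2.trans hxc)
    rw [this]
    exact prob_le_one

/-- Tail integrals of a positive function against a law on `[0, 1/2]` are strictly decreasing
where the distribution function is strictly increasing. -/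
theorem mul_sub_le_tail_sub [IsProbabilityMeasure μ] {g : ℝ → ℝ} (hg : Measurable g) {δ C : ℝ}
    (hμ : ∀ᵐ z ∂μ, δ ≤ g z ∧ |g z| ≤ C) {x y : ℝ} (hxy : x ≤ y) :
    δ * (μ.real (Set.Iic y) - μ.real (Set.Iic x)) ≤
      ∫ z in Set.Ioi x, g z ∂μ - ∫ z in Set.Ioi y, g z ∂μ := by
  have hint : Integrable g μ := integrable_of_ae_abs_le hg C (hμ.mono fun z hz => hz.2)
  have e : Set.Ioi x = Set.Ioc x y ∪ Set.Ioi y := (Set.Ioc_union_Ioi_eq_Ioi hxy).symm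
  rw [e, setIntegral_union (Set.disjoint_left.2 fun z hz hz' => hz'.not_ge hz.2) measurableSet_Ioi
    hint.integrableOn hint.integrableOn, add_sub_cancel_right,
    ← measureReal_sdiff (Set.Iic_subset_Iic.2 hxy) measurableSet_Iic, Set.Iic_sdiff_Iic, mul_comm,
    ← smul_eq_mul, ← setIntegral_const]
  exact setIntegral_mono_ae (integrable_const _).integrableOn hint.integrableOn
    (hμ.mono fun z hz => hz.1)

end Dominance

/-! ### Weighted payments -/

section Transfer

variable {v H : ℝ} {τ : TieRule} {F G : Measure Bid}

/-- The law of `OR`'s bid on either item under `orStar`. -/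
def orMarginal : Measure ℝ := (1 / 2 : ENNReal) • Measure.dirac 0 + (1 / 2 : ENNReal) • orLaw

theorem map_orStar (i : Fin 2) : orStar.map (fun o => o i) = orMarginal := by
  have hm (i : Fin 2) : Measurable fun o : Bid => o i := measurable_pi_apply i
  unfold orStar orMarginal
  rw [Measure.map_add _ _ (hm i), Measure.map_smul, Measure.map_smul,
    Measure.map_map (hm i) (by fun_prop), Measure.map_map (hm i) (by fun_prop)]
  have e1 : (fun o : Bid => o 0) ∘ (fun x : ℝ => (![x, 0] : Bid)) = id := rfl
  have e2 : (fun o : Bid => o 1) ∘ (fun x : ℝ => (![0, x] : Bid)) = id := rfl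
  have e3 : (fun o : Bid => o 0) ∘ (fun x : ℝ => (![0, x] : Bid)) = fun _ => 0 := rfl
  have e4 : (fun o : Bid => o 1) ∘ (fun x : ℝ => (![x, 0] : Bid)) = fun _ => 0 := rfl
  fin_cases i
  · simp only [Fin.zero_eta, e1, e3, Measure.map_id, Measure.map_const, measure_univ, one_smul]
    rw [add_comm]
  · simp only [Fin.mk_one, e2, e4, Measure.map_id, Measure.map_const, measure_univ, one_smul]

instance : IsProbabilityMeasure orMarginal := by
  constructor
  simp [orMarginal, ENNReal.inv_two_add_inv_two]

theorem ae_orMarginal_mem : ∀ᵐ x ∂orMarginal, x ∈ Set.Icc (0 : ℝ) (1 / 2) := by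
  unfold orMarginal
  rw [ae_add_measure_iff]
  constructor
  · refine Measure.ae_smul_measure ?_ _
    exact (ae_dirac_iff (measurableSet_Icc (a := (0 : ℝ)) (b := 1 / 2))).2 (by norm_num)
  · refine Measure.ae_smul_measure ?_ _
    filter_upwards [ae_orLaw_mem] with x hx using Set.Ioc_subset_Icc_self hx

theorem orMarginal_singleton {x : ℝ} (hx : 0 < x) : orMarginal {x} = 0 := by
  simp [orMarginal, hx.ne]

theorem mul_orMarginal_Iic {x : ℝ} (h0 : 0 ≤ x) (h1 : x ≤ 1 / 2) :
    (1 - x) * orMarginal.real (Set.Iic x) = 1 / 2 := by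
  have h := mul_orLaw_Iic h0 h1
  have e : orMarginal.real (Set.Iic x) = 1 / 2 + 1 / 2 * orLaw.real (Set.Iic x) := by
    simp [orMarginal, Measure.real, ENNReal.toReal_add, ENNReal.mul_ne_top, h0]
  rw [e]
  linear_combination h / 2

/-- What the players pay for item `i` at the bids `a` and `o`, with `AND`'s payment weighted by
the value `v` of `OR`. In `v * payoffAnd + payoffOr` the terms for winning both items cancel, and
these payments are all that is left besides a constant. -/
def transfer (v : ℝ) (τ : TieRule) (i : Fin 2) (a o : ℝ) : ℝ :=
  v * (a * andWinsItem τ i a o) + o * (1 - andWinsItem τ i a o)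

@[fun_prop]
theorem measurable_transfer {X : Type*} [MeasurableSpace X] (i : Fin 2) {f g : X → ℝ}
    (hf : Measurable f) (hg : Measurable g) :
    Measurable fun x => transfer v τ i (f x) (g x) := by
  unfold transfer
  fun_prop

theorem transfer_of_lt (i : Fin 2) {a o : ℝ} (h : o < a) : transfer v τ i a o = v * a := by
  simp [transfer, andWinsItem_of_lt τ i h]

theorem transfer_of_gt (i : Fin 2) {a o : ℝ} (h : a < o) : transfer v τ i a o = o := by
  simp [transfer, andWinsItem_of_gt τ i h]

theorem transfer_self (i : Fin 2) (a : ℝ) :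
    transfer v τ i a a = a + τ.andWins i a * ((v - 1) * a) := by
  simp only [transfer, andWinsItem_self]
  ring

theorem payoff_add_payoff (a o : Bid) :
    v * payoffAnd τ a o + payoffOr v τ a o = v - ∑ i, transfer v τ i (a i) (o i) := by
  simp only [payoffAnd, payoffOr, transfer, Finset.sum_add_distrib, ← Finset.mul_sum]
  ring

theorem transfer_nonneg (hv : 0 ≤ v) (i : Fin 2) {a o : ℝ} (ha : 0 ≤ a) (ho : 0 ≤ o) :
    0 ≤ transfer v τ i a o :=
  add_nonneg (mul_nonneg hv (mul_nonneg ha (andWinsItem_nonneg _ _ _ _)))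
    (mul_nonneg ho (sub_nonneg.2 (andWinsItem_le_one _ _ _ _)))

/-- For `v ≥ 1`, a higher bid of `AND` costs more if it already wins, and if it takes over the item,
then `v` times this bid is at least the bid of `OR` it replaces. -/
theorem transfer_mono_left (hv : 1 ≤ v) (i : Fin 2) {o : ℝ} (ho : 0 ≤ o) :
    Monotone fun a => transfer v τ i a o := by
  intro a b hab
  simp only
  rcases lt_or_ge a o with ha | ha
  · rcases lt_or_ge b o with hb | hb
    · rw [transfer_of_gt i ha, transfer_of_gt i hb]
    · have := andWinsItem_nonneg τ i b o
      rw [transfer_of_gt i ha, transfer]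
      nlinarith [mul_nonneg (mul_nonneg (sub_nonneg.2 hv) (ho.trans hb)) this,
        mul_nonneg (sub_nonneg.2 hb) this]
  · rcases ha.lt_or_eq with ha | ha
    · rw [transfer_of_lt i ha, transfer_of_lt i (ha.trans_le hab)]
      exact mul_le_mul_of_nonneg_left hab (by linarith)
    · rcases hab.lt_or_eq with hb | hb
      · subst ha
        rw [transfer_of_lt i hb, transfer_self]
        have h2 := (τ.mem_Icc i o).2
        nlinarith [mul_nonneg (sub_nonneg.2 h2) (mul_nonneg (sub_nonneg.2 hv) ho)]
      · rw [hb]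

theorem transfer_mono_right (hv : v ≤ 1) (i : Fin 2) {a : ℝ} (ha : 0 ≤ a) :
    Monotone fun o => transfer v τ i a o := by
  intro o p hop
  simp only
  have hva : v * a ≤ a := mul_le_of_le_one_left ha hv
  have hself : v * a ≤ transfer v τ i a a ∧ transfer v τ i a a ≤ a := by
    rw [transfer_self]
    have h1 := (τ.mem_Icc i a).1
    have h2 := (τ.mem_Icc i a).2
    constructor <;> nlinarith [mul_nonneg h1 (sub_nonneg.2 hva),
      mul_nonneg (sub_nonneg.2 h2) (sub_nonneg.2 hva)]
  rcases lt_trichotomy o a with ho | rfl | ho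
  · rw [transfer_of_lt i ho]
    rcases lt_trichotomy p a with hp | rfl | hp
    · rw [transfer_of_lt i hp]
    · exact hself.1
    · rw [transfer_of_gt i hp]
      linarith
  · rcases hop.lt_or_eq with hp | rfl
    · rw [transfer_of_gt i hp]
      linarith [hself.2]
    · exact le_rfl
  · rw [transfer_of_gt i ho, transfer_of_gt i (ho.trans_le hop)]
    exact hop

end Transfer

/-! ### Expected weighted payments -/

section ExpectedTransfer

variable {v H : ℝ} {τ : TieRule} {F G : Measure Bid}

/-- The expected value of `transfer` on an item on which `OR` bids `o` and `AND` bids by the law `andLaw v`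
(see `lintegral_transfer_andLaw`). -/
def transferAgainstAnd (v o : ℝ) : ℝ := 1 / 2 - v * ∫ a in Set.Ioi o, (1 - a) ∂andLaw v

/-- The expected value of `transfer` on an item on which `AND` bids `a` and `OR` bids by the law `orMarginal`
(see `lintegral_transfer_orMarginal`). -/
def transferAgainstOr (v a : ℝ) : ℝ := v / 2 - ∫ o in Set.Ioi a, (v - o) ∂orMarginal

theorem abs_transfer_le (hv : 0 ≤ v) (i : Fin 2) {a o : ℝ} {C : ℝ} (ha : a ∈ Set.Icc (0 : ℝ) C)
    (ho : o ∈ Set.Icc (0 : ℝ) C) : |transfer v τ i a o| ≤ v * C + C := by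
  have h1 := abs_mul_le_of_mem ha (andWinsItem_nonneg τ i a o) (andWinsItem_le_one τ i a o)
  have h2 := abs_mul_le_of_mem ho (sub_nonneg.2 (andWinsItem_le_one τ i a o))
    (sub_le_self 1 (andWinsItem_nonneg τ i a o))
  refine (abs_add_le _ _).trans (add_le_add ?_ h2)
  rw [abs_mul, abs_of_nonneg hv]
  exact mul_le_mul_of_nonneg_left h1 hv

theorem lintegral_transfer_andLaw (hv : 1 / 2 < v) (i : Fin 2) {o : ℝ}
    (ho : o ∈ Set.Icc (0 : ℝ) (1 / 2)) :
    ∫⁻ a, ENNReal.ofReal (transfer v τ i a o) ∂andLaw v =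
      ENNReal.ofReal (transferAgainstAnd v o) := by
  have := isProbabilityMeasure_andLaw hv
  have hv0 : 0 ≤ v := by linarith
  rw [← ofReal_integral_eq_lintegral_ofReal]
  · congr 1
    have hne : ∀ᵐ a ∂andLaw v, 0 < o → a ≠ o := by
      rcases ho.1.lt_or_eq with h | h
      · have h1 : ∀ᵐ a ∂andLaw v, a ≠ o := by
          rw [ae_iff]
          simpa using andLaw_singleton h
        filter_upwards [h1] with a ha _ using ha
      · exact .of_forall fun a h' => absurd h' (by rw [← h]; exact lt_irrefl _)
    have e : (fun a => transfer v τ i a o) =ᵐ[andLaw v] fun a => o + (Set.Ioi o).indicator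
        (fun a => v * a - o) a := by
      filter_upwards [hne] with a ha
      rcases lt_trichotomy a o with h | h | h
      · rw [transfer_of_gt i h, Set.indicator_of_notMem (by simpa using h.le), add_zero]
      · have : o = 0 := le_antisymm (not_lt.1 fun h' => ha h' h) ho.1
        subst this
        subst h
        simp [transfer]
      · rw [transfer_of_lt i h, Set.indicator_of_mem (by exact h)]
        ring
    have hid : Integrable (fun a : ℝ => a) (andLaw v) :=
      integrable_of_ae_abs_le measurable_id (1 / 2) (by
        filter_upwards [ae_andLaw_mem] with a ha
        rw [abs_of_nonneg ha.1]
        exact ha.2)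
    have hP : (andLaw v).real (Set.Ioi o) = 1 - (andLaw v).real (Set.Iic o) := by
      rw [← Set.compl_Iic, probReal_compl_eq_one_sub measurableSet_Iic]
    have hd : Integrable (fun a => v * a - o) (andLaw v) :=
      (hid.const_mul v).sub (integrable_const _)
    rw [integral_congr_ae e, integral_add (integrable_const _) (hd.indicator measurableSet_Ioi),
      integral_indicator measurableSet_Ioi,
      integral_sub (hid.const_mul v).integrableOn (integrable_const _).integrableOn,
      integral_const_mul, transferAgainstAnd,
      integral_sub (integrable_const _).integrableOn hid.integrableOn]
    simp only [integral_const, measureReal_restrict_apply_univ, probReal_univ, smul_eq_mul, hP]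
    linear_combination -mul_andLaw_Iic hv ho.1 ho.2
  · refine integrable_of_ae_abs_le (by fun_prop) (v * (1 / 2) + 1 / 2) ?_
    filter_upwards [ae_andLaw_mem] with a ha using abs_transfer_le hv0 i ha ho
  · filter_upwards [ae_andLaw_mem] with a ha using transfer_nonneg hv0 i ha.1 ho.1

theorem lintegral_transfer_orMarginal (hv : 1 / 2 < v) (i : Fin 2) {a : ℝ}
    (ha : a ∈ Set.Icc (0 : ℝ) (1 / 2)) :
    ∫⁻ o, ENNReal.ofReal (transfer v τ i a o) ∂orMarginal =
      ENNReal.ofReal (transferAgainstOr v a) := by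
  have hv0 : 0 ≤ v := by linarith
  rw [← ofReal_integral_eq_lintegral_ofReal]
  · congr 1
    have hne : ∀ᵐ o ∂orMarginal, 0 < a → o ≠ a := by
      rcases ha.1.lt_or_eq with h | h
      · have h1 : ∀ᵐ o ∂orMarginal, o ≠ a := by
          rw [ae_iff]
          simpa using orMarginal_singleton h
        filter_upwards [h1] with o ho _ using ho
      · exact .of_forall fun o h' => absurd h' (by rw [← h]; exact lt_irrefl _)
    have e : (fun o => transfer v τ i a o) =ᵐ[orMarginal] fun o => v * a +
        (Set.Ioi a).indicator (fun o => o - v * a) o := by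
      filter_upwards [hne] with o ho
      rcases lt_trichotomy o a with h | h | h
      · rw [transfer_of_lt i h, Set.indicator_of_notMem (by simpa using h.le), add_zero]
      · have : a = 0 := le_antisymm (not_lt.1 fun h' => ho h' h) ha.1
        subst this
        subst h
        simp [transfer]
      · rw [transfer_of_gt i h, Set.indicator_of_mem (by exact h)]
        ring
    have hid : Integrable (fun o : ℝ => o) orMarginal :=
      integrable_of_ae_abs_le measurable_id (1 / 2) (by
        filter_upwards [ae_orMarginal_mem] with o ho
        rw [abs_of_nonneg ho.1]
        exact ho.2)
    have hP : orMarginal.real (Set.Ioi a) = 1 - orMarginal.real (Set.Iic a) := by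
      rw [← Set.compl_Iic, probReal_compl_eq_one_sub measurableSet_Iic]
    have hd : Integrable (fun o => o - v * a) orMarginal := hid.sub (integrable_const _)
    rw [integral_congr_ae e, integral_add (integrable_const _) (hd.indicator measurableSet_Ioi),
      integral_indicator measurableSet_Ioi,
      integral_sub hid.integrableOn (integrable_const _).integrableOn,
      transferAgainstOr, integral_sub (integrable_const _).integrableOn hid.integrableOn]
    simp only [integral_const, measureReal_restrict_apply_univ, probReal_univ, smul_eq_mul, hP]
    linear_combination -v * mul_orMarginal_Iic ha.1 ha.2
  · refine integrable_of_ae_abs_le (by fun_prop) (v * (1 / 2) + 1 / 2) ?_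
    filter_upwards [ae_orMarginal_mem] with o ho using abs_transfer_le hv0 i ha ho
  · filter_upwards [ae_orMarginal_mem] with o ho using transfer_nonneg hv0 i ha.1 ho.1

theorem andLaw_Iic_lt (hv : 1 / 2 < v) {x y : ℝ} (hx : 0 ≤ x) (hxy : x < y) (hy : y ≤ 1 / 2) :
    (andLaw v).real (Set.Iic x) < (andLaw v).real (Set.Iic y) := by
  have h1 := mul_andLaw_Iic hv hx (hxy.le.trans hy)
  have h2 := mul_andLaw_Iic hv (hx.trans hxy.le) hy
  have h3 : 0 < (andLaw v).real (Set.Iic x) :=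
    pos_of_mul_pos_right (h1 ▸ sub_pos.2 hv) (by linarith)
  by_contra! h
  linarith [mul_le_mul_of_nonneg_left h (by linarith : 0 ≤ v - y), mul_pos (sub_pos.2 hxy) h3]

theorem orMarginal_Iic_lt {x y : ℝ} (hx : 0 ≤ x) (hxy : x < y) (hy : y ≤ 1 / 2) :
    orMarginal.real (Set.Iic x) < orMarginal.real (Set.Iic y) := by
  have h1 := mul_orMarginal_Iic hx (hxy.le.trans hy)
  have h2 := mul_orMarginal_Iic (hx.trans hxy.le) hy
  have h3 : 0 < orMarginal.real (Set.Iic x) :=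
    pos_of_mul_pos_right (h1 ▸ one_half_pos) (by linarith)
  by_contra! h
  linarith [mul_le_mul_of_nonneg_left h (by linarith : 0 ≤ 1 - y), mul_pos (sub_pos.2 hxy) h3]

theorem transferAgainstAnd_sub (hv : 1 / 2 < v) {x y : ℝ} (hxy : x ≤ y) :
    v * (1 / 2 * ((andLaw v).real (Set.Iic y) - (andLaw v).real (Set.Iic x))) ≤
      transferAgainstAnd v y - transferAgainstAnd v x := by
  have := isProbabilityMeasure_andLaw hv
  have h := mul_sub_le_tail_sub (μ := andLaw v) (g := fun a => 1 - a) (by fun_prop) (δ := 1 / 2)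
    (C := 1) (ae_andLaw_mem.mono fun a ha => by
      rw [abs_le]
      exact ⟨by linarith [ha.2], by linarith [ha.2], by linarith [ha.1]⟩) hxy
  have h' := mul_le_mul_of_nonneg_left h (by linarith : 0 ≤ v)
  unfold transferAgainstAnd
  linarith

theorem transferAgainstOr_sub (hv : 1 / 2 < v) {x y : ℝ} (hxy : x ≤ y) :
    (v - 1 / 2) * (orMarginal.real (Set.Iic y) - orMarginal.real (Set.Iic x)) ≤
      transferAgainstOr v y - transferAgainstOr v x := by
  have h := mul_sub_le_tail_sub (μ := orMarginal) (g := fun o => v - o) (by fun_prop)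
    (δ := v - 1 / 2) (C := v) (ae_orMarginal_mem.mono fun o ho => by
      rw [abs_le]
      exact ⟨by linarith [ho.2], by linarith [ho.2], by linarith [ho.1]⟩) hxy
  unfold transferAgainstOr
  linarith

theorem monotone_transferAgainstAnd (hv : 1 / 2 < v) : Monotone (transferAgainstAnd v) := by
  have := isProbabilityMeasure_andLaw hv
  intro x y hxy
  have h1 := transferAgainstAnd_sub hv hxy
  have h2 : (andLaw v).real (Set.Iic x) ≤ (andLaw v).real (Set.Iic y) :=
    measureReal_mono (Set.Iic_subset_Iic.2 hxy)
  nlinarith [mul_nonneg (by linarith : 0 ≤ v) (sub_nonneg.2 h2)]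

theorem strictMonoOn_transferAgainstAnd (hv : 1 / 2 < v) :
    StrictMonoOn (transferAgainstAnd v) (Set.Icc 0 (1 / 2)) := by
  intro x hx y hy hxy
  have h1 := transferAgainstAnd_sub hv hxy.le
  nlinarith [mul_pos (by linarith : 0 < v) (sub_pos.2 (andLaw_Iic_lt hv hx.1 hxy hy.2))]

theorem monotone_transferAgainstOr (hv : 1 / 2 < v) : Monotone (transferAgainstOr v) := by
  intro x y hxy
  have h1 := transferAgainstOr_sub hv hxy
  have h2 : orMarginal.real (Set.Iic x) ≤ orMarginal.real (Set.Iic y) :=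
    measureReal_mono (Set.Iic_subset_Iic.2 hxy)
  nlinarith [mul_nonneg (by linarith : 0 ≤ v - 1 / 2) (sub_nonneg.2 h2)]

theorem strictMonoOn_transferAgainstOr (hv : 1 / 2 < v) :
    StrictMonoOn (transferAgainstOr v) (Set.Icc 0 (1 / 2)) := by
  intro x hx y hy hxy
  have h1 := transferAgainstOr_sub hv hxy.le
  nlinarith [mul_pos (by linarith : 0 < v - 1 / 2) (sub_pos.2 (orMarginal_Iic_lt hx.1 hxy hy.2))]

theorem transferAgainstAnd_nonneg (hv : 1 / 2 < v) {o : ℝ} (ho : o ∈ Set.Icc (0 : ℝ) (1 / 2)) :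
    0 ≤ transferAgainstAnd v o := by
  have := isProbabilityMeasure_andLaw hv
  have h0 : transferAgainstAnd v 0 ≤ transferAgainstAnd v o :=
    monotone_transferAgainstAnd hv ho.1
  refine le_trans ?_ h0
  have hle : ∫ a in Set.Ioi 0, (1 - a) ∂andLaw v ≤ (andLaw v).real (Set.Ioi 0) := by
    rw [← mul_one ((andLaw v).real _), ← smul_eq_mul, ← setIntegral_const]
    refine setIntegral_mono_ae (integrable_of_ae_abs_le (by fun_prop) 1 ?_).integrableOn
      (integrable_const _).integrableOn (ae_andLaw_mem.mono fun a ha => by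
        simpa using ha.1)
    filter_upwards [ae_andLaw_mem] with a ha
    rw [abs_le]
    exact ⟨by linarith [ha.2], by linarith [ha.1]⟩
  have hP : (andLaw v).real (Set.Ioi 0) = 1 - (andLaw v).real (Set.Iic 0) := by
    rw [← Set.compl_Iic, probReal_compl_eq_one_sub measurableSet_Iic]
  rw [hP] at hle
  have h1 := mul_andLaw_Iic hv le_rfl (by norm_num)
  unfold transferAgainstAnd
  nlinarith [mul_le_mul_of_nonneg_left hle (by linarith : 0 ≤ v)]

theorem transferAgainstOr_nonneg (hv : 1 / 2 < v) {a : ℝ} (ha : a ∈ Set.Icc (0 : ℝ) (1 / 2)) :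
    0 ≤ transferAgainstOr v a := by
  have h0 : transferAgainstOr v 0 ≤ transferAgainstOr v a :=
    monotone_transferAgainstOr hv ha.1
  refine le_trans ?_ h0
  have hle : ∫ o in Set.Ioi 0, (v - o) ∂orMarginal ≤ orMarginal.real (Set.Ioi 0) * v := by
    rw [← smul_eq_mul, ← setIntegral_const]
    refine setIntegral_mono_ae (integrable_of_ae_abs_le (by fun_prop) v ?_).integrableOn
      (integrable_const _).integrableOn (ae_orMarginal_mem.mono fun a ha => by
        simpa using ha.1)
    filter_upwards [ae_orMarginal_mem] with o ho
    rw [abs_le]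
    exact ⟨by linarith [ho.2], by linarith [ho.1]⟩
  have hP : orMarginal.real (Set.Ioi 0) = 1 - orMarginal.real (Set.Iic 0) := by
    rw [← Set.compl_Iic, probReal_compl_eq_one_sub measurableSet_Iic]
  rw [hP] at hle
  have h1 := mul_orMarginal_Iic le_rfl (by norm_num)
  unfold transferAgainstOr
  nlinarith

end ExpectedTransfer

/-! ### The marginals of an equilibrium -/

section Marginals

variable {v : ℝ} {τ : TieRule} {μ ν : Measure ℝ}

theorem lintegral_lintegral_transfer_swap [SFinite μ] [SFinite ν] (i : Fin 2) :
    ∫⁻ a, ∫⁻ o, ENNReal.ofReal (transfer v τ i a o) ∂ν ∂μ =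
      ∫⁻ o, ∫⁻ a, ENNReal.ofReal (transfer v τ i a o) ∂μ ∂ν :=
  lintegral_lintegral_swap (Measurable.aemeasurable (by
    unfold Function.uncurry
    fun_prop))

theorem lintegral_transfer_against_and [IsProbabilityMeasure ν] (hv : 1 / 2 < v) (i : Fin 2)
    (hν : ∀ᵐ x ∂ν, x ∈ Set.Icc (0 : ℝ) (1 / 2)) :
    ∫⁻ a, ∫⁻ o, ENNReal.ofReal (transfer v τ i a o) ∂ν ∂andLaw v =
      ∫⁻ o, ENNReal.ofReal (transferAgainstAnd v o) ∂ν := by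
  have := isProbabilityMeasure_andLaw hv
  rw [lintegral_lintegral_transfer_swap]
  exact lintegral_congr_ae (hν.mono fun o ho => lintegral_transfer_andLaw hv i ho)

theorem lintegral_transfer_against_or (hv : 1 / 2 < v) (i : Fin 2)
    (hμ : ∀ᵐ x ∂μ, x ∈ Set.Icc (0 : ℝ) (1 / 2)) :
    ∫⁻ a, ∫⁻ o, ENNReal.ofReal (transfer v τ i a o) ∂orMarginal ∂μ =
      ∫⁻ a, ENNReal.ofReal (transferAgainstOr v a) ∂μ :=
  lintegral_congr_ae (hμ.mono fun _ ha => lintegral_transfer_orMarginal hv i ha)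

/-- If the bids on an item stochastically dominate `andLaw v` and `orMarginal`, then the expected
transfer is at least that under these laws, with equality for these laws only. If `v ≥ 1`, the
transfer is monotone in the bid of `AND` for any fixed bid of `OR`, so the law of `AND` is replaced
by `andLaw v` first; after that it is strictly increasing in the bid of `OR`. If `v ≤ 1`, the
players swap roles. -/
theorem lintegral_transfer_le [IsProbabilityMeasure μ] [IsProbabilityMeasure ν] (hv : 1 / 2 < v)
    (i : Fin 2) (hμ : ∀ᵐ x ∂μ, x ∈ Set.Icc (0 : ℝ) (1 / 2))
    (hν : ∀ᵐ x ∂ν, x ∈ Set.Icc (0 : ℝ) (1 / 2))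
    (hμd : ∀ x, μ (Set.Iic x) ≤ andLaw v (Set.Iic x))
    (hνd : ∀ x, ν (Set.Iic x) ≤ orMarginal (Set.Iic x)) :
    (∫⁻ a, ∫⁻ o, ENNReal.ofReal (transfer v τ i a o) ∂orMarginal ∂andLaw v ≤
      ∫⁻ a, ∫⁻ o, ENNReal.ofReal (transfer v τ i a o) ∂ν ∂μ) ∧
    (∫⁻ a, ∫⁻ o, ENNReal.ofReal (transfer v τ i a o) ∂ν ∂μ =
      ∫⁻ a, ∫⁻ o, ENNReal.ofReal (transfer v τ i a o) ∂orMarginal ∂andLaw v →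
      μ = andLaw v ∧ ν = orMarginal) := by
  have := isProbabilityMeasure_andLaw hv
  have hv0 : 0 ≤ v := by linarith
  have hfin (μ : Measure ℝ) [IsProbabilityMeasure μ] (f : ℝ → ℝ) (hf : Monotone f)
      (hμ : ∀ᵐ x ∂μ, x ∈ Set.Icc (0 : ℝ) (1 / 2)) : ∫⁻ x, ENNReal.ofReal (f x) ∂μ ≠ ⊤ := by
    refine ne_top_of_le_ne_top ENNReal.ofReal_ne_top (b := ENNReal.ofReal (f (1 / 2))) ?_
    calc ∫⁻ x, ENNReal.ofReal (f x) ∂μ ≤ ∫⁻ _, ENNReal.ofReal (f (1 / 2)) ∂μ :=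
          lintegral_mono_ae (hμ.mono fun x hx => ENNReal.ofReal_le_ofReal (hf hx.2))
      _ = _ := by simp
  have mA := monotone_transferAgainstAnd hv
  have mO := monotone_transferAgainstOr hv
  have nA (o : ℝ) (ho : o ∈ Set.Icc (0 : ℝ) (1 / 2)) := transferAgainstAnd_nonneg hv ho
  have nO (a : ℝ) (ha : a ∈ Set.Icc (0 : ℝ) (1 / 2)) := transferAgainstOr_nonneg hv ha
  have eqA (h : ∫⁻ o, ENNReal.ofReal (transferAgainstAnd v o) ∂ν =
      ∫⁻ o, ENNReal.ofReal (transferAgainstAnd v o) ∂orMarginal) : ν = orMarginal :=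
    eq_of_lintegral_eq hνd mA (strictMonoOn_transferAgainstAnd hv) nA hν
      ae_orMarginal_mem h (hfin _ _ mA ae_orMarginal_mem)
  have eqO (h : ∫⁻ a, ENNReal.ofReal (transferAgainstOr v a) ∂μ =
      ∫⁻ a, ENNReal.ofReal (transferAgainstOr v a) ∂andLaw v) : μ = andLaw v :=
    eq_of_lintegral_eq hμd mO (strictMonoOn_transferAgainstOr hv) nO hμ
      ae_andLaw_mem h (hfin _ _ mO ae_andLaw_mem)
  have leA := lintegral_le_of_monotone hνd mA (hν.mono fun o ho => nA o ho)
    (ae_orMarginal_mem.mono fun o ho => nA o ho)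
  have leO := lintegral_le_of_monotone hμd mO (hμ.mono fun a ha => nO a ha)
    (ae_andLaw_mem.mono fun a ha => nO a ha)
  have tA {ρ : Measure ℝ} [IsProbabilityMeasure ρ] (hρ : ∀ᵐ x ∂ρ, x ∈ Set.Icc (0 : ℝ) (1 / 2)) :=
    lintegral_transfer_against_and (τ := τ) hv i hρ
  have tO {ρ : Measure ℝ} (hρ : ∀ᵐ x ∂ρ, x ∈ Set.Icc (0 : ℝ) (1 / 2)) :=
    lintegral_transfer_against_or (τ := τ) hv i hρ
  rcases le_total 1 v with h1 | h1
  · have h2 : ∫⁻ o, ENNReal.ofReal (transferAgainstAnd v o) ∂ν ≤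
        ∫⁻ a, ∫⁻ o, ENNReal.ofReal (transfer v τ i a o) ∂ν ∂μ := by
      rw [← tA hν, lintegral_lintegral_transfer_swap, lintegral_lintegral_transfer_swap]
      refine lintegral_mono_ae (hν.mono fun o ho => ?_)
      exact lintegral_le_of_monotone hμd (transfer_mono_left h1 i ho.1)
        (hμ.mono fun a ha => transfer_nonneg hv0 i ha.1 ho.1)
        (ae_andLaw_mem.mono fun a ha => transfer_nonneg hv0 i ha.1 ho.1)
    refine ⟨(tA ae_orMarginal_mem).trans_le (leA.trans h2), fun he => ?_⟩
    have h3 : ν = orMarginal := by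
      refine eqA (le_antisymm ?_ leA)
      exact (h2.trans_eq he).trans_eq (tA ae_orMarginal_mem)
    refine ⟨eqO ?_, h3⟩
    rwa [h3, tO hμ, tO ae_andLaw_mem] at he
  · have h2 : ∫⁻ a, ENNReal.ofReal (transferAgainstOr v a) ∂μ ≤
        ∫⁻ a, ∫⁻ o, ENNReal.ofReal (transfer v τ i a o) ∂ν ∂μ := by
      rw [← tO hμ]
      refine lintegral_mono_ae (hμ.mono fun a ha => ?_)
      exact lintegral_le_of_monotone hνd (transfer_mono_right h1 i ha.1)
        (hν.mono fun o ho => transfer_nonneg hv0 i ha.1 ho.1)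
        (ae_orMarginal_mem.mono fun o ho => transfer_nonneg hv0 i ha.1 ho.1)
    refine ⟨(tO ae_andLaw_mem).trans_le (leO.trans h2), fun he => ?_⟩
    have h3 : μ = andLaw v := by
      refine eqO (le_antisymm ?_ leO)
      exact (h2.trans_eq he).trans_eq (tO ae_andLaw_mem)
    refine ⟨h3, eqA ?_⟩
    rwa [h3, tA hν, tA ae_orMarginal_mem] at he

end Marginals

/-! ### Uniqueness of the equilibrium strategies -/

section Uniqueness

variable {v H : ℝ} {τ : TieRule} {F G : Measure Bid}

/-- The expected transfers are what `v * utilityAnd + utilityOr` falls short of `v`. -/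
theorem sum_lintegral_transfer (hv : 0 ≤ v) (hF : IsMixedStrategy H F) (hG : IsMixedStrategy H G) :
    ∑ i, ∫⁻ a, ∫⁻ o, ENNReal.ofReal (transfer v τ i a o) ∂G.map (fun o => o i)
        ∂F.map (fun a => a i) =
      ENNReal.ofReal (v - (v * utilityAnd τ F G + utilityOr v τ F G)) := by
  have := hF.1
  have := hG.1
  have hA := (integrable_payoffAnd (τ := τ) hF hG).const_mul v
  have hO := integrable_payoffOr (τ := τ) hv hF hG
  have hm (i : Fin 2) : Measurable fun p : Bid × Bid =>
      ENNReal.ofReal (transfer v τ i (p.1 i) (p.2 i)) := by fun_prop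
  have e (p : Bid × Bid) : ∑ i, transfer v τ i (p.1 i) (p.2 i) =
      v - (v * payoffAnd τ p.1 p.2 + payoffOr v τ p.1 p.2) := by
    rw [payoff_add_payoff]
    ring
  have hi : Integrable (fun p : Bid × Bid => v * payoffAnd τ p.1 p.2 + payoffOr v τ p.1 p.2)
    (F.prod G) := hA.add hO
  have hnn : ∀ᵐ p ∂F.prod G, ∀ i, 0 ≤ transfer v τ i (p.1 i) (p.2 i) := by
    filter_upwards [ae_prod_fst (G := G) hF.2, ae_prod_snd (F := F) hG.2] with p h1 h2 i using
      transfer_nonneg hv i (h1 i).1 (h2 i).1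
  have h1 : v - (v * utilityAnd τ F G + utilityOr v τ F G) =
      ∫ p, ∑ i, transfer v τ i (p.1 i) (p.2 i) ∂F.prod G := by
    simp_rw [e]
    rw [integral_sub (integrable_const _) hi, integral_add hA hO, integral_const_mul,
      utilityAnd_eq_integral, utilityOr_eq_integral]
    simp
  rw [h1, ofReal_integral_eq_lintegral_ofReal
    (by simp_rw [e]; exact (integrable_const _).sub hi)
    (hnn.mono fun p hp => Finset.sum_nonneg fun i _ => hp i)]
  have h2 : ∀ᵐ p ∂F.prod G, ENNReal.ofReal (∑ i, transfer v τ i (p.1 i) (p.2 i)) =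
      ∑ i, ENNReal.ofReal (transfer v τ i (p.1 i) (p.2 i)) :=
    hnn.mono fun p hp => ENNReal.ofReal_sum_of_nonneg fun i _ => hp i
  rw [lintegral_congr_ae h2, lintegral_finsetSum _ fun i _ => hm i]
  refine Finset.sum_congr rfl fun i _ => ?_
  have hc (i : Fin 2) : Measurable fun b : Bid => b i := measurable_pi_apply i
  rw [lintegral_prod _ (hm i).aemeasurable, lintegral_map _ (hc i)]
  · refine lintegral_congr fun a => ?_
    rw [lintegral_map (by fun_prop) (hc i)]
  · exact Measurable.lintegral_prod_right' (f := fun p : ℝ × ℝ =>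
      ENNReal.ofReal (transfer v τ i p.1 p.2)) (by fun_prop)

theorem map_Iic (F : Measure Bid) (i : Fin 2) (x : ℝ) :
    F.map (fun a => a i) (Set.Iic x) = F {a | a i ≤ x} :=
  Measure.map_apply (measurable_pi_apply i) measurableSet_Iic

/-- Domination of distribution functions has to be checked on `[0, 1/2]` only. -/
theorem Iic_le_of_mul_le {μ ν : Measure ℝ} [IsProbabilityMeasure μ] [IsProbabilityMeasure ν]
    (hμ : ∀ᵐ x ∂μ, x ∈ Set.Icc (0 : ℝ) (1 / 2)) (hν : ∀ᵐ x ∂ν, x ∈ Set.Icc (0 : ℝ) (1 / 2))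
    (h : ∀ x ∈ Set.Ico (0 : ℝ) (1 / 2), μ.real (Set.Iic x) ≤ ν.real (Set.Iic x)) (x : ℝ) :
    μ (Set.Iic x) ≤ ν (Set.Iic x) := by
  rcases lt_or_ge x 0 with h0 | h0
  · have : μ (Set.Iic x) = 0 := by
      refine measure_mono_null (fun y hy => ?_) (ae_iff.1 hμ)
      exact fun h' => absurd h'.1 (not_le.2 (lt_of_le_of_lt hy h0))
    rw [this]
    exact zero_le
  rcases lt_or_ge x (1 / 2) with h1 | h1
  · exact (ENNReal.toReal_le_toReal (measure_ne_top _ _) (measure_ne_top _ _)).1 (h x ⟨h0, h1⟩)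
  · have : ν (Set.Iic x) = 1 :=
      (prob_compl_eq_zero_iff measurableSet_Iic).1
        (ae_iff.1 (hν.mono fun y hy => hy.2.trans h1))
    rw [this]
    exact prob_le_one

namespace IsNashEquilibrium

theorem ae_mem_Icc (hN : IsNashEquilibrium v H τ F G) (hv : 1 / 2 < v) (hH : 1 / 2 < H)
    (i : Fin 2) : (∀ᵐ x ∂F.map (fun a => a i), x ∈ Set.Icc (0 : ℝ) (1 / 2)) ∧
      ∀ᵐ x ∂G.map (fun o => o i), x ∈ Set.Icc (0 : ℝ) (1 / 2) := by
  have hβ := hN.utilityOr_eq_sub_half hv hH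
  have hc (i : Fin 2) : AEMeasurable (fun b : Bid => b i) F := (measurable_pi_apply i).aemeasurable
  have hc' (i : Fin 2) : AEMeasurable (fun b : Bid => b i) G := (measurable_pi_apply i).aemeasurable
  constructor
  · refine (ae_map_iff (hc i) measurableSet_Icc).2 ?_
    filter_upwards [hN.1.2, hN.ae_and_le hv hH] with a h1 h2
    exact ⟨(h1 i).1, by linarith [h2 i]⟩
  · refine (ae_map_iff (hc' i) measurableSet_Icc).2 ?_
    filter_upwards [hN.2.1.2, hN.ae_or_le hv hH] with a h1 h2
    exact ⟨(h1 i).1, by linarith [h2 i]⟩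

/-- Compare with `OR` bidding just above `x` on item `i` only. -/
theorem map_Iic_le_andLaw (hN : IsNashEquilibrium v H τ F G) (hv : 1 / 2 < v) (hH : 1 / 2 < H)
    (i : Fin 2) (x : ℝ) : F.map (fun a => a i) (Set.Iic x) ≤ andLaw v (Set.Iic x) := by
  have := hN.1.1
  have := isProbabilityMeasure_andLaw hv
  have := Measure.isProbabilityMeasure_map (μ := F) (measurable_pi_apply i).aemeasurable
  refine Iic_le_of_mul_le (hN.ae_mem_Icc hv hH i).1 ae_andLaw_mem (fun x hx => ?_) x
  have h := hN.mul_measureReal_le (by linarith) i (x := x) ⟨hx.1, hx.2.trans hH⟩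
  rw [hN.utilityOr_eq_sub_half hv hH, ← mul_andLaw_Iic hv hx.1 hx.2.le] at h
  rw [Measure.real, map_Iic]
  exact le_of_mul_le_mul_left h (by linarith [hx.2])

/-- `AND` could win both items by bidding `1/2` on one of them and just above `x` on the other. -/
theorem map_Iic_le_orMarginal (hN : IsNashEquilibrium v H τ F G) (hv : 1 / 2 < v)
    (hH : 1 / 2 < H) (i : Fin 2) (x : ℝ) :
    G.map (fun o => o i) (Set.Iic x) ≤ orMarginal (Set.Iic x) := by
  have := hN.2.1.1
  have := Measure.isProbabilityMeasure_map (μ := G) (measurable_pi_apply i).aemeasurable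
  refine Iic_le_of_mul_le (hN.ae_mem_Icc hv hH i).2 ae_orMarginal_mem (fun x hx => ?_) x
  obtain ⟨j, hij⟩ := exists_ne_fin_two i
  have hj : ∀ᵐ o ∂G, o j ≤ 1 / 2 :=
    (ae_of_ae_map (measurable_pi_apply j).aemeasurable (hN.ae_mem_Icc hv hH j).2).mono
      fun o ho => ho.2
  have h := hN.overbid_and (x := fun k => if k = i then x else 1 / 2) fun k => by
    split_ifs
    · exact ⟨hx.1, hx.2.trans hH⟩
    · exact ⟨by norm_num, hH⟩
  have e1 : G.real {o | ∀ k, o k ≤ if k = i then x else 1 / 2} = G.real {o | o i ≤ x} := by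
    refine measureReal_congr ?_
    filter_upwards [hj] with o ho
    refine propext ⟨fun h => (h i).trans_eq (if_pos rfl), fun h k => ?_⟩
    rcases eq_or_eq_of_ne hij k with rfl | rfl
    · exact h.trans_eq (if_pos rfl).symm
    · exact ho.trans_eq (if_neg hij.symm).symm
  have e2 : G.real {o | o j ≤ 1 / 2} = 1 := by
    rw [Measure.real, (prob_compl_eq_zero_iff (measurableSet_coord_le j _)).1 hj]
    rfl
  rw [sum_of_ne hij, (hN.utilityAnd_eq_zero_and hv hH).1, e1, if_pos rfl, if_neg hij.symm, e2] at h
  rw [Measure.real, map_Iic]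
  have h1 := mul_orMarginal_Iic hx.1 hx.2.le
  refine le_of_mul_le_mul_left (a := 1 - x) ?_ (by linarith [hx.2])
  rw [h1]
  change _ * G.real _ ≤ _
  linarith

/-- The expected transfers under an equilibrium add up to `1/2`, as those under
`(andStar v, orStar)` do. By `lintegral_transfer_le` they are at least as large on each item, so
they are equal. -/
theorem map_eq (hN : IsNashEquilibrium v H τ F G) (hv : 1 / 2 < v) (hH : 1 / 2 < H) (i : Fin 2) :
    F.map (fun a => a i) = andLaw v ∧ G.map (fun o => o i) = orMarginal := by
  have := hN.1.1
  have := hN.2.1.1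
  have hv0 : 0 ≤ v := by linarith
  have hp (μ : Measure Bid) [IsProbabilityMeasure μ] (i : Fin 2) :=
    Measure.isProbabilityMeasure_map (μ := μ) (measurable_pi_apply i).aemeasurable
  have key (i : Fin 2) := by
    have := hp F i
    have := hp G i
    exact lintegral_transfer_le (τ := τ) hv i (hN.ae_mem_Icc hv hH i).1
      (hN.ae_mem_Icc hv hH i).2 (hN.map_Iic_le_andLaw hv hH i) (hN.map_Iic_le_orMarginal hv hH i)
  have hS := isMixedStrategy_andStar (v := v) hv hH
  have hO := isMixedStrategy_orStar hH
  have h1 := sum_lintegral_transfer (τ := τ) hv0 hN.1 hN.2.1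
  have h2 := sum_lintegral_transfer (τ := τ) hv0 hS hO
  rw [(hN.utilityAnd_eq_zero_and hv hH).1, hN.utilityOr_eq_sub_half hv hH] at h1
  rw [hasStarMarginals_andStar.utilityAnd_orStar hH hS,
    hasStarMarginals_andStar.utilityOr_orStar hv hH hS, ← h1] at h2
  simp_rw [map_orStar, hasStarMarginals_andStar.map_eq] at h2
  obtain ⟨j, hij⟩ := exists_ne_fin_two i
  refine (key i).2 (le_antisymm ?_ (key i).1)
  have hfin :=
    (Finset.single_le_sum_of_canonicallyOrdered (Finset.mem_univ j)).trans_eq (h2.trans h1)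
  rw [sum_of_ne hij, sum_of_ne hij] at h2
  refine ENNReal.le_of_add_le_add_right (ne_top_of_le_ne_top ENNReal.ofReal_ne_top hfin) ?_
  rw [h2]
  exact add_le_add le_rfl (key j).1

end IsNashEquilibrium

/-- A law of nonnegative bids of which at least one is zero is determined by its marginals. -/
theorem eq_of_map_eq {G' : Measure Bid} [IsProbabilityMeasure G]
    (h : ∀ i, G.map (fun o => o i) = G'.map (fun o => o i))
    (hG : ∀ᵐ o ∂G, (∀ i, 0 ≤ o i) ∧ (o 0 ≤ 0 ∨ o 1 ≤ 0))
    (hG' : ∀ᵐ o ∂G', (∀ i, 0 ≤ o i) ∧ (o 0 ≤ 0 ∨ o 1 ≤ 0)) : G = G' := by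
  have hc (i : Fin 2) : Measurable fun b : Bid => b i := measurable_pi_apply i
  refine ext_of_Ioi_box fun x => ?_
  by_cases hx : ∀ i, 0 ≤ x i
  · have hz {μ : Measure Bid} (hμ : ∀ᵐ o ∂μ, (∀ i, 0 ≤ o i) ∧ (o 0 ≤ 0 ∨ o 1 ≤ 0)) :
        μ {o | ∀ i, x i < o i} = 0 := by
      refine measure_mono_null (fun o ho => ?_) (ae_iff.1 hμ)
      rintro ⟨-, h0 | h0⟩
      · exact absurd h0 (not_le.2 ((hx 0).trans_lt (ho 0)))
      · exact absurd h0 (not_le.2 ((hx 1).trans_lt (ho 1)))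
    rw [hz hG, hz hG']
  · push Not at hx
    obtain ⟨i, hi⟩ := hx
    obtain ⟨j, hij⟩ := exists_ne_fin_two i
    have hm {μ : Measure Bid} (hμ : ∀ᵐ o ∂μ, (∀ i, 0 ≤ o i) ∧ (o 0 ≤ 0 ∨ o 1 ≤ 0)) :
        μ {o | ∀ i, x i < o i} = μ.map (fun o => o j) (Set.Ioi (x j)) := by
      rw [Measure.map_apply (hc j) measurableSet_Ioi]
      refine measure_congr ?_
      filter_upwards [hμ] with o ho
      refine propext ⟨fun h => h j, fun h k => ?_⟩
      rcases eq_or_eq_of_ne hij k with rfl | rfl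
      · exact hi.trans_le (ho.1 k)
      · exact h
    rw [hm hG, hm hG', h j]

theorem hasStarMarginals_of_map_eq [IsProbabilityMeasure F]
    (hm : ∀ i, F.map (fun a => a i) = andLaw v)
    (h0 : (andLaw v).real (Set.Iic 0) ≤ F.real {a | ∀ i, a i ≤ 0}) : HasStarMarginals v F := by
  refine ⟨hm, ?_⟩
  have hnn (i : Fin 2) : ∀ᵐ a ∂F, 0 ≤ a i := by
    have h := ae_andLaw_mem (v := v)
    rw [← hm i] at h
    exact (ae_of_ae_map (measurable_pi_apply i).aemeasurable h).mono fun a ha => ha.1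
  have he (i : Fin 2) : ({a | ∀ k, a k ≤ 0} : Set Bid) =ᵐ[F] {a | a i ≤ 0} := by
    refine ae_eq_of_subset_of_measure_ge (fun a ha => ha i) ?_
      (measurableSet_le_box 0).nullMeasurableSet (measure_ne_top _ _)
    rw [← map_Iic, hm i, ← ENNReal.toReal_le_toReal _ (measure_ne_top _ _)]
    · exact h0
    · rw [← hm i, map_Iic]
      exact measure_ne_top _ _
  filter_upwards [he 0, he 1, hnn 0, hnn 1] with a h1 h2 h3 h4
  have h5 : a 0 ≤ 0 ↔ a 1 ≤ 0 := (h1.symm.trans h2).to_iff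
  rw [← h3.ge_iff_eq', ← h4.ge_iff_eq']
  exact h5

namespace IsNashEquilibrium

/-- Bidding just above `(0, 0)` must not be profitable for `AND`, so that `OR` never bids `0` on
both items. It bids `0` on each of them half of the time, hence always on one of them. -/
theorem eq_orStar (hN : IsNashEquilibrium v H τ F G) (hv : 1 / 2 < v) (hH : 1 / 2 < H) :
    G = orStar := by
  have := hN.2.1.1
  have hO := isMixedStrategy_orStar hH
  have h := hN.overbid_and (x := 0) fun i => ⟨le_rfl, by simp; linarith⟩
  rw [(hN.utilityAnd_eq_zero_and hv hH).1] at h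
  have hh (i : Fin 2) : G.real {o | o i ≤ 0} = 1 / 2 := by
    have h1 := mul_orMarginal_Iic le_rfl (by norm_num)
    rw [← (hN.map_eq hv hH i).2, Measure.real, map_Iic, sub_zero, one_mul] at h1
    exact h1
  have hu := measureReal_union_add_inter (μ := G) (s := {o : Bid | o 0 ≤ 0})
    (measurableSet_coord_le 1 0)
  rw [hh, hh] at hu
  have hI : G.real ({o : Bid | o 0 ≤ 0} ∩ {o | o 1 ≤ 0}) ≤ 0 := by
    simpa [Fin.forall_fin_two, Set.ofPred_and] using h
  have hU : G ({o : Bid | o 0 ≤ 0} ∪ {o | o 1 ≤ 0}) = 1 := by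
    refine le_antisymm prob_le_one ?_
    rw [← ENNReal.ofReal_one, ENNReal.ofReal_le_iff_le_toReal (measure_ne_top _ _)]
    change _ ≤ G.real _
    linarith
  refine eq_of_map_eq (fun i => ?_) ?_ ?_
  · rw [(hN.map_eq hv hH i).2, map_orStar]
  · have h1 : ∀ᵐ o ∂G, o 0 ≤ 0 ∨ o 1 ≤ 0 := (prob_compl_eq_zero_iff
      ((measurableSet_coord_le 0 0).union (measurableSet_coord_le 1 0))).2 hU
    filter_upwards [hN.2.1.2, h1] with o ho h2 using ⟨fun i => (ho i).1, h2⟩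
  · have h1 : ∀ᵐ o ∂orStar, o 0 ≤ 0 ∨ o 1 ≤ 0 :=
      ae_orStar (.of_forall fun x => by simp)
        ((measurableSet_coord_le 0 0).union (measurableSet_coord_le 1 0))
    filter_upwards [hO.2, h1] with o ho h2 using ⟨fun i => (ho i).1, h2⟩

/-- The mass at the origin comes from comparing with `OR`'s bids just above `(0, 0)`. -/
theorem hasStarMarginals (hN : IsNashEquilibrium v H τ F G) (hv : 1 / 2 < v) (hH : 1 / 2 < H) :
    HasStarMarginals v F := by
  have := hN.1.1
  refine hasStarMarginals_of_map_eq (fun i => (hN.map_eq hv hH i).1) ?_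
  have h := hN.overbid_or (by linarith) (x := 0) fun i => ⟨le_rfl, by simp; linarith⟩
  have hF (i : Fin 2) : F.real {a | a i ≤ 0} = (andLaw v).real (Set.Iic 0) := by
    rw [← (hN.map_eq hv hH i).1, Measure.real, Measure.real, map_Iic]
  have h1 := mul_andLaw_Iic hv le_rfl (by norm_num)
  rw [hN.utilityOr_eq_sub_half hv hH, Fin.sum_univ_two] at h
  simp only [Pi.zero_apply, hF] at h
  refine le_of_mul_le_mul_left ?_ (by linarith : 0 < v)
  linarith

end IsNashEquilibrium

theorem isNashEquilibrium_iff (hv : 1 / 2 < v) (hH : 1 / 2 < H) (hF : IsMixedStrategy H F) :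
    IsNashEquilibrium v H τ F G ↔ G = orStar ∧ HasStarMarginals v F := by
  refine ⟨fun hN => ⟨hN.eq_orStar hv hH, hN.hasStarMarginals hv hH⟩, ?_⟩
  rintro ⟨rfl, h⟩
  exact h.isNashEquilibrium hv hH hF

theorem jointCDF_max_right (hF : IsMixedStrategy H F) (x : ℝ) :
    jointCDF F x H = F.real {a | a 0 ≤ x} := by
  refine measureReal_congr ?_
  filter_upwards [hF.2] with a ha
  exact propext ⟨fun h => h.1, fun h => ⟨h, (ha 1).2⟩⟩

theorem jointCDF_max_left (hF : IsMixedStrategy H F) (y : ℝ) :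
    jointCDF F H y = F.real {a | a 1 ≤ y} := by
  refine measureReal_congr ?_
  filter_upwards [hF.2] with a ha
  exact propext ⟨fun h => h.2, fun h => ⟨(ha 0).2, h⟩⟩

theorem map_eq_of_Iic {F' : Measure Bid} (hF : IsMixedStrategy H F) (hF' : IsMixedStrategy H F')
    (i : Fin 2) (h : ∀ x ∈ Set.Icc 0 H, F.real {a | a i ≤ x} = F'.real {a | a i ≤ x}) :
    F.map (fun a => a i) = F'.map (fun a => a i) := by
  have := hF.1
  have := hF'.1
  refine Measure.ext_of_Iic _ _ fun x => ?_
  rw [map_Iic, map_Iic]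
  by_cases hx : x ∈ Set.Icc 0 H
  · exact (ENNReal.toReal_eq_toReal_iff' (measure_ne_top _ _) (measure_ne_top _ _)).1 (h x hx)
  have hb : x < 0 ∨ H < x := by
    by_contra! h'
    exact hx h'
  rcases hb with hb | hb
  · have hz {μ : Measure Bid} (hμ : IsMixedStrategy H μ) : μ {a | a i ≤ x} = 0 :=
      measure_eq_zero_iff_ae_notMem.2
        (hμ.2.mono fun a ha => not_le.2 (hb.trans_le (ha i).1))
    rw [hz hF, hz hF']
  · have hz {μ : Measure Bid} (hμ : IsMixedStrategy H μ) : μ {a | a i ≤ x} = 1 := by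
      have := hμ.1
      exact (prob_compl_eq_zero_iff (measurableSet_coord_le i x)).1
        (hμ.2.mono fun a ha => (ha i).2.trans hb.le)
    rw [hz hF, hz hF']

/-- The equilibrium conditions on `AND` in terms of distribution functions. -/
theorem hasStarMarginals_iff (hv : 1 / 2 < v) (hH : 1 / 2 < H) (hF : IsMixedStrategy H F) :
    HasStarMarginals v F ↔ (∀ x ∈ Set.Icc 0 H, jointCDF F x H = jointCDF (andStar v) x H) ∧
      (∀ y ∈ Set.Icc 0 H, jointCDF F H y = jointCDF (andStar v) H y) ∧
      jointCDF F 0 0 = jointCDF (andStar v) 0 0 := by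
  have hS := isMixedStrategy_andStar hv hH
  have hA := hasStarMarginals_andStar (v := v)
  have h0 : jointCDF (andStar v) 0 0 = (andLaw v).real (Set.Iic 0) := hA.measureReal_zero
  simp_rw [jointCDF_max_right hF, jointCDF_max_right hS, jointCDF_max_left hF,
    jointCDF_max_left hS, h0]
  constructor
  · intro h
    exact ⟨fun x _ => by rw [h.measureReal_Iic, hA.measureReal_Iic],
      fun x _ => by rw [h.measureReal_Iic, hA.measureReal_Iic], h.measureReal_zero⟩
  · rintro ⟨h1, h2, h3⟩
    have := hF.1
    refine hasStarMarginals_of_map_eq (fun i => ?_) ?_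
    · rw [← hA.map_eq i]
      refine map_eq_of_Iic hF hS i ?_
      fin_cases i
      · exact h1
      · exact h2
    · rw [← h3]
      simp only [Fin.forall_fin_two]
      rfl

end Uniqueness

end AndOr

end

theorem theorem1 (v H : ℝ) (hv : 1 / 2 < v) (hH : 1 / 2 < H) (τ : AndOr.TieRule) :
    AndOr.IsNashEquilibrium v H τ (AndOr.andStar v) AndOr.orStar ∧
    ∀ F G : MeasureTheory.Measure AndOr.Bid,
      AndOr.IsMixedStrategy H F → AndOr.IsMixedStrategy H G →
      (AndOr.IsNashEquilibrium v H τ F G ↔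
        G = AndOr.orStar ∧
        (∀ x ∈ Set.Icc 0 H, AndOr.jointCDF F x H = AndOr.jointCDF (AndOr.andStar v) x H) ∧
        (∀ y ∈ Set.Icc 0 H, AndOr.jointCDF F H y = AndOr.jointCDF (AndOr.andStar v) H y) ∧
        AndOr.jointCDF F 0 0 = AndOr.jointCDF (AndOr.andStar v) 0 0) ∧
      (AndOr.IsNashEquilibrium v H τ F G →
        AndOr.WeaklyDominatedAnd H τ F (AndOr.andStar v) ∧
        (F ≠ AndOr.andStar v → ∃ G', AndOr.IsMixedStrategy H G' ∧
          AndOr.utilityAnd τ F G' < AndOr.utilityAnd τ (AndOr.andStar v) G') ∧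
        (∀ S, AndOr.bundleProbAnd τ F G S =
          AndOr.bundleProbAnd τ (AndOr.andStar v) AndOr.orStar S) ∧
        (∀ T, AndOr.bundleProbOr τ F G T =
          AndOr.bundleProbOr τ (AndOr.andStar v) AndOr.orStar T) ∧
        AndOr.paymentAnd τ F G = AndOr.paymentAnd τ (AndOr.andStar v) AndOr.orStar ∧
        AndOr.paymentOr τ F G = AndOr.paymentOr τ (AndOr.andStar v) AndOr.orStar ∧
        AndOr.utilityAnd τ F G = AndOr.utilityAnd τ (AndOr.andStar v) AndOr.orStar ∧
        AndOr.utilityOr v τ F G = AndOr.utilityOr v τ (AndOr.andStar v) AndOr.orStar ∧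
        AndOr.revenue τ F G = AndOr.revenue τ (AndOr.andStar v) AndOr.orStar ∧
        AndOr.welfare v τ F G = AndOr.welfare v τ (AndOr.andStar v) AndOr.orStar) := by
  refine ⟨AndOr.hasStarMarginals_andStar.isNashEquilibrium hv hH
      (AndOr.isMixedStrategy_andStar hv hH),
    fun F G hF _ => ⟨?_, fun hN => ?_⟩⟩
  · rw [AndOr.isNashEquilibrium_iff hv hH hF, AndOr.hasStarMarginals_iff hv hH hF]
  · obtain ⟨rfl, h⟩ := (AndOr.isNashEquilibrium_iff hv hH hF).1 hN
    -- each quantity is of the form `c S + d * pay a S + e * pay o Sᶜ`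
    have key := h.expect_orStar hv hH hF (τ := τ)
    refine ⟨h.weaklyDominatedAnd hv hH hF, h.exists_utilityAnd_lt hv hH hF,
      fun S => key (fun S' => if S' = S then 1 else 0) 0 0 fun _ _ _ => by ring,
      fun T => key (fun S' => if S'ᶜ = T then 1 else 0) 0 0 fun _ _ _ => by ring,
      key 0 1 0 fun _ _ _ => by simp, key 0 0 1 fun _ _ _ => by simp,
      key AndOr.valueAnd (-1) 0 fun _ _ _ => by ring,
      key (fun S => AndOr.valueOr v Sᶜ) 0 (-1) fun _ _ _ => by ring,
      key 0 1 1 fun _ _ _ => by simp,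
      key (fun S => AndOr.valueAnd S + AndOr.valueOr v Sᶜ) 0 0 fun _ _ _ => by ring⟩
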